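/- All matrices are complex. Let $1\le n_1<n_2<\dots<n_r=n$. A quiver with these dimensions is a family of linear maps $\alpha_i:\mathbb C^{n_i}\to\mathbb C^{n_{i+1}}$, $\beta_i:\mathbb C^{n_{i+1}}\to\mathbb C^{n_i}$ $(1\le i\le r-1)$; put $\alpha_0\beta_0=0$ and $Y=1+\alpha_{r-1}\beta_{r-1}$. Let $\mathcal S$ be the set of quivers such that all $1+\alpha_i\beta_i$, $1+\beta_i\alpha_i$ are invertible, all $\beta_i$ are surjective, and $$1+\beta_{i+1}\alpha_{i+1}=q_{i+1}(1+\alpha_i\beta_i)\qquad(0\le i\le r-2)$$ for some scalars $q_1,\dots,q_{r-1}\in\mathbb C$. The group $\prod_{i=1}^{r}SL(n_i,\mathbb C)$ acts by $\alpha_i\mapsto g_{i+1}\alpha_ig_i^{-1}$, $\beta_i\mapsto g_i\beta_ig_{i+1}^{-1}$, and $H_{\mathbb C}=\prod_{i=1}^{r-1}SL(n_i,\mathbb C)$. A quiver is in standard form if $\beta_i=(0\;\,I_{n_i})$ for all $i$. For a subgroup $S\subseteq SL(n,\mathbb C)$ acting by conjugation on a variety $F$ of $n\times n$ matrices, $SL(n,\mathbb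 C)\times_SF$ denotes the geometric quotient of $SL(n,\mathbb C)\times F$ by the action $p\cdot(u,v)=(up^{-1},pvp^{-1})$. (1) Full flag case, $r=n$ and $n_i=i$. Let $N$ be the group of upper unitriangular matrices, $B$ the group of upper triangular matrices in $SL(n,\mathbb C)$, and $B_1$ the group of upper triangular matrices in $GL(n,\mathbb C)$ with leading diagonal entry $1$. The map sending a quiver to $Y$ is a bijection from the quivers in $\mathcal S$ in standard form onto $B_1$. The geometric quotients $\mathcal S/H_{\mathbb C}$ and $SL(n,\mathbb C)\times_NB_1$ exist as quasi-affine varieties and are isomorphic, the class of $(g,Y)$ corresponding to the class of $g\cdot x$, where $x\in\mathcal S$ is the quiver in standard form with matrix $Y$. (2) Modified equations, full flag case. Let $\tilde{\mathcal S}$ be the set of pairs of a quiver and scalars $(\tilde q_0,\dots,\tilde q_{n-1})$ with $\tilde q_0\cdots\tilde q_{n-1}=1$, such that all $1+\alpha_i\beta_i$, $1+\beta_i\alpha_i$ are invertible, all $\beta_i$ are surjective and $\tilde q_i(1+\beta_{i+1}\alpha_{i+1})=\tilde q_{i+1}(1+\alpha_i\beta_i)$ for $0\le i\le n-2$; $H_{\mathbb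 C}$ acts trivially on the scalars. The map $(x,\tilde q)\mapsto\tilde q_{n-1}^{-1}Y$ is a bijection from the elements of $\tilde{\mathcal S}$ in standard form onto $B$. The geometric quotients $\tilde{\mathcal S}/H_{\mathbb C}$ and $SL(n,\mathbb C)\times_NB$ exist as quasi-affine varieties and are isomorphic, the class of $(g,\tilde q_{n-1}^{-1}Y)$ corresponding to the class of $(g\cdot x,\tilde q)$ for $(x,\tilde q)\in\tilde{\mathcal S}$ in standard form. Division by the leading diagonal entry defines an $n$-fold covering $\rho:B\to B_1$. Forgetting $\tilde q$ maps $\tilde{\mathcal S}$ to $\mathcal S$ and induces a morphism $\tilde{\mathcal S}/H_{\mathbb C}\to\mathcal S/H_{\mathbb C}$ all of whose fibres have exactly $n$ points and which corresponds to $[g,b]\mapsto[g,\rho(b)]$. (3) General dimensions. Let $P\subseteq SL(n,\mathbb C)$ be the parabolic subgroup of block upper triangular matrices with diagonal blocks of sizes $n_r-n_{r-1},\dots,n_2-n_1,n_1$, and let $\mathcal P\subseteq GL(n,\mathbb C)$ be the variety of block upper triangular matrices, for the same blocks, whose diagonal blocks are scalar, with scalars $1,\,q_{r-1},\,q_{r-1}q_{r-2},\dots,q_{r-1}\cdots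 q_1$ for arbitrary nonzero $q_1,\dots,q_{r-1}$. The map sending a quiver to $Y$ is a bijection from the quivers in $\mathcal S$ in standard form onto $\mathcal P$. The geometric quotients $\mathcal S/H_{\mathbb C}$ and $SL(n,\mathbb C)\times_{[P,P]}\mathcal P$ exist as quasi-affine varieties and are isomorphic, the class of $(g,Y)$ corresponding to the class of $g\cdot x$, where $x\in\mathcal S$ is the quiver in standard form with matrix $Y$. -/

import Mathlib

namespace MultQuiver

noncomputable section

open Matrix

/-- Complex `n × n` matrices. -/
abbrev Mat (n : ℕ) : Type := Matrix (Fin n) (Fin n) ℂ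

/-- The group `SL(n, ℂ)`. -/
abbrev SLC (n : ℕ) : Type := Matrix.SpecialLinearGroup (Fin n) ℂ

/-! ## Quasi-affine complex varieties and geometric quotients

Varieties are subsets of a finite-dimensional complex vector space which are locally closed in the
Zariski topology; maps between them are given by total functions on the ambient spaces, of which
only the restriction to the variety matters. -/

section Varieties

variable {V W : Type*} [AddCommGroup V] [Module ℂ V] [AddCommGroup W] [Module ℂ W]

/-- The algebra of polynomial functions on `V`, generated by the linear functionals. -/
def polyFun (V : Type*) [AddCommGroup V] [Module ℂ V] : Subalgebra ℂ (V → ℂ) :=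
  Algebra.adjoin ℂ (Set.range fun φ : Module.Dual ℂ V => (φ : V → ℂ))

/-- Zariski closed: the common zero set of a family of polynomial functions. -/
def IsZariskiClosed (C : Set V) : Prop :=
  ∃ F : Set (V → ℂ), F ⊆ (polyFun V : Set (V → ℂ)) ∧ C = {v | ∀ f ∈ F, f v = 0}

/-- Zariski open: the complement is Zariski closed. -/
def IsZariskiOpen (O : Set V) : Prop := IsZariskiClosed Oᶜ

/-- `U` is a relatively Zariski open subset of `X`. -/
def IsOpenIn (X U : Set V) : Prop := ∃ O : Set V, IsZariskiOpen O ∧ U = X ∩ O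

/-- `X` is a quasi-affine variety: Zariski locally closed in the ambient space. -/
def IsQuasiAffine (X : Set V) : Prop :=
  ∃ O C : Set V, IsZariskiOpen O ∧ IsZariskiClosed C ∧ X = O ∩ C

/-- `f` is a regular function on `U`: near each point of `U` it is a quotient of polynomials. -/
def IsRegularOn (f : V → ℂ) (U : Set V) : Prop :=
  ∀ p ∈ U, ∃ a ∈ polyFun V, ∃ b ∈ polyFun V, b p ≠ 0 ∧ ∀ z ∈ U, b z ≠ 0 → f z = a z / b z

/-- `φ` restricts to a morphism of varieties `X → Z`. -/
def IsMorphism (φ : V → W) (X : Set V) (Z : Set W) : Prop :=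
  Set.MapsTo φ X Z ∧ ∀ l : Module.Dual ℂ W, IsRegularOn (fun v => l (φ v)) X

/-- `π : X → Z` is a geometric quotient of the variety `X` by the group `G`, with quotient
variety `Z`. -/
structure IsGeometricQuotient {G : Type*} [Group G] (act : G → V → V) (X : Set V)
    (Z : Set W) (π : V → W) : Prop where
  source : IsQuasiAffine X
  target : IsQuasiAffine Z
  stable : ∀ g : G, ∀ x ∈ X, act g x ∈ X
  morphism : IsMorphism π X Z
  surj : Set.SurjOn π X Z
  /-- the fibres are exactly the orbits -/
  orbits : ∀ x ∈ X, ∀ y ∈ X, π x = π y ↔ ∃ g : G, act g x = y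
  /-- the quotient carries the quotient topology -/
  submersive : ∀ U ⊆ Z, IsOpenIn X (X ∩ π ⁻¹' U) → IsOpenIn Z U
  /-- the regular functions on the quotient are the invariant regular functions -/
  functions : ∀ U, IsOpenIn Z U → ∀ h : V → ℂ, IsRegularOn h (X ∩ π ⁻¹' U) →
    (∀ g : G, ∀ x ∈ X ∩ π ⁻¹' U, h (act g x) = h x) →
    ∃ f : W → ℂ, IsRegularOn f U ∧ ∀ x ∈ X ∩ π ⁻¹' U, h x = f (π x)

end Varieties

/-! ## Multiplicative quiver equations

The vertices are `0, …, m`, with dimensions `d 0 < … < d m`; there is a pair of arrows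
`α i : ℂ^(d i) → ℂ^(d (i+1))`, `β i : ℂ^(d (i+1)) → ℂ^(d i)` for each `i < m`. -/

section Quivers

variable {m : ℕ} (d : Fin (m + 1) → ℕ)

/-- Pairs `x = (α, β)` of families of linear maps. -/
abbrev QuiverRep : Type :=
  (∀ i : Fin m, Matrix (Fin (d i.succ)) (Fin (d i.castSucc)) ℂ) ×
    (∀ i : Fin m, Matrix (Fin (d i.castSucc)) (Fin (d i.succ)) ℂ)

variable {d}

/-- The endomorphism `α (j-1) * β (j-1)` at the vertex `j`, which is `0` at the first vertex. -/
def incoming (x : QuiverRep d) : ∀ j : Fin (m + 1), Mat (d j) :=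
  Fin.cases 0 fun i => x.1 i * x.2 i

/-- `Y = 1 + αβ` at the last vertex. -/
def lastY (x : QuiverRep d) : Mat (d (Fin.last m)) :=
  1 + incoming x (Fin.last m)

/-- All `1 + αβ` and `1 + βα` are invertible. -/
def IsMult (x : QuiverRep d) : Prop :=
  ∀ i : Fin m, IsUnit (1 + x.1 i * x.2 i) ∧ IsUnit (1 + x.2 i * x.1 i)

/-- The multiplicative quiver equations with scalars `q`. -/
def MultEq (x : QuiverRep d) (q : Fin m → ℂ) : Prop :=
  ∀ i : Fin m, 1 + x.2 i * x.1 i = q i • (1 + incoming x i.castSucc)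

/-- The modified equations with scalars `t` of product one (one scalar for each vertex). -/
def ModMultEq (x : QuiverRep d) (t : Fin (m + 1) → ℂ) : Prop :=
  ∏ j, t j = 1 ∧
    ∀ i : Fin m, t i.castSucc • (1 + x.2 i * x.1 i) = t i.succ • (1 + incoming x i.castSucc)

/-- All `β i` are surjective. -/
def AllSurj (x : QuiverRep d) : Prop :=
  ∀ i : Fin m, Function.Surjective (x.2 i).mulVec

/-- All `β i` are in the standard form `(0 I)`. -/
def IsStandard (x : QuiverRep d) : Prop :=
  ∀ i : Fin m, ∀ (a : Fin (d i.castSucc)) (b : Fin (d i.succ)), x.2 i a b =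
    if (b : ℕ) + d i.castSucc = (a : ℕ) + d i.succ then 1 else 0

variable (d)

/-- Solutions of the multiplicative quiver equations with all `β i` surjective. -/
def surjSol : Set (QuiverRep d) :=
  {x | IsMult x ∧ (∃ q : Fin m → ℂ, MultEq x q) ∧ AllSurj x}

/-- Solutions `(x, t)` of the modified equations with all `β i` surjective. -/
def modSurjSol : Set (QuiverRep d × (Fin (m + 1) → ℂ)) :=
  {s | IsMult s.1 ∧ ModMultEq s.1 s.2 ∧ AllSurj s.1}

variable {d}

/-- The action `α i ↦ g (i+1) * α i * (g i)⁻¹`, `β i ↦ g i * β i * (g (i+1))⁻¹`. -/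
def act (g : ∀ j : Fin (m + 1), SLC (d j)) (x : QuiverRep d) :
    QuiverRep d :=
  (fun i => (g i.succ : Mat (d i.succ)) * x.1 i *
    (((g i.castSucc)⁻¹ : SLC (d i.castSucc)) : Mat (d i.castSucc)),
    fun i => (g i.castSucc : Mat (d i.castSucc)) * x.2 i *
      (((g i.succ)⁻¹ : SLC (d i.succ)) : Mat (d i.succ)))

/-- `H_ℂ`: the product of the groups `SL(d j)` over all vertices except the last one, realised as
the tuples whose last entry is `1`. -/
def hGroup (d : Fin (m + 1) → ℕ) :
    Subgroup (∀ j : Fin (m + 1), SLC (d j)) where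
  carrier := {g | g (Fin.last m) = 1}
  mul_mem' {a b} ha hb := by
    simp only [Set.mem_ofPred_eq] at ha hb ⊢
    simp [ha, hb]
  one_mem' := rfl
  inv_mem' {a} ha := by
    simp only [Set.mem_ofPred_eq] at ha ⊢
    simp [ha]

/-- The action of `H_ℂ` on quivers. -/
def hAct (h : hGroup d) (x : QuiverRep d) : QuiverRep d := act h.1 x

/-- The action of `H_ℂ` on pairs `(x, t)`, trivial on the scalars. -/
def hActMod (h : hGroup d) (s : QuiverRep d × (Fin (m + 1) → ℂ)) :
    QuiverRep d × (Fin (m + 1) → ℂ) := (act h.1 s.1, s.2)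

/-- The residual action of `SL` at the last vertex. -/
def slAct (g : SLC (d (Fin.last m))) (x : QuiverRep d) : QuiverRep d :=
  act (Pi.mulSingle (Fin.last m) g) x

/-! ## Parabolics -/

variable (d)

/-- The index (from `0` at the top to `m` at the bottom) of the diagonal block containing the
row `a`, that is, the number of `i < m` such that `a` is among the last `d i` rows. The blocks have,
from top to bottom, the sizes `d m - d (m-1), …, d 1 - d 0, d 0`. -/
def blockIdx (a : Fin (d (Fin.last m))) : ℕ :=
  (Finset.univ.filter fun i : Fin m => (a.rev : ℕ) < d i.castSucc).card

/-- The parabolic subgroup of block upper triangular matrices in `SL`. -/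
def parabolic : Subgroup (SLC (d (Fin.last m))) where
  carrier := {g | (g : Mat (d (Fin.last m))).BlockTriangular (blockIdx d)}
  mul_mem' {a b} ha hb := by
    simpa using BlockTriangular.mul ha hb
  one_mem' := by
    simpa using blockTriangular_one
  inv_mem' {a} ha := by
    have : Invertible (a : Mat (d (Fin.last m))) := Matrix.invertibleOfIsUnitDet _ (by simp)
    have h := blockTriangular_inv_of_blockTriangular (M := (a : Mat (d (Fin.last m)))) ha
    have e : ((a⁻¹ : SLC (d (Fin.last m))) : Mat (d (Fin.last m))) = (a : Mat (d (Fin.last m)))⁻¹ := by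
      rw [Matrix.inv_def, Matrix.SpecialLinearGroup.coe_inv]; simp
    rw [← e] at h
    exact h

/-- Block upper triangular matrices with scalar diagonal blocks, the scalars being, from top to
bottom, `1, q (m-1), q (m-1) * q (m-2), …, q (m-1) * ⋯ * q 0` for nonzero scalars `q i`. -/
def scalarBlock : Set (Mat (d (Fin.last m))) :=
  {Y | Y.BlockTriangular (blockIdx d) ∧ ∃ q : Fin m → ℂ, (∀ i, q i ≠ 0) ∧
    ∀ a b, blockIdx d a = blockIdx d b →
      Y a b = if a = b then ∏ i ∈ Finset.univ.filter fun i : Fin m => m ≤ (i : ℕ) + blockIdx d a, q i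
        else 0}

/-- The full flag dimension vector `(1, 2, …, m+1)`. -/
abbrev fullFlag (m : ℕ) : Fin (m + 1) → ℕ := fun i => (i : ℕ) + 1

end Quivers

/-! ## Borel subgroups -/

/-- The Borel subgroup `B` of upper triangular matrices in `SL(n, ℂ)`. -/
def borelSL (n : ℕ) : Subgroup (SLC n) where
  carrier := {g | (g : Mat n).BlockTriangular id}
  mul_mem' {a b} ha hb := by
    simpa using BlockTriangular.mul ha hb
  one_mem' := by
    simpa using blockTriangular_one
  inv_mem' {a} ha := by
    have : Invertible (a : Mat n) := Matrix.invertibleOfIsUnitDet _ (by simp)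
    have h := blockTriangular_inv_of_blockTriangular (M := (a : Mat n)) ha
    have e : ((a⁻¹ : SLC n) : Mat n) = (a : Mat n)⁻¹ := by
      rw [Matrix.inv_def, Matrix.SpecialLinearGroup.coe_inv]; simp
    rw [← e] at h
    exact h

theorem upper_mul_diag {n : ℕ} {M M' : Mat n} (h : M.BlockTriangular id)
    (h' : M'.BlockTriangular id) (a : Fin n) : (M * M') a a = M a a * M' a a := by
  rw [Matrix.mul_apply]
  refine Finset.sum_eq_single a (fun b _ hb => ?_) (by simp)
  rcases lt_or_gt_of_ne hb with hlt | hgt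
  · rw [h (by simpa using hlt), zero_mul]
  · rw [h' (by simpa using hgt), mul_zero]

/-- The maximal unipotent subgroup `N` of upper triangular matrices with unit diagonal. -/
def unip (n : ℕ) : Subgroup (SLC n) where
  carrier := {g | g ∈ borelSL n ∧ ∀ a, (g : Mat n) a a = 1}
  mul_mem' {a b} ha hb := by
    refine ⟨mul_mem ha.1 hb.1, fun i => ?_⟩
    rw [Matrix.SpecialLinearGroup.coe_mul, upper_mul_diag ha.1 hb.1 i, ha.2 i, hb.2 i, one_mul]
  one_mem' := ⟨one_mem _, fun a => by simp⟩
  inv_mem' {a} ha := by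
    have hi := inv_mem ha.1
    refine ⟨hi, fun i => ?_⟩
    have := upper_mul_diag ha.1 hi i
    rw [ha.2 i, one_mul, ← Matrix.SpecialLinearGroup.coe_mul, mul_inv_cancel] at this
    rw [← this]
    simp

/-- The group `B_1` of invertible upper triangular matrices of size `n + 1` with leading diagonal
entry `1`. -/
def borelOne (n : ℕ) : Subgroup (GL (Fin (n + 1)) ℂ) where
  carrier := {g | (g : Mat (n + 1)).BlockTriangular id ∧ (g : Mat (n + 1)) 0 0 = 1}
  mul_mem' {a b} ha hb := by
    refine ⟨by simpa using BlockTriangular.mul ha.1 hb.1, ?_⟩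
    have := upper_mul_diag ha.1 hb.1 0
    simpa [ha.2, hb.2] using this
  one_mem' := ⟨by simpa using blockTriangular_one, by simp⟩
  inv_mem' {a} ha := by
    have : Invertible (a : Mat (n + 1)) := a.invertible
    have h := blockTriangular_inv_of_blockTriangular (M := (a : Mat (n + 1))) ha.1
    rw [← Matrix.coe_units_inv] at h
    refine ⟨h, ?_⟩
    have := upper_mul_diag ha.1 h 0
    rw [ha.2, one_mul] at this
    rw [← this]
    simp

theorem borelSL_diag_ne_zero {n : ℕ} (b : borelSL n) (a : Fin n) :
    (b.1 : Mat n) a a ≠ 0 := by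
  have h : (b.1 : Mat n).det = 1 := b.1.det_coe
  have hb : (b.1 : Mat n).BlockTriangular id := b.2
  rw [Matrix.det_of_isUpperTriangular hb] at h
  intro h0
  have h1 : ∏ i, (b.1 : Mat n) i i = 0 := Finset.prod_eq_zero (Finset.mem_univ a) h0
  exact zero_ne_one (h1.symm.trans h)

/-- The map `ρ : B → B_1` dividing a matrix by its leading diagonal entry. -/
def rho (n : ℕ) (b : borelSL (n + 1)) : borelOne n :=
  ⟨GeneralLinearGroup.mkOfDetNeZero (((b.1 : Mat (n + 1)) 0 0)⁻¹ • (b.1 : Mat (n + 1)))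
      (by
        rw [Matrix.det_smul, b.1.det_coe, mul_one]
        exact pow_ne_zero _ (inv_ne_zero (borelSL_diag_ne_zero b 0))),
    by
      have hb : (b.1 : Mat (n + 1)).BlockTriangular id := b.2
      refine ⟨fun i j hij => ?_, ?_⟩
      · change ((b.1 : Mat (n + 1)) 0 0)⁻¹ * (b.1 : Mat (n + 1)) i j = 0
        rw [hb hij, mul_zero]
      · change ((b.1 : Mat (n + 1)) 0 0)⁻¹ * (b.1 : Mat (n + 1)) 0 0 = 1
        exact inv_mul_cancel₀ (borelSL_diag_ne_zero b 0)⟩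

/-- The matrices belonging to `B`. -/
def borelSet (n : ℕ) : Set (Mat n) :=
  Set.range fun b : borelSL n => (b.1 : Mat n)

/-- The matrices belonging to `B_1`. -/
def borelOneSet (n : ℕ) : Set (Mat (n + 1)) :=
  Set.range fun b : borelOne n => (b.1 : Mat (n + 1))

/-- `SL(n, ℂ) × F` as a set of pairs of matrices. -/
def slProd {n : ℕ} (F : Set (Mat n)) :
    Set (Mat n × Mat n) :=
  {z | z.1.det = 1 ∧ z.2 ∈ F}

/-- The action `(u, v) ↦ (u p⁻¹, p v p⁻¹)` of a subgroup `S` of `SL(n, ℂ)`. The quotient of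
`SL(n, ℂ) × F` by this action is `SL(n, ℂ) ×_S F`. -/
def twist {n : ℕ} (S : Subgroup (SLC n)) (p : S)
    (z : Mat n × Mat n) :
    Mat n × Mat n :=
  (z.1 * ((p.1⁻¹ : SLC n) : Mat n),
    (p.1 : Mat n) * z.2 * ((p.1⁻¹ : SLC n) : Mat n))

end

end MultQuiver

open MultQuiver

/-!
The group `H_ℂ` leaves two things of a quiver unchanged: the matrix `Y` and, for each `j`, the
alternating form `v ↦ det (β_j ⋯ β_{r-1} v)`, whose coefficients are the maximal minors of the
composition of the maps `β`. On a quiver `g · x` with `x` in standard form these are `g v g⁻¹`, with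
`v` the matrix of `x`, and the forms given by the last rows of `g⁻¹`; so they are at the same time
invariants of the pair `(g, v)` under the group of block upper triangular matrices whose lower right
corners have determinant one. By row and column elimination this group is `[P, P]`.

These invariants separate orbits and have regular local sections. Where a product of leading
coefficients of the forms does not vanish, elimination replaces `g⁻¹` by a block lower triangular
representative that is a regular function of the forms alone. Hence the image of the invariant map
is quasi-affine and the map onto it is a geometric quotient of the pairs. Every surjective quiver
can be moved into standard form by `∏ SL(n_i, ℂ)`, because a surjective `β` extends to a unimodular
matrix, so the quotient of the quivers has the same image.

For the modified equations `q̃⁻¹ Y` takes the place of `Y`. The map `ρ` is an open surjective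
homomorphism with finite kernel, hence a covering, and it commutes with conjugation by `N`, so it
descends to the quotients; a fibre of the descended map is a fibre of `ρ`, as `N` acts freely.
-/

namespace MultQuiver

noncomputable section

open Matrix

/-! ## Matrices of functions -/

section HasEntriesIn

variable {X R I J K : Type*} [CommRing R] {S : Subalgebra R (X → R)}

/-- `M` is a matrix of functions on `X` all of whose entries belong to the algebra `S`; it is used
both for polynomial and for regular functions. -/
def HasEntriesIn (S : Subalgebra R (X → R)) (M : X → Matrix I J R) : Prop :=
  ∀ i j, (fun x => M x i j) ∈ S

namespace HasEntriesIn

theorem const (M : Matrix I J R) : HasEntriesIn S fun _ => M := fun i j =>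
  S.algebraMap_mem (M i j)

theorem add {M N : X → Matrix I J R} (hM : HasEntriesIn S M) (hN : HasEntriesIn S N) :
    HasEntriesIn S fun x => M x + N x := fun i j => add_mem (hM i j) (hN i j)

theorem mul [Fintype K] {M : X → Matrix I K R} {N : X → Matrix K J R} (hM : HasEntriesIn S M)
    (hN : HasEntriesIn S N) : HasEntriesIn S fun x => M x * N x := fun i j => by
  have hsum : (fun x => (M x * N x) i j) = ∑ k, (fun x => M x i k) * fun x => N x k j := by
    ext x
    simp only [mul_apply, Finset.sum_apply, Pi.mul_apply]
  exact hsum ▸ sum_mem fun k _ => mul_mem (hM i k) (hN k j)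

variable [Fintype I] [DecidableEq I] {M : X → Matrix I I R}

theorem det (hM : HasEntriesIn S M) : (fun x => (M x).det) ∈ S := by
  have hdet : (fun x => (M x).det) = ∑ σ : Equiv.Perm I,
      algebraMap R (X → R) ((Equiv.Perm.sign σ : ℤ) : R) * ∏ i, fun x => M x (σ i) i := by
    ext x
    simp only [det_apply', Finset.sum_apply, Pi.mul_apply, Pi.algebraMap_apply,
      Algebra.algebraMap_self, RingHom.id_apply, Finset.prod_apply]
  rw [hdet]
  exact sum_mem fun σ _ => mul_mem (S.algebraMap_mem _) (prod_mem fun i _ => hM _ _)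

theorem adjugate (hM : HasEntriesIn S M) : HasEntriesIn S fun x => (M x).adjugate := fun i j => by
  simp only [adjugate_apply]
  refine det fun a b => ?_
  by_cases h : a = j
  · simp only [h, updateRow_self]
    exact S.algebraMap_mem ((Pi.single i 1 : I → R) b : R)
  · simpa only [updateRow_ne h] using hM a b

end HasEntriesIn

end HasEntriesIn

/-! ## Regular functions and regular maps -/

section Regular

variable {V W : Type*} [AddCommGroup V] [Module ℂ V] [AddCommGroup W] [Module ℂ W]

theorem dual_mem_polyFun (l : Module.Dual ℂ V) : (fun v => l v) ∈ polyFun V :=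
  Algebra.subset_adjoin ⟨l, rfl⟩

theorem hasEntriesIn_polyFun_id {I J : Type*} :
    HasEntriesIn (polyFun (Matrix I J ℂ)) fun M : Matrix I J ℂ => M := fun i j =>
  dual_mem_polyFun ((LinearMap.proj j : (J → ℂ) →ₗ[ℂ] ℂ) ∘ₗ
    (LinearMap.proj i : (I → J → ℂ) →ₗ[ℂ] J → ℂ))

namespace IsRegularOn

variable {f g : V → ℂ} {U : Set V}

theorem of_mem_polyFun (hf : f ∈ polyFun V) (U : Set V) : IsRegularOn f U := fun _ _ =>
  ⟨f, hf, 1, one_mem _, one_ne_zero, fun z _ _ => (div_one (f z)).symm⟩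

theorem mono {U' : Set V} (hf : IsRegularOn f U) (h : U' ⊆ U) : IsRegularOn f U' := fun p hp =>
  let ⟨a, ha, b, hb, hbp, hab⟩ := hf p (h hp)
  ⟨a, ha, b, hb, hbp, fun z hz => hab z (h hz)⟩

theorem congr (hf : IsRegularOn f U) (h : ∀ z ∈ U, g z = f z) : IsRegularOn g U := fun p hp =>
  let ⟨a, ha, b, hb, hbp, hab⟩ := hf p hp
  ⟨a, ha, b, hb, hbp, fun z hz hbz => (h z hz).trans (hab z hz hbz)⟩

theorem mul (hf : IsRegularOn f U) (hg : IsRegularOn g U) :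
    IsRegularOn (fun v => f v * g v) U := fun p hp => by
  obtain ⟨a, ha, b, hb, hbp, hab⟩ := hf p hp
  obtain ⟨a', ha', b', hb', hbp', hab'⟩ := hg p hp
  refine ⟨a * a', mul_mem ha ha', b * b', mul_mem hb hb', mul_ne_zero hbp hbp', fun z hz h => ?_⟩
  simp only [hab z hz (left_ne_zero_of_mul h), hab' z hz (right_ne_zero_of_mul h), Pi.mul_apply,
    div_mul_div_comm]

theorem add (hf : IsRegularOn f U) (hg : IsRegularOn g U) :
    IsRegularOn (fun v => f v + g v) U := fun p hp => by
  obtain ⟨a, ha, b, hb, hbp, hab⟩ := hf p hp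
  obtain ⟨a', ha', b', hb', hbp', hab'⟩ := hg p hp
  refine ⟨a * b' + b * a', add_mem (mul_mem ha hb') (mul_mem hb ha'), b * b', mul_mem hb hb',
    mul_ne_zero hbp hbp', fun z hz h => ?_⟩
  have hbz := left_ne_zero_of_mul h
  have hbz' := right_ne_zero_of_mul h
  simp only [hab z hz hbz, hab' z hz hbz', Pi.add_apply, Pi.mul_apply, div_add_div _ _ hbz hbz']

theorem inv (hf : IsRegularOn f U) (h0 : ∀ z ∈ U, f z ≠ 0) :
    IsRegularOn (fun v => (f v)⁻¹) U := fun p hp => by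
  obtain ⟨a, ha, b, hb, hbp, hab⟩ := hf p hp
  have hap : a p ≠ 0 := fun h => h0 p hp (by rw [hab p hp hbp, h, zero_div])
  -- The factor `b` keeps the denominator from vanishing where `f` is not `a / b`.
  refine ⟨b * b, mul_mem hb hb, a * b, mul_mem ha hb, mul_ne_zero hap hbp, fun z hz h => ?_⟩
  have hbz := right_ne_zero_of_mul h
  simp only [hab z hz hbz, inv_div, Pi.mul_apply, mul_div_mul_right _ _ hbz]

theorem of_local (h : ∀ p ∈ U, ∃ c ∈ polyFun V, c p ≠ 0 ∧ IsRegularOn f (U ∩ {z | c z ≠ 0})) :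
    IsRegularOn f U := fun p hp => by
  obtain ⟨c, hc, hcp, hf⟩ := h p hp
  obtain ⟨a, ha, b, hb, hbp, hab⟩ := hf p ⟨hp, hcp⟩
  refine ⟨a * c, mul_mem ha hc, b * c, mul_mem hb hc, mul_ne_zero hbp hcp, fun z hz hbc => ?_⟩
  have hcz := right_ne_zero_of_mul hbc
  simp only [hab z ⟨hz, hcz⟩ (left_ne_zero_of_mul hbc), Pi.mul_apply, mul_div_mul_right _ _ hcz]

end IsRegularOn

/-- The algebra of functions that are regular on `U`. -/
def regularFun (U : Set V) : Subalgebra ℂ (V → ℂ) where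
  carrier := {f | IsRegularOn f U}
  mul_mem' hf hg := hf.mul hg
  add_mem' hf hg := hf.add hg
  algebraMap_mem' c := .of_mem_polyFun ((polyFun V).algebraMap_mem c) U

namespace IsRegularOn

variable {f g : V → ℂ} {U : Set V}

theorem const (c : ℂ) (U : Set V) : IsRegularOn (fun _ => c) U := (regularFun U).algebraMap_mem c

theorem sub (hf : IsRegularOn f U) (hg : IsRegularOn g U) : IsRegularOn (fun v => f v - g v) U :=
  (regularFun U).sub_mem hf hg

theorem div (hf : IsRegularOn f U) (hg : IsRegularOn g U) (h0 : ∀ z ∈ U, g z ≠ 0) :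
    IsRegularOn (fun v => f v / g v) U :=
  (hf.mul (hg.inv h0)).congr fun _ _ => div_eq_mul_inv _ _

theorem sum {ι : Type*} (s : Finset ι) {F : ι → V → ℂ} (h : ∀ i ∈ s, IsRegularOn (F i) U) :
    IsRegularOn (fun v => ∑ i ∈ s, F i v) U := by
  change (fun v => ∑ i ∈ s, F i v) ∈ regularFun U
  simpa only [Finset.sum_fn] using (regularFun U).sum_mem h

theorem prod {ι : Type*} (s : Finset ι) {F : ι → V → ℂ} (h : ∀ i ∈ s, IsRegularOn (F i) U) :
    IsRegularOn (fun v => ∏ i ∈ s, F i v) U := by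
  change (fun v => ∏ i ∈ s, F i v) ∈ regularFun U
  simpa only [Finset.prod_fn] using (regularFun U).prod_mem h

end IsRegularOn

/-- `φ` is given by regular functions on `U`; this is the part of `IsMorphism` that does not
mention the target. -/
def IsRegularMap (φ : V → W) (U : Set V) : Prop :=
  ∀ l : Module.Dual ℂ W, IsRegularOn (fun v => l (φ v)) U

namespace IsRegularMap

variable {φ : V → W} {U : Set V}

theorem mono {U' : Set V} (hφ : IsRegularMap φ U) (h : U' ⊆ U) : IsRegularMap φ U' :=
  fun l => (hφ l).mono h

theorem congr {ψ : V → W} (hφ : IsRegularMap φ U) (h : ∀ z ∈ U, ψ z = φ z) : IsRegularMap ψ U :=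
  fun l => (hφ l).congr fun z hz => by rw [h z hz]

theorem polyFun_comp (hφ : IsRegularMap φ U) {f : W → ℂ} (hf : f ∈ polyFun W) :
    IsRegularOn (fun v => f (φ v)) U := by
  induction hf using Algebra.adjoin_induction with
  | mem f hf => obtain ⟨l, rfl⟩ := hf; exact hφ l
  | algebraMap c => exact .const c U
  | add f g _ _ hf hg => exact hf.add hg
  | mul f g _ _ hf hg => exact hf.mul hg

theorem regularOn_comp (hφ : IsRegularMap φ U) {f : W → ℂ} {U' : Set W} (hf : IsRegularOn f U')
    (hU : Set.MapsTo φ U U') : IsRegularOn (fun v => f (φ v)) U := by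
  refine .of_local fun p hp => ?_
  obtain ⟨a, ha, b, hb, hbp, hab⟩ := hf (φ p) (hU hp)
  obtain ⟨r, hr, s, hs, hsp, hrs⟩ := hφ.polyFun_comp hb p hp
  beta_reduce at hrs
  have hrp : r p ≠ 0 := fun h => hbp (by rw [hrs p hp hsp, h, zero_div])
  -- On the locus `r s ≠ 0` the denominator `b ∘ φ = r / s` has no zeros.
  refine ⟨r * s, mul_mem hr hs, mul_ne_zero hrp hsp, ?_⟩
  have hbφ : ∀ z ∈ U ∩ {z | (r * s) z ≠ 0}, b (φ z) ≠ 0 := fun z hz => by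
    rw [hrs z hz.1 (right_ne_zero_of_mul hz.2)]
    exact div_ne_zero (left_ne_zero_of_mul hz.2) (right_ne_zero_of_mul hz.2)
  have hφ' := hφ.mono (Set.inter_subset_left (t := {z | (r * s) z ≠ 0}))
  exact ((hφ'.polyFun_comp ha).div (hφ'.polyFun_comp hb) hbφ).congr fun z hz =>
    hab _ (hU hz.1) (hbφ z hz)

theorem comp {W' : Type*} [AddCommGroup W'] [Module ℂ W'] {ψ : W → W'} {U' : Set W}
    (hψ : IsRegularMap ψ U') (hφ : IsRegularMap φ U) (hU : Set.MapsTo φ U U') :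
    IsRegularMap (fun v => ψ (φ v)) U := fun l => hφ.regularOn_comp (hψ l) hU

theorem linear (T : V →ₗ[ℂ] W) (U : Set V) : IsRegularMap (fun v => T v) U :=
  fun l => .of_mem_polyFun (dual_mem_polyFun (l ∘ₗ T)) U

theorem linear_comp {W' : Type*} [AddCommGroup W'] [Module ℂ W'] (hφ : IsRegularMap φ U)
    (T : W →ₗ[ℂ] W') : IsRegularMap (fun v => T (φ v)) U := fun l => hφ (l ∘ₗ T)

theorem prodMk {W' : Type*} [AddCommGroup W'] [Module ℂ W'] {ψ : V → W'}
    (hφ : IsRegularMap φ U) (hψ : IsRegularMap ψ U) : IsRegularMap (fun v => (φ v, ψ v)) U :=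
  fun l => ((hφ (l ∘ₗ LinearMap.inl ℂ W W')).add (hψ (l ∘ₗ LinearMap.inr ℂ W W'))).congr
    fun z _ => by simp [← map_add]

theorem pi {ι : Type*} [Finite ι] {E : ι → Type*} [∀ i, AddCommGroup (E i)]
    [∀ i, Module ℂ (E i)] {ψ : V → ∀ i, E i} (h : ∀ i, IsRegularMap (fun v => ψ v i) U) :
    IsRegularMap ψ U := by
  classical
  have := Fintype.ofFinite ι
  refine fun l => (IsRegularOn.sum Finset.univ fun i _ =>
    h i (l ∘ₗ LinearMap.single ℂ E i)).congr fun z _ => ?_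
  simp only [LinearMap.comp_apply, LinearMap.coe_single]
  rw [← map_sum, Finset.univ_sum_single]

theorem apply_pi {ι : Type*} {E : ι → Type*} [∀ i, AddCommGroup (E i)]
    [∀ i, Module ℂ (E i)] {ψ : V → ∀ i, E i} (h : IsRegularMap ψ U) (i : ι) :
    IsRegularMap (fun v => ψ v i) U := h.linear_comp (LinearMap.proj i)

theorem of_regularOn {f : V → ℂ} (h : IsRegularOn f U) : IsRegularMap f U := fun l =>
  ((IsRegularOn.const (l 1) U).mul h).congr fun z _ => by
    rw [mul_comm, ← smul_eq_mul, ← l.map_smul, smul_eq_mul, mul_one]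

theorem regularOn {f : V → ℂ} (h : IsRegularMap f U) : IsRegularOn f U := h LinearMap.id

theorem fst {W' : Type*} [AddCommGroup W'] [Module ℂ W'] {ψ : V → W × W'}
    (h : IsRegularMap ψ U) : IsRegularMap (fun v => (ψ v).1) U :=
  h.linear_comp (LinearMap.fst ℂ W W')

theorem snd {W' : Type*} [AddCommGroup W'] [Module ℂ W'] {ψ : V → W × W'}
    (h : IsRegularMap ψ U) : IsRegularMap (fun v => (ψ v).2) U :=
  h.linear_comp (LinearMap.snd ℂ W W')

theorem id (U : Set V) : IsRegularMap (fun v => v) U := linear LinearMap.id U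

theorem const (w : W) (U : Set V) : IsRegularMap (fun _ => w) U := fun l => .const (l w) U

theorem add {ψ : V → W} (hφ : IsRegularMap φ U) (hψ : IsRegularMap ψ U) :
    IsRegularMap (fun v => φ v + ψ v) U := fun l =>
  ((hφ l).add (hψ l)).congr fun _ _ => map_add l _ _

theorem sub {ψ : V → W} (hφ : IsRegularMap φ U) (hψ : IsRegularMap ψ U) :
    IsRegularMap (fun v => φ v - ψ v) U := fun l =>
  ((hφ l).sub (hψ l)).congr fun _ _ => map_sub l _ _

theorem smul {f : V → ℂ} (hf : IsRegularOn f U) (hφ : IsRegularMap φ U) :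
    IsRegularMap (fun v => f v • φ v) U := fun l =>
  (hf.mul (hφ l)).congr fun _ _ => map_smul l _ _

section Matrices

variable {I J K : Type*}

theorem hasEntriesIn {A : V → Matrix I J ℂ} (hA : IsRegularMap A U) :
    HasEntriesIn (regularFun U) A := fun i j => regularOn (apply_pi (apply_pi (ψ := A) hA i) j)

theorem of_hasEntriesIn [Finite I] [Finite J] {A : V → Matrix I J ℂ}
    (h : HasEntriesIn (regularFun U) A) : IsRegularMap A U :=
  pi (ψ := A) fun i => pi fun j => of_regularOn (h i j)

theorem matMul [Finite I] [Finite J] [Fintype K] {A : V → Matrix I K ℂ} {B : V → Matrix K J ℂ}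
    (hA : IsRegularMap A U) (hB : IsRegularMap B U) : IsRegularMap (fun v => A v * B v) U :=
  of_hasEntriesIn (hA.hasEntriesIn.mul hB.hasEntriesIn)

theorem adjugate {N : Type*} [Fintype N] [DecidableEq N] {A : V → Matrix N N ℂ}
    (hA : IsRegularMap A U) : IsRegularMap (fun v => (A v).adjugate) U :=
  of_hasEntriesIn hA.hasEntriesIn.adjugate

end Matrices

end IsRegularMap

end Regular

/-! ## Locally closed sets -/

section ZariskiTopology

variable {V W : Type*} [AddCommGroup V] [Module ℂ V] [AddCommGroup W] [Module ℂ W]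

/-- The smallest Zariski closed set containing `Z`. -/
def zariskiClosure (Z : Set V) : Set V :=
  {w | ∀ e ∈ polyFun V, (∀ z ∈ Z, e z = 0) → e w = 0}

theorem subset_zariskiClosure (Z : Set V) : Z ⊆ zariskiClosure Z := fun _ hw _ _ he => he _ hw

theorem isZariskiClosed_zariskiClosure (Z : Set V) : IsZariskiClosed (zariskiClosure Z) :=
  ⟨{e | e ∈ polyFun V ∧ ∀ z ∈ Z, e z = 0}, fun _ he => he.1,
    Set.ext fun _ => ⟨fun hw e he => hw e he.1 he.2, fun hw e he he0 => hw e ⟨he, he0⟩⟩⟩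

theorem zariskiClosure_subset {Z C : Set V} (hC : IsZariskiClosed C) (h : Z ⊆ C) :
    zariskiClosure Z ⊆ C := by
  obtain ⟨F, hF, rfl⟩ := hC
  exact fun w hw f hf => hw f (hF hf) fun z hz => h hz f hf

theorem isZariskiOpen_iff {O : Set V} :
    IsZariskiOpen O ↔ ∀ p ∈ O, ∃ c ∈ polyFun V, c p ≠ 0 ∧ {z | c z ≠ 0} ⊆ O := by
  constructor
  · rintro ⟨F, hF, hO⟩ p hp
    have hmem : ∀ z, z ∉ O ↔ ∀ f ∈ F, f z = 0 := fun z => Set.ext_iff.1 hO z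
    obtain ⟨c, hcF, hcp⟩ : ∃ c ∈ F, c p ≠ 0 := by
      by_contra! h
      exact (hmem p).2 h hp
    exact ⟨c, hF hcF, hcp, fun z hz => by_contra fun hzO => hz ((hmem z).1 hzO c hcF)⟩
  · intro h
    refine ⟨{c | c ∈ polyFun V ∧ {z | c z ≠ 0} ⊆ O}, fun c hc => hc.1, Set.ext fun z => ?_⟩
    refine ⟨fun hz c hc => by_contra fun hcz => hz (hc.2 hcz), fun hz hzO => ?_⟩
    obtain ⟨c, hc, hcz, hcO⟩ := h z hzO
    exact hcz (hz c ⟨hc, hcO⟩)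

theorem isOpenIn_iff {X U : Set V} : IsOpenIn X U ↔
    U ⊆ X ∧ ∀ p ∈ U, ∃ c ∈ polyFun V, c p ≠ 0 ∧ X ∩ {z | c z ≠ 0} ⊆ U := by
  constructor
  · rintro ⟨O, hO, rfl⟩
    refine ⟨Set.inter_subset_left, fun p hp => ?_⟩
    obtain ⟨c, hc, hcp, hcO⟩ := isZariskiOpen_iff.1 hO p hp.2
    exact ⟨c, hc, hcp, Set.inter_subset_inter_right X hcO⟩
  · rintro ⟨hUX, h⟩
    refine ⟨⋃₀ {D | X ∩ D ⊆ U ∧ ∃ c ∈ polyFun V, D = {z | c z ≠ 0}},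
      isZariskiOpen_iff.2 ?_, subset_antisymm (fun p hp => ?_) ?_⟩
    · rintro p ⟨_, ⟨hD, c, hc, rfl⟩, hcp⟩
      exact ⟨c, hc, hcp, Set.subset_sUnion_of_mem ⟨hD, c, hc, rfl⟩⟩
    · obtain ⟨c, hc, hcp, hcU⟩ := h p hp
      exact ⟨hUX hp, _, ⟨hcU, c, hc, rfl⟩, hcp⟩
    · rintro z ⟨hz, D, ⟨hD, -⟩, hzD⟩
      exact hD ⟨hz, hzD⟩

theorem isOpenIn_self (X : Set V) : IsOpenIn X X :=
  isOpenIn_iff.2 ⟨subset_rfl, fun _ _ =>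
    ⟨1, one_mem (polyFun V), one_ne_zero, Set.inter_subset_left⟩⟩

theorem isQuasiAffine_iff {Z : Set V} : IsQuasiAffine Z ↔
    ∀ z ∈ Z, ∃ c ∈ polyFun V, c z ≠ 0 ∧ zariskiClosure Z ∩ {w | c w ≠ 0} ⊆ Z := by
  have hopen : IsOpenIn (zariskiClosure Z) Z ↔
      ∀ z ∈ Z, ∃ c ∈ polyFun V, c z ≠ 0 ∧ zariskiClosure Z ∩ {w | c w ≠ 0} ⊆ Z := by
    rw [isOpenIn_iff, and_iff_right (subset_zariskiClosure Z)]
  rw [← hopen]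
  constructor
  · rintro ⟨O, C, hO, hC, hZ⟩
    refine ⟨O, hO, subset_antisymm
      (Set.subset_inter (subset_zariskiClosure Z) (hZ.trans_subset Set.inter_subset_left)) ?_⟩
    rintro w ⟨hwZ, hwO⟩
    exact hZ ▸ ⟨hwO, zariskiClosure_subset hC (hZ.trans_subset Set.inter_subset_right) hwZ⟩
  · rintro ⟨O, hO, hZ⟩
    exact ⟨O, _, hO, isZariskiClosed_zariskiClosure Z, hZ.trans (Set.inter_comm _ _)⟩

theorem isQuasiAffine_of_conditions {ι : Type*} [Finite ι] {Z : Set V} (F : ι → Set (V → ℂ))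
    (E : Set (V → ℂ)) (hF : ∀ i, F i ⊆ polyFun V) (hE : E ⊆ polyFun V)
    (hZ : ∀ v, v ∈ Z ↔ (∀ i, ∃ f ∈ F i, f v ≠ 0) ∧ ∀ e ∈ E, e v = 0) : IsQuasiAffine Z := by
  have := Fintype.ofFinite ι
  refine isQuasiAffine_iff.2 fun z hz => ?_
  choose f hfF hf using ((hZ z).1 hz).1
  refine ⟨∏ i, f i, prod_mem fun i _ => hF i (hfF i), ?_, ?_⟩
  · rw [Finset.prod_apply, Finset.prod_ne_zero_iff]
    exact fun i _ => hf i
  · rintro w ⟨hwZ, hfw⟩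
    rw [Set.mem_ofPred_eq, Finset.prod_apply, Finset.prod_ne_zero_iff] at hfw
    exact (hZ w).2 ⟨fun i => ⟨f i, hfF i, hfw i (Finset.mem_univ i)⟩,
      fun e he => hwZ e (hE he) fun z' hz' => ((hZ z').1 hz').2 e he⟩

theorem IsRegularOn.eq_zero_of_mem_zariskiClosure {R c : V → ℂ} {Z : Set V} (hc : c ∈ polyFun V)
    (hR : IsRegularOn R (zariskiClosure Z ∩ {w | c w ≠ 0}))
    (hRZ : ∀ z ∈ Z, c z ≠ 0 → R z = 0) {w : V} (hw : w ∈ zariskiClosure Z) (hcw : c w ≠ 0) :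
    R w = 0 := by
  obtain ⟨a, ha, b, hb, hbw, hab⟩ := hR w ⟨hw, hcw⟩
  have hvanish : ∀ z ∈ Z, (a * b * c) z = 0 := fun z hz => by
    by_contra h
    have hcz := right_ne_zero_of_mul h
    have hbz := right_ne_zero_of_mul (left_ne_zero_of_mul h)
    have hRz := hab z ⟨subset_zariskiClosure Z hz, hcz⟩ hbz
    rw [hRZ z hz hcz, eq_comm, div_eq_zero_iff] at hRz
    exact hRz.elim (left_ne_zero_of_mul (left_ne_zero_of_mul h)) hbz
  have h0 := hw _ (mul_mem (mul_mem ha hb) hc) hvanish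
  rw [hab w ⟨hw, hcw⟩ hbw, (mul_eq_zero.1 ((mul_eq_zero.1 h0).resolve_right hcw)).resolve_right hbw,
    zero_div]

theorem IsRegularOn.exists_poly_ne_zero {R c : V → ℂ} {Z : Set V} (hc : c ∈ polyFun V)
    (hR : IsRegularOn R (Z ∩ {w | c w ≠ 0})) {z : V} (hzZ : z ∈ Z) (hcz : c z ≠ 0)
    (hz : R z ≠ 0) : ∃ c' ∈ polyFun V, c' z ≠ 0 ∧ ∀ w ∈ Z, c' w ≠ 0 → c w ≠ 0 ∧ R w ≠ 0 := by
  obtain ⟨a, ha, b, hb, hbz, hab⟩ := hR z ⟨hzZ, hcz⟩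
  have haz : a z ≠ 0 := fun h => hz (by rw [hab z ⟨hzZ, hcz⟩ hbz, h, zero_div])
  refine ⟨a * b * c, mul_mem (mul_mem ha hb) hc, mul_ne_zero (mul_ne_zero haz hbz) hcz,
    fun w hwZ hw => ?_⟩
  have hab0 := left_ne_zero_of_mul hw
  have hcw := right_ne_zero_of_mul hw
  refine ⟨hcw, ?_⟩
  rw [hab w ⟨hwZ, hcw⟩ (right_ne_zero_of_mul hab0)]
  exact div_ne_zero (left_ne_zero_of_mul hab0) (right_ne_zero_of_mul hab0)

theorem IsRegularMap.mem_zariskiClosure {σ : W → V} {c : W → ℂ} {Z : Set W} {X : Set V}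
    (hc : c ∈ polyFun W) (hσ : IsRegularMap σ (zariskiClosure Z ∩ {w | c w ≠ 0}))
    (hX : ∀ z ∈ Z, c z ≠ 0 → σ z ∈ X) {w : W} (hw : w ∈ zariskiClosure Z) (hcw : c w ≠ 0) :
    σ w ∈ zariskiClosure X := fun _ he he0 =>
  (hσ.polyFun_comp he).eq_zero_of_mem_zariskiClosure hc (fun z hz hcz => he0 _ (hX z hz hcz)) hw hcw

theorem IsRegularMap.eqOn_zariskiClosure {φ ψ : V → W} {c : V → ℂ} {Z : Set V}
    (hc : c ∈ polyFun V) (hφ : IsRegularMap φ (zariskiClosure Z ∩ {w | c w ≠ 0}))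
    (hψ : IsRegularMap ψ (zariskiClosure Z ∩ {w | c w ≠ 0}))
    (h : ∀ z ∈ Z, c z ≠ 0 → φ z = ψ z) {w : V} (hw : w ∈ zariskiClosure Z) (hcw : c w ≠ 0) :
    φ w = ψ w := by
  rw [← sub_eq_zero, ← Module.forall_dual_apply_eq_zero_iff ℂ]
  refine fun l => IsRegularOn.eq_zero_of_mem_zariskiClosure (R := fun v => l (φ v - ψ v)) hc
    ((hφ.sub hψ) l) (fun z hz hcz => ?_) hw hcw
  rw [h z hz hcz, sub_self, map_zero]

theorem polyFun_comp_linear {f : W → ℂ} (hf : f ∈ polyFun W) (L : V →ₗ[ℂ] W) :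
    (fun v => f (L v)) ∈ polyFun V := by
  induction hf using Algebra.adjoin_induction with
  | mem f hf => obtain ⟨l, rfl⟩ := hf; exact dual_mem_polyFun (l ∘ₗ L)
  | algebraMap c => exact (polyFun V).algebraMap_mem c
  | add f g _ _ hf hg => exact add_mem hf hg
  | mul f g _ _ hf hg => exact mul_mem hf hg

theorem IsZariskiClosed.preimage {C : Set W} (hC : IsZariskiClosed C) (L : V →ₗ[ℂ] W) :
    IsZariskiClosed (L ⁻¹' C) := by
  obtain ⟨F, hF, rfl⟩ := hC
  refine ⟨(fun (f : W → ℂ) (v : V) => f (L v)) '' F, ?_, ?_⟩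
  · rintro _ ⟨f, hf, rfl⟩
    exact polyFun_comp_linear (hF hf) L
  · ext v
    simp only [Set.mem_preimage, Set.mem_ofPred_eq, Set.forall_mem_image]

theorem IsZariskiClosed.inter {C C' : Set V} (hC : IsZariskiClosed C) (hC' : IsZariskiClosed C') :
    IsZariskiClosed (C ∩ C') := by
  obtain ⟨F, hF, rfl⟩ := hC
  obtain ⟨F', hF', rfl⟩ := hC'
  refine ⟨F ∪ F', Set.union_subset hF hF', ?_⟩
  ext v
  simp only [Set.mem_inter_iff, Set.mem_ofPred_eq, Set.mem_union, or_imp, forall_and]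

theorem IsQuasiAffine.inter_isZariskiClosed {Z C : Set V} (hZ : IsQuasiAffine Z)
    (hC : IsZariskiClosed C) : IsQuasiAffine (Z ∩ C) :=
  let ⟨O, C', hO, hC', hZO⟩ := hZ
  ⟨O, C' ∩ C, hO, hC'.inter hC, by rw [hZO, Set.inter_assoc]⟩

theorem IsOpenIn.preimage {X U : Set W} (hU : IsOpenIn X U) (L : V →ₗ[ℂ] W) :
    IsOpenIn (L ⁻¹' X) (L ⁻¹' U) :=
  let ⟨O, hO, hUO⟩ := hU
  ⟨L ⁻¹' O, IsZariskiClosed.preimage hO L, by rw [hUO, Set.preimage_inter]⟩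

theorem IsQuasiAffine.preimage {Z : Set W} (hZ : IsQuasiAffine Z) (L : V →ₗ[ℂ] W) :
    IsQuasiAffine (L ⁻¹' Z) :=
  let ⟨O, C, hO, hC, hZO⟩ := hZ
  ⟨L ⁻¹' O, L ⁻¹' C, IsZariskiClosed.preimage hO L, hC.preimage L,
    by rw [hZO, Set.preimage_inter]⟩

end ZariskiTopology

/-! ## Geometric quotients -/

section Quotients

variable {V W : Type*} [AddCommGroup V] [Module ℂ V] [AddCommGroup W] [Module ℂ W]

/-- A regular section of `π` over the part of `π '' X` on which the polynomial `c` does not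
vanish. -/
structure IsLocalSection (X : Set V) (π : V → W) (c : W → ℂ) (σ : W → V) : Prop where
  poly : c ∈ polyFun W
  regular : IsRegularMap σ (π '' X ∩ {w | c w ≠ 0})
  mem : ∀ w ∈ π '' X, c w ≠ 0 → σ w ∈ X
  right_inv : ∀ w ∈ π '' X, c w ≠ 0 → π (σ w) = w

variable {X : Set V} {π : V → W}

theorem isQuasiAffine_image (hX : IsQuasiAffine X) (hπ : IsRegularMap π X)
    (hσ : ∀ z ∈ π '' X, ∃ c σ, c z ≠ 0 ∧ IsLocalSection X π c σ ∧
      IsRegularMap σ {w | c w ≠ 0}) : IsQuasiAffine (π '' X) := by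
  refine isQuasiAffine_iff.2 fun z hz => ?_
  obtain ⟨c, σ, hcz, h, hreg⟩ := hσ z hz
  obtain ⟨cX, hcX, hcXz, hcXX⟩ := isQuasiAffine_iff.1 hX (σ z) (h.mem z hz hcz)
  obtain ⟨c', hc', hc'z, hc'0⟩ :=
    IsRegularOn.exists_poly_ne_zero (Z := Set.univ) h.poly
      ((hreg.polyFun_comp hcX).mono Set.inter_subset_right) trivial hcz hcXz
  have hc'c : ∀ w, c' w ≠ 0 → c w ≠ 0 := fun w hw => (hc'0 w trivial hw).1
  refine ⟨c', hc', hc'z, fun w ⟨hw, hc'w⟩ => ?_⟩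
  have hregZ : ∀ f : W → ℂ, (∀ w, f w ≠ 0 → c w ≠ 0) →
      IsRegularMap σ (zariskiClosure (π '' X) ∩ {w | f w ≠ 0}) :=
    fun f hf => hreg.mono fun w hw => hf w hw.2
  have hmaps : Set.MapsTo σ (zariskiClosure (π '' X) ∩ {w | c' w ≠ 0}) X := fun v hv =>
    hcXX ⟨(hregZ c fun _ => id).mem_zariskiClosure h.poly h.mem hv.1 (hc'c v hv.2),
      (hc'0 v trivial hv.2).2⟩
  exact ⟨σ w, hmaps ⟨hw, hc'w⟩, (hπ.comp (hregZ c' hc'c) hmaps).eqOn_zariskiClosure hc' (.id _)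
    (fun z' hz' hz'0 => h.right_inv z' hz' (hc'c z' hz'0)) hw hc'w⟩

theorem isOpenIn_image_of_sections (hσ : ∀ z ∈ π '' X, ∃ c σ, c z ≠ 0 ∧ IsLocalSection X π c σ)
    {U : Set W} (hU : U ⊆ π '' X) (hopen : IsOpenIn X (X ∩ π ⁻¹' U)) : IsOpenIn (π '' X) U := by
  refine isOpenIn_iff.2 ⟨hU, fun z hz => ?_⟩
  obtain ⟨c, σ, hcz, h⟩ := hσ z (hU hz)
  have hσz : σ z ∈ X ∩ π ⁻¹' U :=
    ⟨h.mem z (hU hz) hcz, by rwa [Set.mem_preimage, h.right_inv z (hU hz) hcz]⟩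
  obtain ⟨c₁, hc₁, hc₁z, hc₁U⟩ := (isOpenIn_iff.1 hopen).2 (σ z) hσz
  obtain ⟨c', hc', hc'z, hc'0⟩ :=
    (h.regular.polyFun_comp hc₁).exists_poly_ne_zero h.poly (hU hz) hcz hc₁z
  refine ⟨c', hc', hc'z, fun w ⟨hw, hc'w⟩ => ?_⟩
  obtain ⟨hcw, hc₁w⟩ := hc'0 w hw hc'w
  have hσw := (hc₁U ⟨h.mem w hw hcw, hc₁w⟩).2
  rwa [Set.mem_preimage, h.right_inv w hw hcw] at hσw

theorem exists_regularOn_of_sections (hσ : ∀ z ∈ π '' X, ∃ c σ, c z ≠ 0 ∧ IsLocalSection X π c σ)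
    {U : Set W} (hU : U ⊆ π '' X) {f : V → ℂ} (hf : IsRegularOn f (X ∩ π ⁻¹' U))
    (hconst : ∀ x ∈ X ∩ π ⁻¹' U, ∀ y ∈ X ∩ π ⁻¹' U, π x = π y → f x = f y) :
    ∃ f' : W → ℂ, IsRegularOn f' U ∧ ∀ x ∈ X ∩ π ⁻¹' U, f x = f' (π x) := by
  choose! s hsX hsπ using fun w (hw : w ∈ U) => hU hw
  have hs : ∀ x ∈ X ∩ π ⁻¹' U, f x = f (s (π x)) := fun x hx =>
    hconst x hx _ ⟨hsX _ hx.2, by rw [Set.mem_preimage, hsπ _ hx.2]; exact hx.2⟩ (hsπ _ hx.2).symm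
  refine ⟨fun w => f (s w), .of_local fun z hz => ?_, hs⟩
  obtain ⟨c, σ, hcz, h⟩ := hσ z (hU hz)
  refine ⟨c, h.poly, hcz, ?_⟩
  have hmaps : Set.MapsTo σ (U ∩ {w | c w ≠ 0}) (X ∩ π ⁻¹' U) := fun w hw =>
    ⟨h.mem w (hU hw.1) hw.2, by rw [Set.mem_preimage, h.right_inv w (hU hw.1) hw.2]; exact hw.1⟩
  refine ((h.regular.mono (Set.inter_subset_inter_left _ hU)).regularOn_comp hf hmaps).congr
    fun w hw => ?_
  rw [hs _ (hmaps hw), h.right_inv w (hU hw.1) hw.2]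

theorem isGeometricQuotient_of_sections {G : Type*} [Group G] {act : G → V → V}
    (hX : IsQuasiAffine X) (hstable : ∀ g : G, ∀ x ∈ X, act g x ∈ X) (hπ : IsRegularMap π X)
    (horb : ∀ x ∈ X, ∀ y ∈ X, π x = π y ↔ ∃ g : G, act g x = y) (hZ : IsQuasiAffine (π '' X))
    (hσ : ∀ z ∈ π '' X, ∃ c σ, c z ≠ 0 ∧ IsLocalSection X π c σ) :
    IsGeometricQuotient act X (π '' X) π where
  source := hX
  target := hZ
  stable := hstable
  morphism := ⟨Set.mapsTo_image π X, hπ⟩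
  surj := Set.surjOn_image π X
  orbits := horb
  submersive _ hU hopen := isOpenIn_image_of_sections hσ hU hopen
  functions _ hU _ hf hinv := exists_regularOn_of_sections hσ (isOpenIn_iff.1 hU).1 hf
    fun x hx y hy hxy => by
      obtain ⟨g, rfl⟩ := (horb x hx.1 y hy.1).1 hxy
      exact (hinv g x hx).symm

theorem IsLocalSection.comp_map {V' : Type*} [AddCommGroup V'] [Module ℂ V'] {X' : Set V'}
    {π' : V' → W} {φ : V → V'} {c : W → ℂ} {σ : W → V}
    (h : IsLocalSection X π c σ) (hφ : IsRegularMap φ X)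
    (hmaps : Set.MapsTo φ X X') (hcomp : ∀ x ∈ X, π' (φ x) = π x) (himg : π' '' X' = π '' X) :
    IsLocalSection X' π' c (fun w => φ (σ w)) where
  poly := h.poly
  regular := himg ▸ hφ.comp h.regular fun w hw => h.mem w hw.1 hw.2
  mem w hw hc := hmaps (h.mem w (himg ▸ hw) hc)
  right_inv w hw hc := by
    rw [himg] at hw
    rw [hcomp _ (h.mem w hw hc), h.right_inv w hw hc]

namespace IsGeometricQuotient

variable {G : Type*} [Group G] {act : G → V → V} {Z : Set W}

theorem exists_descent {W₂ : Type*} [AddCommGroup W₂] [Module ℂ W₂] [FiniteDimensional ℂ W₂]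
    (h : IsGeometricQuotient act X Z π) {Z₂ : Set W₂} {ψ : V → W₂} (hψ : IsMorphism ψ X Z₂)
    (hinv : ∀ g : G, ∀ x ∈ X, ψ (act g x) = ψ x) :
    ∃ κ : W → W₂, IsMorphism κ Z Z₂ ∧ ∀ x ∈ X, κ (π x) = ψ x := by
  let b := Module.finBasis ℂ W₂
  have hX : X ∩ π ⁻¹' Z = X := Set.inter_eq_left.2 h.morphism.1
  have hcoord := fun i => h.functions Z (isOpenIn_self Z) (fun v => b.coord i (ψ v))
    (hX.symm ▸ hψ.2 (b.coord i)) fun g x hx => by rw [hinv g x (hX ▸ hx)]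
  rw [hX] at hcoord
  choose f hf hfψ using hcoord
  let κ : W → W₂ := fun w => b.equivFun.symm fun i => f i w
  have hκ : ∀ x ∈ X, κ (π x) = ψ x := fun x hx => b.equivFun.symm_apply_eq.2 <|
    funext fun i => (hfψ i x hx).symm
  refine ⟨κ, ⟨fun z hz => ?_, ?_⟩, hκ⟩
  · obtain ⟨x, hx, rfl⟩ := h.surj hz
    exact hκ x hx ▸ hψ.1 hx
  · exact (IsRegularMap.pi fun i => .of_regularOn (hf i)).linear_comp b.equivFun.symm.toLinearMap

theorem linearEquiv_comp {W' : Type*} [AddCommGroup W'] [Module ℂ W']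
    (h : IsGeometricQuotient act X Z π) (e : W ≃ₗ[ℂ] W') :
    IsGeometricQuotient act X (e '' Z) (fun v => e (π v)) where
  source := h.source
  target := by
    rw [LinearEquiv.image_eq_preimage_symm]
    exact h.target.preimage e.symm.toLinearMap
  stable := h.stable
  morphism := ⟨fun _ hx => ⟨_, h.morphism.1 hx, rfl⟩,
    IsRegularMap.linear_comp h.morphism.2 e.toLinearMap⟩
  surj := Set.forall_mem_image.2 fun z hz =>
    let ⟨x, hx, hxz⟩ := h.surj hz
    ⟨x, hx, congrArg e hxz⟩
  orbits x hx y hy := e.injective.eq_iff.trans (h.orbits x hx y hy)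
  submersive U hU hopen := by
    have hUZ : e ⁻¹' U ⊆ Z := fun w hw => by
      obtain ⟨z, hz, hzw⟩ := hU hw
      rwa [← e.injective hzw]
    have hopenW := (h.submersive _ hUZ hopen).preimage e.symm.toLinearMap
    rw [LinearEquiv.image_eq_preimage_symm]
    exact e.toEquiv.symm_preimage_preimage U ▸ hopenW
  functions U hU f hf hinv := by
    have hUZ := hU.preimage e.toLinearMap
    rw [LinearEquiv.coe_coe, Set.preimage_image_eq Z e.injective] at hUZ
    obtain ⟨f', hf', hff'⟩ := h.functions _ hUZ f hf hinv
    refine ⟨fun w => f' (e.symm w), (IsRegularMap.linear e.symm.toLinearMap U).regularOn_comp hf'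
      fun w hw => ?_, fun x hx => ?_⟩
    · exact Set.mem_preimage.2 ((e.apply_symm_apply w).symm ▸ hw)
    · simp only [hff' x hx, e.symm_apply_apply]

end IsGeometricQuotient

theorem IsMorphism.linearEquiv_conj {V' W' : Type*} [AddCommGroup V'] [Module ℂ V']
    [AddCommGroup W'] [Module ℂ W'] {κ : V → W} {Z : Set V} {Z' : Set W} (h : IsMorphism κ Z Z')
    (e : V ≃ₗ[ℂ] V') (e' : W ≃ₗ[ℂ] W') :
    IsMorphism (fun v => e' (κ (e.symm v))) (e '' Z) (e' '' Z') := by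
  have hsymm : Set.MapsTo (fun v => e.symm v) (e '' Z) Z := by
    rintro _ ⟨z, hz, rfl⟩
    simpa only [e.symm_apply_apply]
  refine ⟨fun v hv => ⟨_, h.1 (hsymm hv), rfl⟩, ?_⟩
  have hreg := IsRegularMap.linear_comp h.2 e'.toLinearMap
  exact hreg.comp (IsRegularMap.linear e.symm.toLinearMap _) hsymm

theorem ncard_fibre_equiv_conj {α β γ δ : Type*} (e : α ≃ β) {f : γ → δ}
    (hf : Function.Injective f) (κ : α → γ) (Z : Set α) (z : γ) :
    (e '' Z ∩ (fun w => f (κ (e.symm w))) ⁻¹' {f z}).ncard = (Z ∩ κ ⁻¹' {z}).ncard := by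
  rw [← Set.image_inter_preimage, Set.ncard_image_of_injective _ e.injective]
  congr 2
  ext v
  simp only [Set.mem_preimage, Set.mem_singleton_iff, e.symm_apply_apply, hf.eq_iff]

end Quotients

/-! ## Lower right corners -/

section Corners

variable {R γ : Type*} {a b c : ℕ}

/-- The inclusion of `Fin a` into `Fin b` as the last `a` indices. -/
def embLast (h : a ≤ b) (i : Fin a) : Fin b := ⟨i + (b - a), by omega⟩

theorem rev_embLast (h : a ≤ b) (i : Fin a) : ((embLast h i).rev : ℕ) = i.rev := by
  simp only [Fin.val_rev, embLast]; omega

theorem embLast_injective (h : a ≤ b) : Function.Injective (embLast h) := fun i j hij => by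
  simp only [embLast, Fin.mk.injEq] at hij
  exact Fin.ext (by omega)

theorem embLast_embLast (h : a ≤ b) (h' : b ≤ c) (i : Fin a) :
    embLast h' (embLast h i) = embLast (h.trans h') i := Fin.ext (by simp only [embLast]; omega)

theorem embLast_self (h : a ≤ a) (i : Fin a) : embLast h i = i := Fin.ext (by simp [embLast])

theorem exists_embLast_eq (h : a ≤ b) {j : Fin b} (hj : (j.rev : ℕ) < a) :
    ∃ i : Fin a, embLast h i = j := by
  simp only [Fin.val_rev] at hj
  exact ⟨⟨j - (b - a), by omega⟩, Fin.ext (by simp only [embLast]; omega)⟩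

/-- The matrix `(0 I)` of size `a × b`. -/
def stdMat (R : Type*) [Zero R] [One R] (a b : ℕ) : Matrix (Fin a) (Fin b) R :=
  of fun i j => if (j : ℕ) + a = (i : ℕ) + b then 1 else 0

theorem stdMat_apply_embLast [Zero R] [One R] (h : a ≤ b) (i : Fin a) (j : Fin b) :
    stdMat R a b i j = (1 : Matrix (Fin b) (Fin b) R) (embLast h i) j := by
  simp only [stdMat, of_apply, one_apply, Fin.ext_iff, embLast]
  congr 1
  simp only [eq_iff_iff]
  omega

theorem stdMat_self [Zero R] [One R] (a : ℕ) : stdMat R a a = 1 := by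
  ext i j
  rw [stdMat_apply_embLast le_rfl, embLast_self]

variable [NonAssocSemiring R]

theorem stdMat_mul (h : a ≤ b) (M : Matrix (Fin b) γ R) :
    stdMat R a b * M = M.submatrix (embLast h) id := by
  ext i j
  simp only [mul_apply, stdMat_apply_embLast h, one_apply, ite_mul, one_mul, zero_mul,
    Finset.sum_ite_eq, Finset.mem_univ, if_true, submatrix_apply, id]

theorem mul_stdMat_transpose (h : a ≤ b) (M : Matrix γ (Fin b) R) :
    M * (stdMat R a b)ᵀ = M.submatrix id (embLast h) := by
  ext i j
  simp only [mul_apply, transpose_apply, stdMat_apply_embLast h, one_apply, mul_ite, mul_one,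
    mul_zero, Finset.sum_ite_eq, Finset.mem_univ, if_true, submatrix_apply, id]

theorem stdMat_mul_stdMat (h : a ≤ b) (h' : b ≤ c) :
    stdMat R a b * stdMat R b c = stdMat R a c := by
  ext i j
  rw [stdMat_mul h, submatrix_apply, stdMat_apply_embLast h', embLast_embLast,
    stdMat_apply_embLast (h.trans h'), id]

theorem stdMat_mul_transpose (h : a ≤ b) : stdMat R a b * (stdMat R a b)ᵀ = 1 := by
  ext i j
  simp only [mul_stdMat_transpose h, submatrix_apply, stdMat_apply_embLast h, one_apply, id,
    (embLast_injective h).eq_iff]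

theorem mul_stdMat_apply_embLast (h : a ≤ b) (M : Matrix γ (Fin a) R) (i : γ) (j : Fin a) :
    (M * stdMat R a b) i (embLast h j) = M i j := by
  simp only [mul_apply, stdMat_apply_embLast h, one_apply, (embLast_injective h).eq_iff, mul_ite,
    mul_one, mul_zero, Finset.sum_ite_eq', Finset.mem_univ, if_true]

theorem mul_stdMat_apply_of_le (h : a ≤ b) (M : Matrix γ (Fin a) R) (i : γ) {j : Fin b}
    (hj : a ≤ j.rev) : (M * stdMat R a b) i j = 0 := by
  rw [mul_apply]
  refine Finset.sum_eq_zero fun k _ => ?_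
  have hne : embLast h k ≠ j := by
    rintro rfl
    rw [rev_embLast] at hj
    exact hj.not_gt k.rev.2
  rw [stdMat_apply_embLast h, one_apply_ne hne, mul_zero]

/-- The lower right corner of size `a` of a square matrix of size `b`. -/
def corner (a : ℕ) (M : Matrix (Fin b) (Fin b) R) : Matrix (Fin a) (Fin a) R :=
  stdMat R a b * M * (stdMat R a b)ᵀ

theorem corner_eq_submatrix (h : a ≤ b) (M : Matrix (Fin b) (Fin b) R) :
    corner a M = M.submatrix (embLast h) (embLast h) := by
  rw [corner, mul_stdMat_transpose h, stdMat_mul h, submatrix_submatrix, Function.comp_id,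
    Function.id_comp]

theorem corner_apply (h : a ≤ b) (M : Matrix (Fin b) (Fin b) R) (i j : Fin a) :
    corner a M i j = M (embLast h i) (embLast h j) := by
  rw [corner_eq_submatrix h, submatrix_apply]

theorem corner_one (h : a ≤ b) : corner a (1 : Matrix (Fin b) (Fin b) R) = 1 := by
  rw [corner_eq_submatrix h, submatrix_one _ (embLast_injective h)]

theorem corner_self (M : Matrix (Fin b) (Fin b) R) : corner b M = M := by
  rw [corner, stdMat_self, Matrix.one_mul, transpose_one, Matrix.mul_one]

end Corners

section Blocks

variable {m : ℕ} {d : Fin (m + 1) → ℕ}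

theorem isStandard_iff {x : QuiverRep d} :
    IsStandard x ↔ ∀ i : Fin m, x.2 i = stdMat ℂ (d i.castSucc) (d i.succ) := by
  simp only [IsStandard, ← Matrix.ext_iff, stdMat, of_apply]

theorem rev_lt_iff (hd : Monotone d) (r : Fin (d (Fin.last m))) (j : Fin (m + 1)) :
    (r.rev : ℕ) < d j ↔ m ≤ (j : ℕ) + blockIdx d r := by
  cases j using Fin.lastCases with
  | last => exact iff_of_true r.rev.2 (Nat.le_add_right _ _)
  | cast i =>
    have hcard : blockIdx d r = (Finset.univ.filter fun i : Fin m =>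
        (r.rev : ℕ) < d i.rev.castSucc).card :=
      Finset.card_equiv Fin.revPerm fun i => by simp
    have hcount := Fin.lt_card_filter_univ_iff_apply_of_imp (j := i.rev)
      (fun i : Fin m => (r.rev : ℕ) < d i.rev.castSucc) fun i j hij hi => hi.trans_le
        (hd (Fin.castSucc_le_castSucc_iff.2 (Fin.rev_le_rev.2 hij)))
    rw [Fin.rev_rev] at hcount
    rw [← hcount, ← hcard, Fin.val_rev, Fin.val_castSucc]
    omega

theorem blockIdx_le (r : Fin (d (Fin.last m))) : blockIdx d r ≤ m :=
  (Finset.card_filter_le _ _).trans_eq (Finset.card_fin m)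

variable {R : Type*} [CommRing R]

theorem stdMat_mul_of_blockTriangular (hd : Monotone d)
    {p : Matrix (Fin (d (Fin.last m))) (Fin (d (Fin.last m))) R}
    (hp : p.BlockTriangular (blockIdx d)) (j : Fin (m + 1)) :
    stdMat R (d j) (d (Fin.last m)) * p = corner (d j) p * stdMat R (d j) (d (Fin.last m)) := by
  have h := hd (Fin.le_last j)
  ext r s
  rw [stdMat_mul h, submatrix_apply, id]
  by_cases hs : (s.rev : ℕ) < d j
  · obtain ⟨s, rfl⟩ := exists_embLast_eq h hs
    rw [mul_stdMat_apply_embLast h, corner_eq_submatrix h, submatrix_apply]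
  · rw [mul_stdMat_apply_of_le h _ _ (not_lt.1 hs)]
    refine hp ?_
    have hr := (rev_lt_iff hd (embLast h r) j).1 (by rw [rev_embLast]; exact r.rev.2)
    rw [rev_lt_iff hd] at hs
    omega

theorem corner_mul (hd : Monotone d)
    {p : Matrix (Fin (d (Fin.last m))) (Fin (d (Fin.last m))) R}
    (hp : p.BlockTriangular (blockIdx d))
    (M : Matrix (Fin (d (Fin.last m))) (Fin (d (Fin.last m))) R) (j : Fin (m + 1)) :
    corner (d j) (p * M) = corner (d j) p * corner (d j) M := by
  rw [corner, ← Matrix.mul_assoc, stdMat_mul_of_blockTriangular hd hp]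
  simp only [corner, Matrix.mul_assoc]

theorem stdMat_mul_corner (hd : Monotone d)
    {p : Matrix (Fin (d (Fin.last m))) (Fin (d (Fin.last m))) R}
    (hp : p.BlockTriangular (blockIdx d)) (i : Fin m) :
    stdMat R (d i.castSucc) (d i.succ) * corner (d i.succ) p =
      corner (d i.castSucc) p * stdMat R (d i.castSucc) (d i.succ) := by
  have hsucc := stdMat_mul_stdMat (R := R) (hd i.castSucc_le_succ) (hd (Fin.le_last i.succ))
  calc stdMat R (d i.castSucc) (d i.succ) * corner (d i.succ) p
      = stdMat R (d i.castSucc) (d (Fin.last m)) * p * (stdMat R (d i.succ) (d (Fin.last m)))ᵀ := by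
        rw [corner, ← hsucc]; simp only [Matrix.mul_assoc]
    _ = corner (d i.castSucc) p * stdMat R (d i.castSucc) (d i.succ) := by
        rw [stdMat_mul_of_blockTriangular hd hp, ← hsucc, Matrix.mul_assoc, Matrix.mul_assoc,
          stdMat_mul_transpose (hd (Fin.le_last i.succ)), Matrix.mul_one]

end Blocks

/-! ## The commutator subgroup of a parabolic subgroup -/

section Elimination

variable {n α K : Type*} [Fintype n] [DecidableEq n] [Field K]

/-- The row `r` of `M` is the row `r` of the identity matrix. Elimination by column operations
enlarges the set of these rows. -/
def IsUnitRow (M : Matrix n n K) (r : n) : Prop := M r = Pi.single r 1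

theorem IsUnitRow.mul_apply {M : Matrix n n K} {r : n} (h : IsUnitRow M r) (A : Matrix n n K)
    (s : n) : (M * A) r s = A r s := by
  rw [mul_apply_eq_vecMul, h, single_vecMul, one_smul, row_apply]

theorem IsUnitRow.mul_transvection {M : Matrix.SpecialLinearGroup n K} {r i j : n}
    (h : IsUnitRow M.1 r) (hi : r ≠ i) (hij : i ≠ j) (c : K) :
    IsUnitRow (M * Matrix.SpecialLinearGroup.transvection hij c).1 r := by
  ext s
  change (M.1 * transvection i j c : Matrix n n K) r s = _
  rw [h.mul_apply, transvection, Matrix.add_apply, single_apply_of_row_ne hi.symm, add_zero,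
    one_eq_pi_single]

theorem exists_apply_ne_zero_of_not_isUnitRow {M : Matrix.SpecialLinearGroup n K} {i : n}
    (hi : ¬ IsUnitRow M.1 i) : ∃ s, ¬ IsUnitRow M.1 s ∧ M i s ≠ 0 := by
  by_contra! hsupp
  have hfix : (M.1 * M.1) i = M.1 i := by
    ext t
    have hterm : ∀ s, M i s * M s t = M i s * (1 : Matrix n n K) s t := fun s => by
      by_cases hs : IsUnitRow M.1 s
      · rw [one_eq_pi_single, ← hs]
      · rw [hsupp s hs, zero_mul, zero_mul]
    rw [Matrix.mul_apply, Finset.sum_congr rfl fun s _ => hterm s, ← Matrix.mul_apply,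
      Matrix.mul_one]
  refine hi (funext fun t => ?_)
  have hinv : M.1 * (M⁻¹).1 = 1 := congrArg Subtype.val (mul_inv_cancel M)
  have hcancel : (M.1 * M.1 * (M⁻¹).1) i = (M.1 * (M⁻¹).1) i := by
    rw [mul_apply_eq_vecMul, hfix, ← mul_apply_eq_vecMul]
  rw [Matrix.mul_assoc, hinv, Matrix.mul_one] at hcancel
  rw [hcancel, one_eq_pi_single]

theorem det_eq_apply_of_isUnitRow {M : Matrix n n K} {i : n}
    (h : ∀ r, r ≠ i → IsUnitRow M r) : M.det = M i i := by
  have hM : M = updateRow 1 i (M i) := by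
    ext r s
    by_cases hr : r = i
    · rw [hr, updateRow_self]
    · rw [updateRow_ne hr, h r hr, one_eq_pi_single]
  conv_lhs => rw [hM, ← cramer_transpose_apply, transpose_one, cramer_one, Module.End.one_apply]

variable [LinearOrder α] {b : n → α}

/-- The subgroup `T` contains all transvections which are block upper triangular for the block
labelling `b`. -/
def ContainsTransvections (b : n → α) (T : Subgroup (Matrix.SpecialLinearGroup n K)) : Prop :=
  ∀ ⦃i j⦄ (hij : i ≠ j) (c : K), b i ≤ b j → Matrix.SpecialLinearGroup.transvection hij c ∈ T

variable {T : Subgroup (Matrix.SpecialLinearGroup n K)}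

theorem exists_mul_apply_ne_zero
    (hT : ContainsTransvections b T) {M : Matrix.SpecialLinearGroup n K} {i j s : n}
    (hb : b s = b j) (hs : ¬ IsUnitRow M.1 s) (hs0 : M i s ≠ 0) :
    ∃ A ∈ T, (M * A) i j ≠ 0 ∧ ∀ r, IsUnitRow M.1 r → IsUnitRow (M * A).1 r := by
  by_cases h0 : M i j = 0
  · have hsj : s ≠ j := fun h => hs0 (h ▸ h0)
    refine ⟨Matrix.SpecialLinearGroup.transvection hsj 1, hT _ _ hb.le, ?_,
      fun r hr => hr.mul_transvection (by rintro rfl; exact hs hr) _ _⟩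
    change (M.1 * transvection s j 1 : Matrix n n K) i j ≠ 0
    rw [mul_transvection_apply_same, h0, one_mul, zero_add]
    exact hs0
  · exact ⟨1, one_mem _, by rwa [mul_one], fun r hr => by rwa [mul_one]⟩

theorem exists_mul_apply_self_eq_one (hT : ContainsTransvections b T)
    {M : Matrix.SpecialLinearGroup n K} (hM : M.1.BlockTriangular b)
    (hdet : ∀ k, (M.1.toSquareBlockProp (k ≤ b ·)).det = 1) {i : n}
    (hi : ¬ IsUnitRow M.1 i) (hmax : ∀ r, ¬ IsUnitRow M.1 r → b r ≤ b i) :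
    ∃ A ∈ T, (M * A) i i = 1 ∧ ∀ r, IsUnitRow M.1 r → IsUnitRow (M * A).1 r := by
  obtain ⟨s, hs, hs0⟩ := exists_apply_ne_zero_of_not_isUnitRow hi
  have hbs : b s = b i := (hmax s hs).antisymm (not_lt.1 fun hlt => hs0 (hM hlt))
  by_cases hex : ∃ j, i ≠ j ∧ ¬ IsUnitRow M.1 j ∧ b i = b j
  · obtain ⟨j, hij, hj, hbj⟩ := hex
    obtain ⟨A, hA, hA0, hAr⟩ := exists_mul_apply_ne_zero hT (hbs.trans hbj) hs hs0
    refine ⟨A * Matrix.SpecialLinearGroup.transvection hij.symm ((1 - (M * A) i i) / (M * A) i j),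
      mul_mem hA (hT _ _ hbj.ge), ?_, fun r hr => ?_⟩
    · rw [← mul_assoc]
      change ((M * A).1 * transvection j i _ : Matrix n n K) i i = 1
      rw [mul_transvection_apply_same, div_mul_cancel₀ _ hA0, add_sub_cancel]
    · rw [← mul_assoc]
      exact (hAr r hr).mul_transvection (by rintro rfl; exact hj hr) _ _
  · push Not at hex
    refine ⟨1, one_mem _, ?_, fun r hr => by rwa [mul_one]⟩
    have hpivot := det_eq_apply_of_isUnitRow (M := M.1.toSquareBlockProp (b i ≤ b ·))
      (i := ⟨i, le_rfl⟩) fun r hr => ?_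
    · rw [mul_one]
      exact hpivot.symm.trans (hdet _)
    · have hri : i ≠ r.1 := fun h => hr (Subtype.ext h.symm)
      have hrow : IsUnitRow M.1 r.1 :=
        by_contra fun h => hex r.1 hri h (r.2.antisymm (hmax r.1 h))
      ext t
      exact (congrFun hrow t).trans (by simp only [Pi.single_apply, Subtype.ext_iff])

theorem exists_mul_isUnitRow (hT : ContainsTransvections b T)
    {M : Matrix.SpecialLinearGroup n K} (hM : M.1.BlockTriangular b) {i : n} (hi : M i i = 1) :
    ∃ A ∈ T, IsUnitRow (M * A).1 i ∧ ∀ r, IsUnitRow M.1 r → IsUnitRow (M * A).1 r := by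
  suffices hclear : ∀ S : Finset n, i ∉ S → ∃ A ∈ T, (∀ r, r ≠ i → IsUnitRow M.1 r →
      IsUnitRow (M * A).1 r) ∧ ∀ s, (M * A) i s = if s ∈ S then 0 else M i s by
    obtain ⟨A, hA, hAr, hAi⟩ := hclear (Finset.univ.erase i) (Finset.notMem_erase i _)
    have hrow : IsUnitRow (M * A).1 i := by
      ext s
      refine (hAi s).trans ?_
      by_cases hs : s = i
      · simp [hs, hi]
      · simp [hs]
    exact ⟨A, hA, hrow, fun r hr => if h : r = i then h ▸ hrow else hAr r h hr⟩
  intro S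
  induction S using Finset.induction_on with
  | empty => exact fun _ => ⟨1, one_mem _, by simp⟩
  | insert s S hs ih =>
    intro hiS
    rw [Finset.mem_insert, not_or] at hiS
    obtain ⟨A, hA, hAr, hAi⟩ := ih hiS.2
    by_cases h0 : M i s = 0
    · refine ⟨A, hA, hAr, fun t => (hAi t).trans ?_⟩
      by_cases ht : t = s
      · simp [ht, h0]
      · simp [ht]
    · refine ⟨A * Matrix.SpecialLinearGroup.transvection hiS.1 (-M i s),
        mul_mem hA (hT _ _ (not_lt.1 fun hlt => h0 (hM hlt))), fun r hri hr => ?_, fun t => ?_⟩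
      · rw [← mul_assoc]
        exact (hAr r hri hr).mul_transvection hri _ _
      · rw [← mul_assoc]
        change ((M * A).1 * transvection i s (-M i s) : Matrix n n K) i t = _
        by_cases ht : t = s
        · rw [ht, mul_transvection_apply_same, hAi, hAi, if_neg hs, if_neg hiS.2, hi]
          simp
        · rw [mul_transvection_apply_of_ne _ _ _ _ ht, hAi]
          simp [ht]

theorem le_of_containsTransvections (hT : ContainsTransvections b T)
    {U : Subgroup (Matrix.SpecialLinearGroup n K)} (hTU : T ≤ U)
    (hU : ∀ M ∈ U, M.1.BlockTriangular b ∧ ∀ k, (M.1.toSquareBlockProp (k ≤ b ·)).det = 1) :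
    U ≤ T := by
  classical
  suffices hind : ∀ (s : Finset n), ∀ M ∈ U, (∀ r, ¬ IsUnitRow M.1 r → r ∈ s) → M ∈ T from
    fun M hM => hind Finset.univ M hM fun r _ => Finset.mem_univ r
  intro s
  induction s using Finset.strongInduction with
  | H s ih =>
    intro M hM hs
    by_cases hunit : ∀ r, IsUnitRow M.1 r
    · have hone : M = 1 := Subtype.ext (funext fun r => (hunit r).trans <|
        funext fun s => one_eq_pi_single.symm)
      exact hone ▸ one_mem T
    · push Not at hunit
      obtain ⟨i, hi, hmax⟩ := Finset.exists_max_image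
        (Finset.univ.filter fun r => ¬ IsUnitRow M.1 r) b (by simpa [Finset.Nonempty] using hunit)
      simp only [Finset.mem_filter, Finset.mem_univ, true_and] at hi hmax
      obtain ⟨A, hA, hAi, hAr⟩ := exists_mul_apply_self_eq_one hT (hU M hM).1 (hU M hM).2 hi hmax
      have hMA : M * A ∈ U := mul_mem hM (hTU hA)
      obtain ⟨A', hA', hi', hAr'⟩ := exists_mul_isUnitRow hT (hU _ hMA).1 hAi
      have hmem : M * A * A' ∈ T := by
        refine ih (s.erase i) (Finset.erase_ssubset (hs i hi)) _ (mul_mem hMA (hTU hA'))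
          fun r hr => Finset.mem_erase.2 ⟨fun h => hr (h ▸ hi'), hs r fun h => ?_⟩
        exact hr (hAr' r (hAr r h))
      rwa [Subgroup.mul_mem_cancel_right _ hA', Subgroup.mul_mem_cancel_right _ hA] at hmem

end Elimination

section Commutator

variable {m : ℕ} {d : Fin (m + 1) → ℕ}

/-- The block upper triangular matrices whose lower right corners are unimodular. This is the
commutator subgroup of the parabolic subgroup. -/
def unimodularParabolic (hd : Monotone d) : Subgroup (SLC (d (Fin.last m))) where
  carrier := {p | p ∈ parabolic d ∧ ∀ j, (corner (d j) p.1).det = 1}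
  mul_mem' {a b} ha hb := ⟨mul_mem ha.1 hb.1, fun j => by
    rw [Matrix.SpecialLinearGroup.coe_mul, corner_mul hd ha.1, det_mul, ha.2, hb.2, one_mul]⟩
  one_mem' := ⟨one_mem _, fun j => by
    rw [Matrix.SpecialLinearGroup.coe_one, corner_one (hd (Fin.le_last j)), det_one]⟩
  inv_mem' {a} ha := ⟨inv_mem ha.1, fun j => by
    have h := congrArg det (corner_mul hd ha.1 (a⁻¹).1 j)
    rw [← Matrix.SpecialLinearGroup.coe_mul, mul_inv_cancel, Matrix.SpecialLinearGroup.coe_one,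
      corner_one (hd (Fin.le_last j)), det_one, det_mul, ha.2, one_mul] at h
    exact h.symm⟩

/-- The determinant of a lower right corner, as a character of the parabolic subgroup. -/
def cornerDet (hd : Monotone d) (j : Fin (m + 1)) : parabolic d →* ℂ where
  toFun p := (corner (d j) p.1.1).det
  map_one' := by
    rw [OneMemClass.coe_one, Matrix.SpecialLinearGroup.coe_one,
      corner_one (hd (Fin.le_last j)), det_one]
  map_mul' p q := by
    rw [Subgroup.coe_mul, Matrix.SpecialLinearGroup.coe_mul, corner_mul hd p.2, det_mul]

theorem commutator_le_unimodularParabolic (hd : Monotone d) :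
    ⁅parabolic d, parabolic d⁆ ≤ unimodularParabolic hd := by
  rw [Subgroup.commutator_le]
  intro p hp q hq
  refine ⟨Subgroup.commutator_le_self _ (Subgroup.commutator_mem_commutator hp hq), fun j => ?_⟩
  have hcomm := map_commutatorElement (cornerDet hd j).toHomUnits ⟨p, hp⟩ ⟨q, hq⟩
  rw [commutatorElement_eq_one_iff_mul_comm.2 (mul_comm (_ : ℂˣ) _)] at hcomm
  exact congrArg Units.val hcomm

open scoped commutatorElement in
theorem commutator_diag2n_transvection {n K : Type*} [Fintype n] [DecidableEq n] [Field K]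
    {i j : n} (hij : i ≠ j) {a : K} (ha : a ≠ 0) (c : K) :
    ⁅Matrix.SpecialLinearGroup.diag2n hij a ha, Matrix.SpecialLinearGroup.transvection hij c⁆ =
      Matrix.SpecialLinearGroup.transvection hij ((a ^ 2 - 1) * c) := by
  rw [commutatorElement_def, mul_inv_eq_iff_eq_mul, mul_inv_eq_iff_eq_mul]
  refine Subtype.ext ?_
  rw [Matrix.SpecialLinearGroup.coe_mul, Matrix.SpecialLinearGroup.coe_mul,
    Matrix.SpecialLinearGroup.coe_mul, Matrix.SpecialLinearGroup.diag2n_coe]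
  change diagonal _ * transvection i j c = transvection i j _ * transvection i j c * diagonal _
  rw [transvection_mul_transvection_same _ _ hij]
  ext r s
  rw [diagonal_mul, mul_diagonal]
  by_cases hrs : r = i ∧ s = j
  · obtain ⟨rfl, rfl⟩ := hrs
    simp only [transvection, Matrix.add_apply, one_apply_ne hij, single_apply_same, if_true,
      if_neg hij.symm]
    field_simp
    ring
  · have hzero : ∀ x : K, single i j x r s = 0 := fun x =>
      single_apply_of_ne _ _ _ _ _ fun h => hrs ⟨h.1.symm, h.2.symm⟩
    simp only [transvection, Matrix.add_apply, hzero, add_zero]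
    by_cases h : r = s
    · rw [h, one_apply_eq, mul_one, one_mul]
    · rw [one_apply_ne h, mul_zero, zero_mul]

theorem containsTransvections_commutator_parabolic :
    ContainsTransvections (blockIdx d) ⁅parabolic d, parabolic d⁆ := fun i j hij c hb => by
  have hcomm := commutator_diag2n_transvection hij (two_ne_zero (α := ℂ)) (c / 3)
  rw [show ((2 : ℂ) ^ 2 - 1) * (c / 3) = c by ring] at hcomm
  rw [← hcomm]
  refine Subgroup.commutator_mem_commutator ?_
    (show _ ∈ parabolic d from blockTriangular_transvection hb (c / 3))
  change BlockTriangular (Matrix.SpecialLinearGroup.diag2n hij _ _).1 (blockIdx d)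
  rw [Matrix.SpecialLinearGroup.diag2n_coe]
  exact blockTriangular_diagonal _

theorem det_toSquareBlockProp_blockIdx (hd : Monotone d) (M : Mat (d (Fin.last m)))
    (j : Fin (m + 1)) :
    (M.toSquareBlockProp (m ≤ j + blockIdx d ·)).det = (corner (d j) M).det := by
  have h := hd (Fin.le_last j)
  let e : Fin (d j) → {r : Fin (d (Fin.last m)) // m ≤ j + blockIdx d r} := fun r =>
    ⟨embLast h r, (rev_lt_iff hd _ j).1 (by rw [rev_embLast]; exact r.rev.2)⟩
  have he : Function.Bijective e :=
    ⟨fun r s hrs => embLast_injective h (congrArg Subtype.val hrs), fun ⟨r, hr⟩ =>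
      (exists_embLast_eq h ((rev_lt_iff hd r j).2 hr)).imp fun s hs => Subtype.ext hs⟩
  rw [corner_eq_submatrix h, ← det_submatrix_equiv_self (Equiv.ofBijective e he)]
  rfl

theorem commutator_parabolic (hd : Monotone d) :
    ⁅parabolic d, parabolic d⁆ = unimodularParabolic hd := by
  refine (commutator_le_unimodularParabolic hd).antisymm <|
    le_of_containsTransvections containsTransvections_commutator_parabolic
      (commutator_le_unimodularParabolic hd) fun M hM => ⟨hM.1, fun k => ?_⟩
  obtain hk | hk := le_or_gt k m
  · let j : Fin (m + 1) := ⟨m - k, by omega⟩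
    rw [equiv_block_det M.1 (q := (m ≤ j + blockIdx d ·)) fun r => by dsimp only [j]; omega,
      det_toSquareBlockProp_blockIdx hd]
    exact hM.2 j
  · have : IsEmpty {r : Fin (d (Fin.last m)) // k ≤ blockIdx d r} :=
      ⟨fun r => (hk.trans_le r.2).not_ge (blockIdx_le r.1)⟩
    exact det_isEmpty

theorem strictMono_fullFlag (m : ℕ) : StrictMono (fullFlag m) := fun _ _ hij =>
  Nat.succ_lt_succ hij

theorem blockIdx_fullFlag (m : ℕ) (a : Fin (fullFlag m (Fin.last m))) :
    blockIdx (fullFlag m) a = a := by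
  have hle := blockIdx_le (d := fullFlag m) a
  have ha : (a : ℕ) < m + 1 := a.2
  have hle' := rev_lt_iff (strictMono_fullFlag m).monotone a ⟨m - a, by omega⟩
  have hge := rev_lt_iff (strictMono_fullFlag m).monotone a
    ⟨m - blockIdx (fullFlag m) a, by omega⟩
  simp only [Fin.val_rev, fullFlag, Fin.val_last] at hle' hge
  have := hle'.1 (by omega)
  have := hge.2 (by omega)
  omega

theorem blockTriangular_fullFlag_iff {m : ℕ} {M : Mat (m + 1)} :
    M.BlockTriangular (blockIdx (fullFlag m)) ↔ M.BlockTriangular id := by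
  have h : ∀ a b : Fin (m + 1), blockIdx (fullFlag m) a < blockIdx (fullFlag m) b ↔ a < b :=
    fun a b => by rw [blockIdx_fullFlag, blockIdx_fullFlag, Fin.lt_def]
  exact ⟨fun hM i j hij => hM ((h j i).2 hij), fun hM i j hij => hM ((h j i).1 hij)⟩

/-- A diagonal entry, as a character of the Borel subgroup. -/
def borelDiag {n : ℕ} (a : Fin n) : borelSL n →* ℂ where
  toFun b := b.1.1 a a
  map_one' := by
    rw [OneMemClass.coe_one, Matrix.SpecialLinearGroup.coe_one, one_apply_eq]
  map_mul' b c := by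
    rw [Subgroup.coe_mul, Matrix.SpecialLinearGroup.coe_mul, upper_mul_diag b.2 c.2]

theorem commutator_borelSL_le (n : ℕ) : ⁅borelSL n, borelSL n⁆ ≤ unip n := by
  rw [Subgroup.commutator_le]
  intro b hb c hc
  refine ⟨Subgroup.commutator_le_self _ (Subgroup.commutator_mem_commutator hb hc), fun a => ?_⟩
  have hcomm := map_commutatorElement (borelDiag a).toHomUnits ⟨b, hb⟩ ⟨c, hc⟩
  rw [commutatorElement_eq_one_iff_mul_comm.2 (mul_comm (_ : ℂˣ) _)] at hcomm
  exact congrArg Units.val hcomm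

theorem parabolic_fullFlag (m : ℕ) : parabolic (fullFlag m) = borelSL (m + 1) :=
  Subgroup.ext fun _ => blockTriangular_fullFlag_iff

theorem unimodularParabolic_fullFlag (m : ℕ) :
    unimodularParabolic (strictMono_fullFlag m).monotone = unip (m + 1) := by
  refine le_antisymm ?_ fun p hp => ⟨blockTriangular_fullFlag_iff.2 hp.1, fun j => ?_⟩
  · rw [← commutator_parabolic, parabolic_fullFlag]
    exact commutator_borelSL_le (m + 1)
  · rw [corner_eq_submatrix ((strictMono_fullFlag m).monotone (Fin.le_last j))]
    refine (det_of_isUpperTriangular fun a b hab => hp.1 ?_).trans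
      (Finset.prod_eq_one fun a _ => hp.2 _)
    exact Nat.add_lt_add_right hab _

end Commutator

/-! ## The action on quivers -/

section Action

variable {m : ℕ} {d : Fin (m + 1) → ℕ}

section SpecialLinear

variable {n R : Type*} [Fintype n] [DecidableEq n] [CommRing R] (g : Matrix.SpecialLinearGroup n R)

theorem coe_mul_coe_inv : g.1 * (g⁻¹).1 = 1 := by
  rw [← Matrix.SpecialLinearGroup.coe_mul, mul_inv_cancel, Matrix.SpecialLinearGroup.coe_one]

theorem coe_inv_mul_coe : (g⁻¹).1 * g.1 = 1 := by
  rw [← Matrix.SpecialLinearGroup.coe_mul, inv_mul_cancel, Matrix.SpecialLinearGroup.coe_one]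

theorem coe_inv_mul_cancel_left {γ : Type*} (M : Matrix n γ R) : (g⁻¹).1 * (g.1 * M) = M := by
  rw [← Matrix.mul_assoc, coe_inv_mul_coe, Matrix.one_mul]

theorem one_add_conj (M : Matrix n n R) :
    1 + g.1 * M * (g⁻¹).1 = g.1 * (1 + M) * (g⁻¹).1 := by
  rw [Matrix.mul_add, Matrix.add_mul, Matrix.mul_one, coe_mul_coe_inv]

theorem isUnit_coe : IsUnit g.1 := by
  rw [Matrix.isUnit_iff_isUnit_det, g.det_coe]
  exact isUnit_one

end SpecialLinear

theorem act_one (x : QuiverRep d) : act 1 x = x := by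
  simp [act]

theorem act_mul (g h : ∀ j : Fin (m + 1), SLC (d j)) (x : QuiverRep d) :
    act (g * h) x = act g (act h x) := by
  simp only [act, Pi.mul_apply, _root_.mul_inv_rev, Matrix.SpecialLinearGroup.coe_mul,
    Matrix.mul_assoc]

theorem incoming_act (g : ∀ j : Fin (m + 1), SLC (d j)) (x : QuiverRep d) (j : Fin (m + 1)) :
    incoming (act g x) j =
      (g j : Mat (d j)) * incoming x j * (((g j)⁻¹ : SLC (d j)) : Mat (d j)) := by
  cases j using Fin.cases with
  | zero => simp [incoming]
  | succ i =>
    simp only [incoming, Fin.cases_succ, act, Matrix.mul_assoc, coe_inv_mul_cancel_left]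

theorem lastY_act (g : ∀ j : Fin (m + 1), SLC (d j)) (x : QuiverRep d) :
    lastY (act g x) = (g (Fin.last m) : Mat (d (Fin.last m))) * lastY x *
      (((g (Fin.last m))⁻¹ : SLC (d (Fin.last m))) : Mat (d (Fin.last m))) := by
  rw [lastY, incoming_act, one_add_conj, lastY]

theorem alpha_mul_beta_act (g : ∀ j : Fin (m + 1), SLC (d j)) (x : QuiverRep d) (i : Fin m) :
    1 + (act g x).1 i * (act g x).2 i = (g i.succ : Mat (d i.succ)) * (1 + x.1 i * x.2 i) *
      (((g i.succ)⁻¹ : SLC (d i.succ)) : Mat (d i.succ)) := by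
  rw [← one_add_conj]
  simp only [act, Matrix.mul_assoc, coe_inv_mul_cancel_left]

theorem beta_mul_alpha_act (g : ∀ j : Fin (m + 1), SLC (d j)) (x : QuiverRep d) (i : Fin m) :
    1 + (act g x).2 i * (act g x).1 i = (g i.castSucc : Mat (d i.castSucc)) *
      (1 + x.2 i * x.1 i) * (((g i.castSucc)⁻¹ : SLC (d i.castSucc)) : Mat (d i.castSucc)) := by
  rw [← one_add_conj]
  simp only [act, Matrix.mul_assoc, coe_inv_mul_cancel_left]

theorem isMult_act {x : QuiverRep d} (hx : IsMult x) (g : ∀ j : Fin (m + 1), SLC (d j)) :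
    IsMult (act g x) := fun i => by
  rw [alpha_mul_beta_act, beta_mul_alpha_act]
  exact ⟨((isUnit_coe _).mul (hx i).1).mul (isUnit_coe _),
    ((isUnit_coe _).mul (hx i).2).mul (isUnit_coe _)⟩

theorem allSurj_act {x : QuiverRep d} (hx : AllSurj x) (g : ∀ j : Fin (m + 1), SLC (d j)) :
    AllSurj (act g x) := fun i v => by
  obtain ⟨w, hw⟩ := hx i ((((g i.castSucc)⁻¹ : SLC (d i.castSucc)) : Mat (d i.castSucc)) *ᵥ v)
  refine ⟨(g i.succ : Mat (d i.succ)) *ᵥ w, ?_⟩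
  simp only [act, mulVec_mulVec, Matrix.mul_assoc, coe_inv_mul_coe, Matrix.mul_one]
  rw [← mulVec_mulVec, hw, mulVec_mulVec, coe_mul_coe_inv, one_mulVec]

theorem multEq_act {x : QuiverRep d} {q : Fin m → ℂ} (hx : MultEq x q)
    (g : ∀ j : Fin (m + 1), SLC (d j)) : MultEq (act g x) q := fun i => by
  rw [beta_mul_alpha_act, incoming_act, one_add_conj, hx i, Matrix.mul_smul, Matrix.smul_mul]

theorem modMultEq_act {x : QuiverRep d} {t : Fin (m + 1) → ℂ} (hx : ModMultEq x t)
    (g : ∀ j : Fin (m + 1), SLC (d j)) : ModMultEq (act g x) t :=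
  ⟨hx.1, fun i => by
    rw [beta_mul_alpha_act, incoming_act, one_add_conj, ← Matrix.smul_mul, ← Matrix.mul_smul,
      hx.2 i, Matrix.mul_smul, Matrix.smul_mul]⟩

theorem act_mem_surjSol {x : QuiverRep d} (hx : x ∈ surjSol d) (g : ∀ j : Fin (m + 1), SLC (d j)) :
    act g x ∈ surjSol d :=
  ⟨isMult_act hx.1 g, hx.2.1.imp fun _ h => multEq_act h g, allSurj_act hx.2.2 g⟩

theorem act_mem_modSurjSol {x : QuiverRep d} {t : Fin (m + 1) → ℂ} (hx : (x, t) ∈ modSurjSol d)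
    (g : ∀ j : Fin (m + 1), SLC (d j)) : (act g x, t) ∈ modSurjSol d :=
  ⟨isMult_act hx.1 g, modMultEq_act hx.2.1 g, allSurj_act hx.2.2 g⟩

theorem isUnit_one_add_incoming {x : QuiverRep d} (hx : IsMult x) (j : Fin (m + 1)) :
    IsUnit (1 + incoming x j) := by
  cases j using Fin.cases with
  | zero => simp [incoming]
  | succ i => simpa [incoming] using (hx i).1

end Action

/-! ## Quivers in standard form -/

section Standard

variable {m : ℕ} {d : Fin (m + 1) → ℕ}

theorem dim_pos (hd : Monotone d) (h0 : 0 < d 0) (j : Fin (m + 1)) : 0 < d j :=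
  h0.trans_le (hd (Fin.zero_le j))

/-- The first of the last `d j` rows. -/
def topRow (hd : StrictMono d) (h0 : 0 < d 0) (j : Fin (m + 1)) : Fin (d (Fin.last m)) :=
  embLast (hd.monotone (Fin.le_last j)) ⟨0, dim_pos hd.monotone h0 j⟩

/-- The diagonal entry of `Y` in the row `topRow hd h0 j`. -/
def blockScalar (hd : StrictMono d) (h0 : 0 < d 0) (Y : Mat (d (Fin.last m))) (j : Fin (m + 1)) :
    ℂ := Y (topRow hd h0 j) (topRow hd h0 j)

/-- The least `j` such that `a` is among the last `d j` rows. -/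
def level (a : Fin (d (Fin.last m))) : Fin (m + 1) := ⟨m - blockIdx d a, by omega⟩

theorem rev_lt_level (hd : Monotone d) (a : Fin (d (Fin.last m))) :
    (a.rev : ℕ) < d (level a) :=
  (rev_lt_iff hd a _).2 (by simp only [level]; omega)

theorem rev_lt_iff_level_le (hd : Monotone d) (a : Fin (d (Fin.last m))) (j : Fin (m + 1)) :
    (a.rev : ℕ) < d j ↔ level a ≤ j := by
  rw [rev_lt_iff hd, Fin.le_def]
  simp only [level]
  omega

theorem blockIdx_le_iff {a b : Fin (d (Fin.last m))} :
    blockIdx d a ≤ blockIdx d b ↔ level b ≤ level a := by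
  have := blockIdx_le a
  have := blockIdx_le b
  rw [Fin.le_def]
  simp only [level]
  omega

theorem level_topRow (hd : StrictMono d) (h0 : 0 < d 0) (j : Fin (m + 1)) :
    level (topRow hd h0 j) = j := by
  have h : ∀ j', level (topRow hd h0 j) ≤ j' ↔ j ≤ j' := fun j' => by
    rw [← rev_lt_iff_level_le hd.monotone, topRow, rev_embLast, ← hd.le_iff_le]
    have := dim_pos hd.monotone h0 j
    simp only [Fin.val_rev]
    omega
  exact le_antisymm ((h j).2 le_rfl) ((h _).1 le_rfl)

theorem level_anti (hd : Monotone d) {a b : Fin (d (Fin.last m))} (h : a ≤ b) :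
    level b ≤ level a := by
  rw [← rev_lt_iff_level_le hd]
  refine lt_of_le_of_lt ?_ (rev_lt_level hd a)
  rw [← Fin.le_def, Fin.rev_le_rev]
  exact h

/-- The product `q (m-1) * ⋯ * q j`, the scalar of the diagonal block at level `j` of the matrix
`Y` of a quiver in standard form. -/
def scalarProd (q : Fin m → ℂ) (j : Fin (m + 1)) : ℂ :=
  ∏ i ∈ Finset.univ.filter fun i : Fin m => (j : ℕ) ≤ i, q i

theorem scalarProd_last (q : Fin m → ℂ) : scalarProd q (Fin.last m) = 1 := by
  rw [scalarProd, Finset.filter_false_of_mem fun i _ => not_le.2 i.2, Finset.prod_empty]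

theorem scalarProd_castSucc (q : Fin m → ℂ) (i : Fin m) :
    scalarProd q i.castSucc = q i * scalarProd q i.succ := by
  have hinsert : (Finset.univ.filter fun k : Fin m => (i.castSucc : ℕ) ≤ k) =
      insert i (Finset.univ.filter fun k : Fin m => (i.succ : ℕ) ≤ k) := by
    ext k
    simp only [Finset.mem_filter, Finset.mem_insert, Finset.mem_univ, true_and, Fin.ext_iff,
      Fin.val_castSucc, Fin.val_succ]
    omega
  rw [scalarProd, hinsert, Finset.prod_insert (by simp), scalarProd]

theorem scalarProd_ne_zero {q : Fin m → ℂ} (hq : ∀ i, q i ≠ 0) (j : Fin (m + 1)) :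
    scalarProd q j ≠ 0 := Finset.prod_ne_zero_iff.2 fun i _ => hq i

theorem scalarProd_div (f : Fin (m + 1) → ℂ) (hf : ∀ j, f j ≠ 0) (j : Fin (m + 1)) :
    scalarProd (fun i => f i.castSucc / f i.succ) j = f j / f (Fin.last m) := by
  induction j using Fin.reverseInduction with
  | last => rw [scalarProd_last, div_self (hf _)]
  | cast i ih => rw [scalarProd_castSucc, ih, div_mul_div_cancel₀ (hf _)]

theorem prod_filter_blockIdx (q : Fin m → ℂ) (a : Fin (d (Fin.last m))) :
    ∏ i ∈ Finset.univ.filter (fun i : Fin m => m ≤ (i : ℕ) + blockIdx d a), q i =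
      scalarProd q (level a) :=
  Finset.prod_congr (Finset.filter_congr fun i _ => by simp only [level]; omega) fun _ _ => rfl

theorem mem_scalarBlock_iff_exists {Y : Mat (d (Fin.last m))} :
    Y ∈ scalarBlock d ↔ ∃ q : Fin m → ℂ, (∀ i, q i ≠ 0) ∧
      ∀ r s, level r ≤ level s → Y r s = if r = s then scalarProd q (level s) else 0 := by
  simp only [scalarBlock, Set.mem_ofPred_eq, prod_filter_blockIdx]
  refine ⟨fun ⟨htri, q, hq, hY⟩ => ⟨q, hq, fun r s hrs => ?_⟩, fun ⟨q, hq, hY⟩ =>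
    ⟨fun r s hsr => ?_, q, hq, fun r s hrs => ?_⟩⟩
  · obtain hlt | heq := (blockIdx_le_iff.2 hrs).lt_or_eq
    · rw [htri hlt, if_neg (ne_of_apply_ne _ hlt.ne')]
    · rw [hY r s heq.symm, hrs.antisymm (blockIdx_le_iff.1 heq.ge)]
  · rw [hY r s (blockIdx_le_iff.1 hsr.le), if_neg (ne_of_apply_ne _ hsr.ne')]
  · have hlev : level r = level s :=
      (blockIdx_le_iff.1 hrs.ge).antisymm (blockIdx_le_iff.1 hrs.le)
    rw [hY r s hlev.le, hlev]

/-- Away from the blocks strictly above the diagonal, `Y` is the diagonal matrix of its block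
scalars, which are nonzero, the leading one being `1`. -/
structure IsScalarBlock (hd : StrictMono d) (h0 : 0 < d 0) (Y : Mat (d (Fin.last m))) : Prop where
  blockScalar_last : blockScalar hd h0 Y (Fin.last m) = 1
  blockScalar_ne_zero (j : Fin (m + 1)) : blockScalar hd h0 Y j ≠ 0
  apply_of_level_le {r s : Fin (d (Fin.last m))} (h : level r ≤ level s) :
    Y r s = if r = s then blockScalar hd h0 Y (level s) else 0

theorem mem_scalarBlock_iff (hd : StrictMono d) (h0 : 0 < d 0) {Y : Mat (d (Fin.last m))} :
    Y ∈ scalarBlock d ↔ IsScalarBlock hd h0 Y := by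
  rw [mem_scalarBlock_iff_exists]
  refine ⟨fun ⟨q, hq, hY⟩ => ?_, fun h =>
    ⟨fun i => blockScalar hd h0 Y i.castSucc / blockScalar hd h0 Y i.succ,
      fun i => div_ne_zero (h.2 _) (h.2 _), fun r s hrs => ?_⟩⟩
  · have hscalar : ∀ j, blockScalar hd h0 Y j = scalarProd q j := fun j => by
      rw [blockScalar, hY _ _ le_rfl, if_pos rfl, level_topRow]
    exact ⟨by rw [hscalar, scalarProd_last], fun j => hscalar j ▸ scalarProd_ne_zero hq j,
      fun hrs => by rw [hscalar, hY _ _ hrs]⟩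
  · rw [h.3 hrs, scalarProd_div _ h.2, h.1, div_one]

theorem corner_corner (hd : Monotone d) (M : Mat (d (Fin.last m))) (i : Fin m) :
    stdMat ℂ (d i.castSucc) (d i.succ) * corner (d i.succ) M *
      (stdMat ℂ (d i.castSucc) (d i.succ))ᵀ = corner (d i.castSucc) M := by
  rw [corner, corner, ← stdMat_mul_stdMat (hd i.castSucc_le_succ) (hd (Fin.le_last i.succ)),
    transpose_mul]
  simp only [Matrix.mul_assoc]

/-- The quiver in standard form determined by `Y`. -/
def stdQuiver (hd : StrictMono d) (h0 : 0 < d 0) (Y : Mat (d (Fin.last m))) : QuiverRep d :=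
  (fun i => ((blockScalar hd h0 Y i.succ)⁻¹ • corner (d i.succ) Y - 1) *
      (stdMat ℂ (d i.castSucc) (d i.succ))ᵀ,
    fun i => stdMat ℂ (d i.castSucc) (d i.succ))

theorem isStandard_stdQuiver (hd : StrictMono d) (h0 : 0 < d 0) (Y : Mat (d (Fin.last m))) :
    IsStandard (stdQuiver hd h0 Y) := isStandard_iff.2 fun _ => rfl

theorem incoming_apply_of_isStandard (hd : Monotone d) {x : QuiverRep d} (hx : IsStandard x)
    {j : Fin (m + 1)} {r : Fin (d j)} (s : Fin (d j))
    (hs : level (embLast (hd (Fin.le_last j)) s) = j) : incoming x j r s = 0 := by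
  cases j using Fin.cases with
  | zero => rfl
  | succ i =>
    simp only [incoming, Fin.cases_succ]
    rw [isStandard_iff.1 hx, mul_stdMat_apply_of_le (hd i.castSucc_le_succ)]
    rw [← not_lt, ← rev_embLast (hd (Fin.le_last i.succ)), rev_lt_iff_level_le hd, hs, not_le]
    exact i.castSucc_lt_succ

theorem corner_lastY (hd : Monotone d) {x : QuiverRep d} (hx : IsStandard x) {q : Fin m → ℂ}
    (hq : MultEq x q) (j : Fin (m + 1)) :
    corner (d j) (lastY x) = scalarProd q j • (1 + incoming x j) := by
  induction j using Fin.reverseInduction with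
  | last => rw [corner_self, scalarProd_last, one_smul, lastY]
  | cast i ih =>
    have hE := stdMat_mul_transpose (R := ℂ) (hd i.castSucc_le_succ)
    have hcorner : stdMat ℂ (d i.castSucc) (d i.succ) * (1 + incoming x i.succ) *
        (stdMat ℂ (d i.castSucc) (d i.succ))ᵀ = 1 + x.2 i * x.1 i := by
      simp only [incoming, Fin.cases_succ]
      rw [isStandard_iff.1 hx, Matrix.mul_add, Matrix.add_mul, Matrix.mul_one, hE]
      simp only [Matrix.mul_assoc, hE, Matrix.mul_one]
    rw [← corner_corner hd, ih, Matrix.mul_smul, Matrix.smul_mul, hcorner, hq i, smul_smul,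
      scalarProd_castSucc, mul_comm]

theorem blockScalar_lastY (hd : StrictMono d) (h0 : 0 < d 0) {x : QuiverRep d} (hx : IsStandard x)
    {q : Fin m → ℂ} (hq : MultEq x q) (j : Fin (m + 1)) :
    blockScalar hd h0 (lastY x) j = scalarProd q j := by
  have hinc : incoming x j ⟨0, dim_pos hd.monotone h0 j⟩ ⟨0, dim_pos hd.monotone h0 j⟩ = 0 :=
    incoming_apply_of_isStandard hd.monotone hx _ (level_topRow hd h0 j)
  have hcorner := corner_apply (hd.monotone (Fin.le_last j)) (lastY x) ⟨0, dim_pos hd.monotone h0 j⟩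
    ⟨0, dim_pos hd.monotone h0 j⟩
  rw [blockScalar, topRow, ← hcorner, corner_lastY hd.monotone hx hq, Matrix.smul_apply,
    Matrix.add_apply, hinc, one_apply_eq, add_zero, smul_eq_mul, mul_one]

theorem multEq_ne_zero (hd : StrictMono d) (h0 : 0 < d 0) {x : QuiverRep d} (hx : IsMult x)
    {q : Fin m → ℂ} (hq : MultEq x q) (i : Fin m) : q i ≠ 0 := fun h => by
  have hunit := (hx i).2
  have : Nonempty (Fin (d i.castSucc)) := ⟨⟨0, dim_pos hd.monotone h0 _⟩⟩
  rw [hq i, h, zero_smul] at hunit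
  exact not_isUnit_zero hunit

theorem lastY_mem_scalarBlock (hd : StrictMono d) (h0 : 0 < d 0) {x : QuiverRep d}
    (hx : x ∈ surjSol d) (hst : IsStandard x) : lastY x ∈ scalarBlock d := by
  obtain ⟨hmul, ⟨q, hq⟩, -⟩ := hx
  refine mem_scalarBlock_iff_exists.2 ⟨q, multEq_ne_zero hd h0 hmul hq, fun r s hrs => ?_⟩
  have h := hd.monotone (Fin.le_last (level s))
  obtain ⟨s', hs'⟩ := exists_embLast_eq h (rev_lt_level hd.monotone s)
  obtain ⟨r', hr'⟩ := exists_embLast_eq h ((rev_lt_iff_level_le hd.monotone r _).2 hrs)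
  have hinc : incoming x (level s) r' s' = 0 :=
    incoming_apply_of_isStandard hd.monotone hst s' (congrArg level hs')
  calc lastY x r s = corner (d (level s)) (lastY x) r' s' := by rw [corner_apply h, hr', hs']
    _ = scalarProd q (level s) * (1 : Mat (d (level s))) r' s' := by
      rw [corner_lastY hd.monotone hst hq, Matrix.smul_apply, Matrix.add_apply, hinc, add_zero,
        smul_eq_mul]
    _ = if r = s then scalarProd q (level s) else 0 := by
      simp only [one_apply, mul_ite, mul_one, mul_zero, ← (embLast_injective h).eq_iff, hr', hs']

theorem stdQuiver_lastY (hd : StrictMono d) (h0 : 0 < d 0) {x : QuiverRep d}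
    (hx : x ∈ surjSol d) (hst : IsStandard x) : stdQuiver hd h0 (lastY x) = x := by
  obtain ⟨hmul, ⟨q, hq⟩, -⟩ := hx
  refine Prod.ext (funext fun i => ?_) (funext fun i => (isStandard_iff.1 hst i).symm)
  simp only [stdQuiver]
  rw [blockScalar_lastY hd h0 hst hq, corner_lastY hd.monotone hst hq,
    inv_smul_smul₀ (scalarProd_ne_zero (multEq_ne_zero hd h0 hmul hq) _), add_sub_cancel_left]
  simp only [incoming, Fin.cases_succ]
  rw [isStandard_iff.1 hst, Matrix.mul_assoc, stdMat_mul_transpose (hd.monotone i.castSucc_le_succ),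
    Matrix.mul_one]

namespace IsScalarBlock

variable {hd : StrictMono d} {h0 : 0 < d 0} {Y : Mat (d (Fin.last m))}

theorem isUnit_corner (hY : IsScalarBlock hd h0 Y) (j : Fin (m + 1)) :
    IsUnit (corner (d j) Y) := by
  have h := hd.monotone (Fin.le_last j)
  rw [isUnit_iff_isUnit_det, isUnit_iff_ne_zero, det_of_isUpperTriangular fun a b hab => ?_]
  · refine Finset.prod_ne_zero_iff.2 fun a _ => ?_
    rw [corner_apply h, hY.apply_of_level_le le_rfl, if_pos rfl]
    exact hY.blockScalar_ne_zero _
  · have hlt : embLast h b < embLast h a := Nat.add_lt_add_right hab _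
    rw [corner_apply h, hY.apply_of_level_le (level_anti hd.monotone hlt.le), if_neg hlt.ne']

theorem inv_smul_corner_apply (hY : IsScalarBlock hd h0 Y) {j : Fin (m + 1)} (a : Fin (d j))
    {b : Fin (d j)} (hb : level (embLast (hd.monotone (Fin.le_last j)) b) = j) :
    ((blockScalar hd h0 Y j)⁻¹ • corner (d j) Y) a b = (1 : Mat (d j)) a b := by
  have h := hd.monotone (Fin.le_last j)
  have hle : level (embLast h a) ≤ level (embLast h b) := by
    rw [hb, ← rev_lt_iff_level_le hd.monotone, rev_embLast]
    exact a.rev.2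
  simp only [Matrix.smul_apply, corner_apply h, hY.apply_of_level_le hle, hb, one_apply,
    (embLast_injective h).eq_iff, smul_eq_mul, mul_ite, mul_zero,
    inv_mul_cancel₀ (hY.blockScalar_ne_zero j)]

theorem one_add_incoming_stdQuiver (hY : IsScalarBlock hd h0 Y) (j : Fin (m + 1)) :
    1 + incoming (stdQuiver hd h0 Y) j = (blockScalar hd h0 Y j)⁻¹ • corner (d j) Y := by
  have hle : ∀ (j) (b : Fin (d j)), level (embLast (hd.monotone (Fin.le_last j)) b) ≤ j :=
    fun j b => by
      rw [← rev_lt_iff_level_le hd.monotone, rev_embLast]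
      exact b.rev.2
  cases j using Fin.cases with
  | zero =>
    ext a b
    rw [hY.inv_smul_corner_apply a (Fin.le_zero_iff.1 (hle 0 b)), incoming, Fin.cases_zero,
      add_zero]
  | succ i =>
    have hsucc := hd.monotone i.castSucc_le_succ
    rw [← eq_sub_iff_add_eq']
    simp only [incoming, Fin.cases_succ, stdQuiver]
    ext a b
    by_cases hb : (b.rev : ℕ) < d i.castSucc
    · obtain ⟨b, rfl⟩ := exists_embLast_eq hsucc hb
      rw [mul_stdMat_apply_embLast hsucc, mul_stdMat_transpose hsucc]
      rfl
    · rw [mul_stdMat_apply_of_le hsucc _ _ (not_lt.1 hb), Matrix.sub_apply,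
        hY.inv_smul_corner_apply a ((hle _ b).antisymm ?_), sub_self]
      rwa [← rev_embLast (hd.monotone (Fin.le_last i.succ)), rev_lt_iff_level_le hd.monotone,
        not_le, Fin.castSucc_lt_iff_succ_le] at hb

theorem lastY_stdQuiver (hY : IsScalarBlock hd h0 Y) : lastY (stdQuiver hd h0 Y) = Y := by
  rw [lastY, hY.one_add_incoming_stdQuiver, hY.blockScalar_last, corner_self, inv_one, one_smul]

end IsScalarBlock

theorem beta_mul_alpha_stdQuiver (hd : StrictMono d) (h0 : 0 < d 0) (Y : Mat (d (Fin.last m)))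
    (i : Fin m) : 1 + (stdQuiver hd h0 Y).2 i * (stdQuiver hd h0 Y).1 i =
      (blockScalar hd h0 Y i.succ)⁻¹ • corner (d i.castSucc) Y := by
  simp only [stdQuiver]
  rw [← Matrix.mul_assoc, Matrix.mul_sub, Matrix.sub_mul, Matrix.mul_one,
    stdMat_mul_transpose (hd.monotone i.castSucc_le_succ), Matrix.mul_smul, Matrix.smul_mul,
    corner_corner hd.monotone, add_sub_cancel]

theorem stdQuiver_mem_surjSol (hd : StrictMono d) (h0 : 0 < d 0)
    {Y : Mat (d (Fin.last m))} (hY : Y ∈ scalarBlock d) : stdQuiver hd h0 Y ∈ surjSol d := by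
  rw [mem_scalarBlock_iff hd h0] at hY
  have hunit : ∀ {j k}, IsUnit ((blockScalar hd h0 Y j)⁻¹ • corner (d k) Y) := fun {j k} =>
    (hY.isUnit_corner k).smul (Units.mk0 _ (inv_ne_zero (hY.blockScalar_ne_zero j)))
  refine ⟨fun i => ⟨?_, ?_⟩, ⟨fun i => blockScalar hd h0 Y i.castSucc / blockScalar hd h0 Y i.succ,
    fun i => ?_⟩, fun i => mulVec_surjective_iff_exists_right_inverse.2
      ⟨_, stdMat_mul_transpose (hd.monotone i.castSucc_le_succ)⟩⟩
  · have hinc := hY.one_add_incoming_stdQuiver i.succ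
    simp only [incoming, Fin.cases_succ] at hinc
    rw [hinc]
    exact hunit
  · rw [beta_mul_alpha_stdQuiver]
    exact hunit
  · rw [beta_mul_alpha_stdQuiver, hY.one_add_incoming_stdQuiver, smul_smul, div_mul_eq_mul_div,
      mul_inv_cancel₀ (hY.blockScalar_ne_zero _), one_div]

theorem lastY_stdQuiver (hd : StrictMono d) (h0 : 0 < d 0)
    {Y : Mat (d (Fin.last m))} (hY : Y ∈ scalarBlock d) : lastY (stdQuiver hd h0 Y) = Y :=
  ((mem_scalarBlock_iff hd h0).1 hY).lastY_stdQuiver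

theorem bijOn_lastY (hd : StrictMono d) (h0 : 0 < d 0) :
    Set.BijOn lastY {x | x ∈ surjSol d ∧ IsStandard x} (scalarBlock d) :=
  Set.InvOn.bijOn (f' := stdQuiver hd h0)
    ⟨fun _ hx => stdQuiver_lastY hd h0 hx.1 hx.2, fun _ hY => lastY_stdQuiver hd h0 hY⟩
    (fun _ hx => lastY_mem_scalarBlock hd h0 hx.1 hx.2)
    fun Y hY => ⟨stdQuiver_mem_surjSol hd h0 hY, isStandard_stdQuiver hd h0 Y⟩

end Standard

/-! ## Maximal minors and the normal form -/

section Forms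

section CommRing

variable {R : Type*} [CommRing R] {a n : ℕ}

/-- The alternating form `v ↦ det (M v₁, …, M v_a)`, whose coefficients are the maximal minors
of `M`. -/
def minorForm (M : Matrix (Fin a) (Fin n) R) : (Fin n → R) [⋀^Fin a]→ₗ[R] R :=
  detRowAlternating.compLinearMap M.mulVecLin

theorem minorForm_apply (M : Matrix (Fin a) (Fin n) R) (v : Fin a → Fin n → R) :
    minorForm M v = (of fun i => M *ᵥ v i).det := rfl

theorem minorForm_mul (A : Matrix (Fin a) (Fin a) R) (M : Matrix (Fin a) (Fin n) R) :
    minorForm (A * M) = A.det • minorForm M := by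
  ext v
  rw [AlternatingMap.smul_apply, minorForm_apply, minorForm_apply, smul_eq_mul, mul_comm,
    ← det_transpose A, ← det_mul]
  congr 1
  ext i j
  rw [of_apply, ← mulVec_mulVec, mul_apply]
  simp only [mulVec, dotProduct, of_apply, transpose_apply, mul_comm]

theorem minorForm_mulVec_single (M : Matrix (Fin a) (Fin n) R) (g : Matrix (Fin n) (Fin n) R)
    (t : Fin a → Fin n) :
    minorForm M (fun i => g *ᵥ Pi.single (t i) 1) = ((M * g).submatrix id t).det := by
  rw [minorForm_apply, ← det_transpose]
  congr 1
  ext i j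
  simp only [transpose_apply, of_apply, submatrix_apply, mulVec_single_one, id]
  rfl

theorem det_submatrix_update (M : Matrix (Fin a) (Fin n) R) (t : Fin a → Fin n) (r : Fin a)
    (b : Fin n) : (M.submatrix id (Function.update t r b)).det =
      ((M.submatrix id t).adjugate * M) r b := by
  have h : M.submatrix id (Function.update t r b) =
      (M.submatrix id t).updateCol r (fun i => M i b) := by
    ext i j
    by_cases hj : j = r
    · subst hj; simp
    · simp [hj]
  rw [h, ← cramer_apply, cramer_eq_adjugate_mulVec]
  rfl

end CommRing

instance finite_alternatingMap (a n : ℕ) : Module.Finite ℂ ((Fin n → ℂ) [⋀^Fin a]→ₗ[ℂ] ℂ) :=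
  Module.Finite.of_injective (AlternatingMap.toMultilinearMapLM (R := ℂ) (S := ℂ)
    (M := Fin n → ℂ) (N := ℂ) (ι := Fin a)) AlternatingMap.coe_multilinearMap_injective

theorem isRegularMap_minorForm {V : Type*} [AddCommGroup V] [Module ℂ V] {a n : ℕ} {U : Set V}
    {M : V → Matrix (Fin a) (Fin n) ℂ} (hM : IsRegularMap M U) :
    IsRegularMap (fun v => minorForm (M v)) U := by
  let coordinates : ((Fin n → ℂ) [⋀^Fin a]→ₗ[ℂ] ℂ) →ₗ[ℂ] ((Fin a → Fin n) → ℂ) :=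
    { toFun := fun ω t => ω fun i => (1 : Mat n) *ᵥ Pi.single (t i) 1
      map_add' := fun _ _ => rfl
      map_smul' := fun _ _ => rfl }
  have hker : LinearMap.ker coordinates = ⊥ := by
    rw [LinearMap.ker_eq_bot]
    intro ω ω' h
    refine Module.Basis.ext_alternating (Pi.basisFun ℂ (Fin n)) fun t _ => ?_
    have ht : (ω fun i => (1 : Mat n) *ᵥ Pi.single (t i) 1) =
      ω' fun i => (1 : Mat n) *ᵥ Pi.single (t i) 1 := congrFun h t
    simpa only [one_mulVec, Pi.basisFun_apply] using ht
  obtain ⟨L, hL⟩ := coordinates.exists_leftInverse_of_injective hker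
  have hreg : IsRegularMap (fun v => coordinates (minorForm (M v))) U :=
    IsRegularMap.pi fun t => .of_regularOn <| by
      have hdet : IsRegularOn (fun v => ((M v).submatrix id t).det) U :=
        HasEntriesIn.det (S := regularFun U) (M := fun v => (M v).submatrix id t)
          fun i j => hM.hasEntriesIn i (t j)
      refine hdet.congr fun v _ => ?_
      change minorForm (M v) (fun i => (1 : Mat n) *ᵥ Pi.single (t i) 1) = _
      rw [minorForm_mulVec_single, Matrix.mul_one]
  exact (hreg.linear_comp L).congr fun v _ => (LinearMap.congr_fun hL _).symm

end Forms

section NormalForm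

variable {m : ℕ} {d : Fin (m + 1) → ℕ}

variable (d) in
/-- The space in which the invariants take their values. -/
abbrev InvSpace : Type :=
  Mat (d (Fin.last m)) × ∀ j : Fin (m + 1), (Fin (d (Fin.last m)) → ℂ) [⋀^Fin (d j)]→ₗ[ℂ] ℂ

/-- The value of the form with index `j` at the columns of `g` with indices `t`. -/
def coeff (g : Mat (d (Fin.last m))) (j : Fin (m + 1)) (t : Fin (d j) → Fin (d (Fin.last m))) :
    Module.Dual ℂ (InvSpace d) where
  toFun z := z.2 j fun i => g *ᵥ Pi.single (t i) 1
  map_add' _ _ := rfl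
  map_smul' _ _ := rfl

/-- The value of the form with index `j` at the last `d j` columns of `g`. -/
def leadCoeff (hd : StrictMono d) (g : Mat (d (Fin.last m))) (j : Fin (m + 1)) :
    Module.Dual ℂ (InvSpace d) := coeff g j (embLast (hd.monotone (Fin.le_last j)))

/-- Quotients of successive leading coefficients. -/
def leadRatio (hd : StrictMono d) (g : Mat (d (Fin.last m))) (z : InvSpace d) :
    Fin (m + 1) → ℂ :=
  Fin.cases (leadCoeff hd g 0 z) fun i => leadCoeff hd g i.succ z / leadCoeff hd g i.castSucc z

/-- The scale of the row `r` of the normal form. -/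
def rowScale (hd : StrictMono d) (h0 : 0 < d 0) (g : Mat (d (Fin.last m))) (z : InvSpace d)
    (r : Fin (d (Fin.last m))) : ℂ :=
  ∏ j, if r = topRow hd h0 j then leadRatio hd g z j else 1

/-- The position of the row `r` among the last `d (level r)` rows. -/
def posInBlock (hd : StrictMono d) (r : Fin (d (Fin.last m))) : Fin (d (level r)) :=
  (exists_embLast_eq (hd.monotone (Fin.le_last (level r))) (rev_lt_level hd.monotone r)).choose

theorem embLast_posInBlock (hd : StrictMono d) (r : Fin (d (Fin.last m))) :
    embLast (hd.monotone (Fin.le_last (level r))) (posInBlock hd r) = r :=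
  (exists_embLast_eq (hd.monotone (Fin.le_last (level r))) (rev_lt_level hd.monotone r)).choose_spec

/-- A block lower triangular representative, with respect to the basis given by the columns of `g`,
of the class of matrices with given minors. -/
def normalMat (hd : StrictMono d) (h0 : 0 < d 0) (g : Mat (d (Fin.last m))) (z : InvSpace d) :
    Mat (d (Fin.last m)) := of fun r b =>
  rowScale hd h0 g z r * ((leadCoeff hd g (level r) z)⁻¹ *
    coeff g (level r) (Function.update (embLast (hd.monotone (Fin.le_last (level r))))
      (posInBlock hd r) b) z)

theorem prod_leadRatio (hd : StrictMono d) {g : Mat (d (Fin.last m))} {z : InvSpace d}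
    (hz : ∀ j, leadCoeff hd g j z ≠ 0) (j : Fin (m + 1)) :
    ∏ i ∈ Finset.univ.filter (fun i => i ≤ j), leadRatio hd g z i = leadCoeff hd g j z := by
  induction j using Fin.induction with
  | zero =>
    have : (Finset.univ.filter fun i : Fin (m + 1) => i ≤ 0) = {0} := by
      ext i; simp
    rw [this, Finset.prod_singleton]
    rfl
  | succ i ih =>
    have : (Finset.univ.filter fun k => k ≤ i.succ) =
        insert i.succ (Finset.univ.filter fun k => k ≤ i.castSucc) := by
      ext k
      simp only [Finset.mem_filter, Finset.mem_insert, Finset.mem_univ, true_and, Fin.ext_iff,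
        Fin.le_def, Fin.val_castSucc, Fin.val_succ]
      omega
    rw [this, Finset.prod_insert (by simp [Fin.le_def]), ih]
    exact div_mul_cancel₀ _ (hz _)

theorem prod_rowScale (hd : StrictMono d) (h0 : 0 < d 0) {g : Mat (d (Fin.last m))}
    {z : InvSpace d} (hz : ∀ j, leadCoeff hd g j z ≠ 0) (j : Fin (m + 1)) :
    ∏ a, rowScale hd h0 g z (embLast (hd.monotone (Fin.le_last j)) a) = leadCoeff hd g j z := by
  simp only [rowScale]
  rw [Finset.prod_comm, ← prod_leadRatio hd hz, Finset.prod_filter]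
  refine Finset.prod_congr rfl fun i _ => ?_
  split_ifs with hij
  · obtain ⟨a, ha⟩ := exists_embLast_eq (hd.monotone (Fin.le_last j)) (j := topRow hd h0 i)
      ((rev_lt_iff_level_le hd.monotone _ _).2 (by rwa [level_topRow]))
    rw [← ha]
    simp only [(embLast_injective (hd.monotone (Fin.le_last j))).eq_iff]
    simp
  · refine Finset.prod_eq_one fun a _ => if_neg fun h => hij ?_
    rw [← level_topRow hd h0 i, ← h, ← rev_lt_iff_level_le hd.monotone, rev_embLast]
    exact a.rev.2

/-- The forms determined by the last rows of `k`. -/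
def flagForms (d : Fin (m + 1) → ℕ) (k : Mat (d (Fin.last m))) (j : Fin (m + 1)) :
    (Fin (d (Fin.last m)) → ℂ) [⋀^Fin (d j)]→ₗ[ℂ] ℂ :=
  minorForm (stdMat ℂ (d j) (d (Fin.last m)) * k)

theorem coeff_flagForms (g k Y : Mat (d (Fin.last m))) (j : Fin (m + 1))
    (t : Fin (d j) → Fin (d (Fin.last m))) : coeff g j t (Y, flagForms d k) =
      ((stdMat ℂ (d j) (d (Fin.last m)) * (k * g)).submatrix id t).det := by
  rw [← Matrix.mul_assoc, ← minorForm_mulVec_single]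
  rfl

theorem leadCoeff_flagForms (hd : StrictMono d) (g k Y : Mat (d (Fin.last m)))
    (j : Fin (m + 1)) : leadCoeff hd g j (Y, flagForms d k) = (corner (d j) (k * g)).det := by
  rw [leadCoeff, coeff_flagForms, corner, mul_stdMat_transpose (hd.monotone (Fin.le_last j))]

/-- The matrix carrying `K` to its normal form: its row `r` extracts, up to the scale of that row,
the corresponding row of the inverse of the corner of `K` at the level of `r`. -/
def normalFactor (hd : StrictMono d) (h0 : 0 < d 0) (g : Mat (d (Fin.last m))) (z : InvSpace d)
    (K : Mat (d (Fin.last m))) : Mat (d (Fin.last m)) := of fun r s =>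
  rowScale hd h0 g z r * ((leadCoeff hd g (level r) z)⁻¹ *
    ((corner (d (level r)) K).adjugate * stdMat ℂ (d (level r)) (d (Fin.last m)))
      (posInBlock hd r) s)

theorem normalFactor_blockTriangular (hd : StrictMono d) (h0 : 0 < d 0)
    (g : Mat (d (Fin.last m))) (z : InvSpace d) (K : Mat (d (Fin.last m))) :
    (normalFactor hd h0 g z K).BlockTriangular (blockIdx d) := fun r s hrs => by
  have hlt : level r < level s := by
    rw [← not_le, ← blockIdx_le_iff, not_le]; exact hrs
  rw [normalFactor, of_apply, mul_stdMat_apply_of_le (hd.monotone (Fin.le_last _)), mul_zero,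
    mul_zero]
  rwa [← not_lt, rev_lt_iff_level_le hd.monotone, not_le]

section FlagForms

variable (hd : StrictMono d) (h0 : 0 < d 0) (g k Y : Mat (d (Fin.last m)))

theorem normalMat_flagForms_apply (r b : Fin (d (Fin.last m))) :
    normalMat hd h0 g (Y, flagForms d k) r b = rowScale hd h0 g (Y, flagForms d k) r *
      ((leadCoeff hd g (level r) (Y, flagForms d k))⁻¹ *
        ((corner (d (level r)) (k * g)).adjugate *
          (stdMat ℂ (d (level r)) (d (Fin.last m)) * (k * g))) (posInBlock hd r) b) := by
  rw [normalMat, of_apply, coeff_flagForms, det_submatrix_update, corner,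
    mul_stdMat_transpose (hd.monotone (Fin.le_last (level r)))]

theorem normalMat_flagForms : normalMat hd h0 g (Y, flagForms d k) =
    normalFactor hd h0 g (Y, flagForms d k) (k * g) * (k * g) := by
  ext r b
  rw [normalMat_flagForms_apply, ← Matrix.mul_assoc, mul_apply, mul_apply, Finset.mul_sum,
    Finset.mul_sum]
  refine Finset.sum_congr rfl fun s _ => ?_
  rw [normalFactor, of_apply]
  ring

variable {g k Y}

theorem normalMat_flagForms_of_level_le {r s : Fin (d (Fin.last m))} (hrs : level s ≤ level r)
    (hz : leadCoeff hd g (level r) (Y, flagForms d k) ≠ 0) :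
    normalMat hd h0 g (Y, flagForms d k) r s =
      if r = s then rowScale hd h0 g (Y, flagForms d k) r else 0 := by
  have hle := hd.monotone (Fin.le_last (level r))
  obtain ⟨s', hs'⟩ := exists_embLast_eq hle ((rev_lt_iff_level_le hd.monotone s _).2 hrs)
  have hcorner : ((corner (d (level r)) (k * g)).adjugate *
      (stdMat ℂ (d (level r)) (d (Fin.last m)) * (k * g))) (posInBlock hd r) s =
        ((corner (d (level r)) (k * g)).adjugate * corner (d (level r)) (k * g))
          (posInBlock hd r) s' := by
    rw [mul_apply, mul_apply]
    refine Finset.sum_congr rfl fun i _ => ?_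
    rw [corner_apply hle, hs', stdMat_mul hle]
    rfl
  have heq : posInBlock hd r = s' ↔ r = s := by
    rw [← (embLast_injective hle).eq_iff, embLast_posInBlock, hs']
  rw [normalMat_flagForms_apply, hcorner, adjugate_mul, Matrix.smul_apply, smul_eq_mul,
    ← leadCoeff_flagForms hd g k Y, inv_mul_cancel_left₀ hz, one_apply]
  simp only [heq, mul_ite, mul_one, mul_zero]

theorem det_corner_normalMat (hz : ∀ j, leadCoeff hd g j (Y, flagForms d k) ≠ 0)
    (j : Fin (m + 1)) : (corner (d j) (normalMat hd h0 g (Y, flagForms d k))).det =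
      leadCoeff hd g j (Y, flagForms d k) := by
  have hle := hd.monotone (Fin.le_last j)
  rw [det_of_isLowerTriangular _ fun a b hab => ?_]
  · rw [← prod_rowScale hd h0 hz]
    refine Finset.prod_congr rfl fun a _ => ?_
    rw [corner_apply hle, normalMat_flagForms_of_level_le hd h0 le_rfl (hz _), if_pos rfl]
  · have hlt : embLast hle a < embLast hle b := by
      have hab' : a < b := hab
      simp only [embLast, Fin.lt_def] at hab' ⊢
      omega
    rw [corner_apply hle, normalMat_flagForms_of_level_le hd h0 (level_anti hd.monotone hlt.le)
      (hz _), if_neg hlt.ne]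

theorem det_corner_normalFactor (hz : ∀ j, leadCoeff hd g j (Y, flagForms d k) ≠ 0)
    (j : Fin (m + 1)) :
    (corner (d j) (normalFactor hd h0 g (Y, flagForms d k) (k * g))).det = 1 := by
  have h := det_corner_normalMat hd h0 hz j
  rw [normalMat_flagForms, corner_mul hd.monotone (normalFactor_blockTriangular ..), det_mul,
    ← leadCoeff_flagForms hd g k Y] at h
  exact mul_right_cancel₀ (hz j) (h.trans (one_mul _).symm)

end FlagForms

theorem exists_normalMat_eq (hd : StrictMono d) (h0 : 0 < d 0) (g k : SLC (d (Fin.last m)))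
    (Y : Mat (d (Fin.last m))) (hz : ∀ j, leadCoeff hd g.1 j (Y, flagForms d k) ≠ 0) :
    ∃ p ∈ unimodularParabolic hd.monotone,
      normalMat hd h0 g (Y, flagForms d k) = (p * (k * g)).1 := by
  have hdet : (normalFactor hd h0 g.1 (Y, flagForms d k) (k * g)).det = 1 := by
    simpa only [corner_self] using det_corner_normalFactor hd h0 hz (Fin.last m)
  exact ⟨⟨_, hdet⟩, ⟨normalFactor_blockTriangular .., det_corner_normalFactor hd h0 hz⟩,
    normalMat_flagForms hd h0 g.1 k.1 Y⟩

end NormalForm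

/-! ## The quotient `SL ×_S F` -/

section Transfer

variable {V V' W : Type*} [AddCommGroup V] [Module ℂ V] [AddCommGroup V'] [Module ℂ V']
  [AddCommGroup W] [Module ℂ W]

theorem isGeometricQuotient_transfer {G : Type*} [Group G] {act' : G → V' → V'} {X : Set V}
    {X' : Set V'} {π : V → W} {π' : V' → W} {φ : V → V'} (hZ : IsQuasiAffine (π '' X))
    (hσ : ∀ z ∈ π '' X, ∃ c σ, c z ≠ 0 ∧ IsLocalSection X π c σ) (hX' : IsQuasiAffine X')
    (hmul : ∀ g h : G, ∀ x, act' (g * h) x = act' g (act' h x)) (hone : ∀ x, act' 1 x = x)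
    (hstable : ∀ g : G, ∀ x ∈ X', act' g x ∈ X') (hπ' : IsRegularMap π' X')
    (hinv : ∀ g : G, ∀ x ∈ X', π' (act' g x) = π' x) (hφ : IsRegularMap φ X)
    (hmaps : Set.MapsTo φ X X') (hcomp : ∀ u ∈ X, π' (φ u) = π u)
    (hmeet : ∀ x ∈ X', ∃ u ∈ X, ∃ g, act' g (φ u) = x)
    (hfib : ∀ u ∈ X, ∀ u' ∈ X, π u = π u' → ∃ g, act' g (φ u) = φ u') :
    IsGeometricQuotient act' X' (π '' X) π' := by
  have himg : π' '' X' = π '' X := by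
    apply Set.Subset.antisymm
    · rintro _ ⟨x, hx, rfl⟩
      obtain ⟨u, hu, g, rfl⟩ := hmeet x hx
      exact ⟨u, hu, by rw [hinv g _ (hmaps hu), hcomp u hu]⟩
    · rintro _ ⟨u, hu, rfl⟩
      exact ⟨φ u, hmaps hu, hcomp u hu⟩
  rw [← himg] at hZ ⊢
  refine isGeometricQuotient_of_sections hX' hstable hπ' (fun x hx y hy => ⟨fun h => ?_, ?_⟩) hZ ?_
  · obtain ⟨u, hu, g, rfl⟩ := hmeet x hx
    obtain ⟨u', hu', g', rfl⟩ := hmeet y hy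
    rw [hinv g _ (hmaps hu), hinv g' _ (hmaps hu'), hcomp u hu, hcomp u' hu'] at h
    obtain ⟨k, hk⟩ := hfib u hu u' hu' h
    exact ⟨g' * k * g⁻¹, by rw [hmul, hmul, ← hmul g⁻¹, inv_mul_cancel, hone, hk]⟩
  · rintro ⟨g, rfl⟩
    exact (hinv g x hx).symm
  · rw [himg]
    intro z hz
    obtain ⟨c, σ, hc, h⟩ := hσ z hz
    exact ⟨c, _, hc, h.comp_map hφ hmaps hcomp himg⟩

end Transfer

section SlProd

variable {n : ℕ} {F : Set (Mat n)}

theorem exists_coe_of_mem_slProd {z : Mat n × Mat n} (hz : z ∈ slProd F) :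
    ∃ g : SLC n, ∃ v ∈ F, z = (g.1, v) := ⟨⟨z.1, hz.1⟩, z.2, hz.2, rfl⟩

theorem coe_mem_slProd (g : SLC n) {v : Mat n} (hv : v ∈ F) : (g.1, v) ∈ slProd F :=
  ⟨g.det_coe, hv⟩

theorem isZariskiClosed_setOf_det_eq_one : IsZariskiClosed {A : Mat n | A.det = 1} :=
  ⟨{fun A => A.det - 1}, Set.singleton_subset_iff.2
    (sub_mem hasEntriesIn_polyFun_id.det ((polyFun (Mat n)).algebraMap_mem 1)), by
      simp only [Set.mem_singleton_iff, forall_eq, sub_eq_zero]⟩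

theorem isQuasiAffine_slProd (hF : IsQuasiAffine F) : IsQuasiAffine (slProd F) := by
  have h := (hF.preimage (LinearMap.snd ℂ (Mat n) (Mat n))).inter_isZariskiClosed
    (isZariskiClosed_setOf_det_eq_one.preimage (LinearMap.fst ℂ (Mat n) (Mat n)))
  rwa [Set.inter_comm] at h

/-- The set `F` of matrices is stable under conjugation by the group `S`. -/
def IsConjStable (S : Subgroup (SLC n)) (F : Set (Mat n)) : Prop :=
  ∀ p ∈ S, ∀ v ∈ F, p.1 * v * (p⁻¹).1 ∈ F

variable {S : Subgroup (SLC n)}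

theorem twist_mem_slProd (hF : IsConjStable S F) (p : S) {z : Mat n × Mat n}
    (hz : z ∈ slProd F) : twist S p z ∈ slProd F :=
  ⟨by rw [twist, det_mul, hz.1, Matrix.SpecialLinearGroup.det_coe, one_mul], hF p p.2 z.2 hz.2⟩

theorem twist_one (z : Mat n × Mat n) : twist S 1 z = z := by
  simp [twist]

theorem twist_mul (p q : S) (z : Mat n × Mat n) :
    twist S (p * q) z = twist S p (twist S q z) := by
  simp only [twist, Subgroup.coe_mul, _root_.mul_inv_rev, Matrix.SpecialLinearGroup.coe_mul,
    Matrix.mul_assoc]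

end SlProd

section TwistInv

variable {m : ℕ} {d : Fin (m + 1) → ℕ}

theorem flagForms_mul (hd : Monotone d) {p : SLC (d (Fin.last m))}
    (hp : p ∈ unimodularParabolic hd) (k : Mat (d (Fin.last m))) :
    flagForms d (p.1 * k) = flagForms d k := by
  ext1 j
  rw [flagForms, ← Matrix.mul_assoc, stdMat_mul_of_blockTriangular hd hp.1, Matrix.mul_assoc,
    minorForm_mul, hp.2, one_smul, flagForms]

variable (d) in
/-- The invariants of the class of `(g, v)` in `SL ×_[P,P] F`: the matrix `g v g⁻¹`, together with
the maximal minors of the last rows of `g⁻¹`. The adjugate, which is polynomial, takes the place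
of the inverse. -/
def twistInv (z : Mat (d (Fin.last m)) × Mat (d (Fin.last m))) : InvSpace d :=
  (z.1 * z.2 * z.1.adjugate, flagForms d z.1.adjugate)

theorem twistInv_coe (g : SLC (d (Fin.last m))) (v : Mat (d (Fin.last m))) :
    twistInv d (g.1, v) = (g.1 * v * (g⁻¹).1, flagForms d (g⁻¹).1) := by
  rw [twistInv, Matrix.SpecialLinearGroup.coe_inv]

theorem isRegularMap_twistInv (U : Set (Mat (d (Fin.last m)) × Mat (d (Fin.last m)))) :
    IsRegularMap (twistInv d) U :=
  have hfst := (IsRegularMap.id U).fst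
  have hsnd := (IsRegularMap.id U).snd
  ((hfst.matMul hsnd).matMul hfst.adjugate).prodMk (IsRegularMap.pi fun _ =>
    isRegularMap_minorForm ((IsRegularMap.const _ U).matMul hfst.adjugate))

theorem twistInv_twist (hd : Monotone d) (p : unimodularParabolic hd)
    (g : SLC (d (Fin.last m))) (v : Mat (d (Fin.last m))) :
    twistInv d (twist _ p (g.1, v)) = twistInv d (g.1, v) := by
  rw [twist, ← Matrix.SpecialLinearGroup.coe_mul, twistInv_coe, twistInv_coe,
    _root_.mul_inv_rev, inv_inv, Matrix.SpecialLinearGroup.coe_mul,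
    Matrix.SpecialLinearGroup.coe_mul, flagForms_mul hd p.2]
  simp only [Matrix.mul_assoc, coe_inv_mul_cancel_left]

variable (hd : StrictMono d)

/-- The function whose non-vanishing defines the chart of the quotient attached to `g`. -/
def chart (g : Mat (d (Fin.last m))) (z : InvSpace d) : ℂ := ∏ j, leadCoeff hd g j z

/-- The section over the chart attached to `g`: with `N = p (k g)` the normal form of the class of
`k g`, the matrix `N g⁻¹ = p k` represents the class of `k`. -/
def chartSection (h0 : 0 < d 0) (g : Mat (d (Fin.last m))) (z : InvSpace d) :
    Mat (d (Fin.last m)) × Mat (d (Fin.last m)) :=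
  ((normalMat hd h0 g z * g.adjugate).adjugate,
    normalMat hd h0 g z * g.adjugate * z.1 * (normalMat hd h0 g z * g.adjugate).adjugate)

theorem chart_mem_polyFun (g : Mat (d (Fin.last m))) : chart hd g ∈ polyFun (InvSpace d) := by
  have h : ∏ j, ⇑(leadCoeff hd g j) ∈ polyFun (InvSpace d) :=
    prod_mem fun _ _ => dual_mem_polyFun _
  convert h using 1
  ext z
  rw [chart, Finset.prod_apply]

variable {hd} in
theorem chart_ne_zero_iff {g : Mat (d (Fin.last m))} {z : InvSpace d} :
    chart hd g z ≠ 0 ↔ ∀ j, leadCoeff hd g j z ≠ 0 := by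
  simp [chart, Finset.prod_ne_zero_iff]

theorem chart_twistInv_self (g : SLC (d (Fin.last m))) (v : Mat (d (Fin.last m))) :
    chart hd g (twistInv d (g.1, v)) = 1 := by
  refine Finset.prod_eq_one fun j _ => ?_
  rw [twistInv_coe, leadCoeff_flagForms, coe_inv_mul_coe,
    corner_one (hd.monotone (Fin.le_last j)), det_one]

theorem isRegularMap_chartSection (h0 : 0 < d 0) (g : Mat (d (Fin.last m))) :
    IsRegularMap (chartSection hd h0 g) {z | chart hd g z ≠ 0} := by
  have hdual : ∀ l : Module.Dual ℂ (InvSpace d), IsRegularOn l {z | chart hd g z ≠ 0} :=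
    fun l => .of_mem_polyFun (dual_mem_polyFun l) _
  have hne : ∀ j, ∀ z ∈ {z | chart hd g z ≠ 0}, leadCoeff hd g j z ≠ 0 := fun j z hz =>
    chart_ne_zero_iff.1 hz j
  have hscale : ∀ r, IsRegularOn (fun z => rowScale hd h0 g z r) {z | chart hd g z ≠ 0} := by
    refine fun r => IsRegularOn.prod _ fun j _ => ?_
    split_ifs
    · cases j using Fin.cases with
      | zero => exact hdual _
      | succ i => exact (hdual _).div (hdual _) (hne _)
    · exact IsRegularOn.const _ _
  have hN : IsRegularMap (normalMat hd h0 g) {z | chart hd g z ≠ 0} :=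
    .of_hasEntriesIn fun r b => (hscale r).mul (((hdual _).inv (hne _)).mul (hdual _))
  have hNg := hN.matMul (IsRegularMap.const g.adjugate _)
  exact hNg.adjugate.prodMk ((hNg.matMul (IsRegularMap.id _).fst).matMul hNg.adjugate)

theorem exists_chartSection_twistInv_eq (h0 : 0 < d 0)
    (g k : SLC (d (Fin.last m))) (v : Mat (d (Fin.last m)))
    (hc : chart hd g (twistInv d (k.1, v)) ≠ 0) :
    ∃ p : unimodularParabolic hd.monotone,
      chartSection hd h0 g (twistInv d (k.1, v)) = twist _ p (k.1, v) := by
  rw [chart_ne_zero_iff] at hc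
  rw [twistInv_coe] at hc ⊢
  obtain ⟨p, hp, hN⟩ := exists_normalMat_eq hd h0 g k⁻¹ _ hc
  have hNg : normalMat hd h0 g (k.1 * v * (k⁻¹).1, flagForms d (k⁻¹).1) * g.1.adjugate =
      (p * k⁻¹).1 := by
    rw [hN, ← Matrix.SpecialLinearGroup.coe_inv, ← Matrix.SpecialLinearGroup.coe_mul]
    simp only [mul_assoc, mul_inv_cancel, mul_one]
  refine ⟨⟨p, hp⟩, ?_⟩
  rw [chartSection, hNg, ← Matrix.SpecialLinearGroup.coe_inv, _root_.mul_inv_rev, inv_inv, twist]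
  simp only [Matrix.SpecialLinearGroup.coe_mul, Matrix.mul_assoc, coe_inv_mul_cancel_left]

variable {F : Set (Mat (d (Fin.last m)))}

theorem isLocalSection_chart (h0 : 0 < d 0) (hF : IsConjStable (unimodularParabolic hd.monotone) F)
    (g : SLC (d (Fin.last m))) :
    IsLocalSection (slProd F) (twistInv d) (chart hd g) (chartSection hd h0 g) where
  poly := chart_mem_polyFun hd _
  regular := (isRegularMap_chartSection hd h0 _).mono Set.inter_subset_right
  mem := by
    rintro _ ⟨x, hx, rfl⟩ hc
    obtain ⟨k, v, -, rfl⟩ := exists_coe_of_mem_slProd hx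
    obtain ⟨p, h⟩ := exists_chartSection_twistInv_eq hd h0 g k v hc
    exact h ▸ twist_mem_slProd hF p hx
  right_inv := by
    rintro _ ⟨x, hx, rfl⟩ hc
    obtain ⟨k, v, -, rfl⟩ := exists_coe_of_mem_slProd hx
    obtain ⟨p, h⟩ := exists_chartSection_twistInv_eq hd h0 g k v hc
    rw [h, twistInv_twist]

theorem exists_isLocalSection_twistInv (h0 : 0 < d 0)
    (hF : IsConjStable (unimodularParabolic hd.monotone) F) :
    ∀ z ∈ twistInv d '' slProd F, ∃ c σ, c z ≠ 0 ∧ IsLocalSection (slProd F) (twistInv d) c σ ∧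
      IsRegularMap σ {w | c w ≠ 0} := by
  rintro _ ⟨x, hx, rfl⟩
  obtain ⟨g, v, -, rfl⟩ := exists_coe_of_mem_slProd hx
  refine ⟨_, _, ?_, isLocalSection_chart hd h0 hF g, isRegularMap_chartSection hd h0 _⟩
  rw [chart_twistInv_self]
  exact one_ne_zero

theorem isQuasiAffine_image_twistInv (h0 : 0 < d 0)
    (hF : IsConjStable (unimodularParabolic hd.monotone) F)
    (hFq : IsQuasiAffine F) : IsQuasiAffine (twistInv d '' slProd F) :=
  isQuasiAffine_image (isQuasiAffine_slProd hFq) (isRegularMap_twistInv _)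
    (exists_isLocalSection_twistInv hd h0 hF)

theorem twistInv_eq_iff (h0 : 0 < d 0) (g g' : SLC (d (Fin.last m))) (v v' : Mat (d (Fin.last m))) :
    twistInv d (g.1, v) = twistInv d (g'.1, v') ↔
      ∃ p : unimodularParabolic hd.monotone, twist _ p (g.1, v) = (g'.1, v') := by
  refine ⟨fun h => ?_, fun ⟨p, hp⟩ => by rw [← hp, twistInv_twist]⟩
  have hc : chart hd g (twistInv d (g.1, v)) ≠ 0 := by
    rw [chart_twistInv_self]
    exact one_ne_zero
  obtain ⟨p, hp⟩ := exists_chartSection_twistInv_eq hd h0 g g v hc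
  obtain ⟨p', hp'⟩ := exists_chartSection_twistInv_eq hd h0 g g' v' (h ▸ hc)
  refine ⟨p'⁻¹ * p, ?_⟩
  rw [twist_mul, ← hp, h, hp', ← twist_mul, inv_mul_cancel, twist_one]

theorem isGeometricQuotient_twist (h0 : 0 < d 0)
    (hF : IsConjStable (unimodularParabolic hd.monotone) F)
    (hFq : IsQuasiAffine F) :
    IsGeometricQuotient (twist (unimodularParabolic hd.monotone)) (slProd F)
      (twistInv d '' slProd F) (twistInv d) := by
  refine isGeometricQuotient_of_sections (isQuasiAffine_slProd hFq)
    (fun p _ => twist_mem_slProd hF p) (isRegularMap_twistInv _) (fun x hx y hy => ?_)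
    (isQuasiAffine_image_twistInv hd h0 hF hFq) fun z hz => ?_
  · obtain ⟨g, v, -, rfl⟩ := exists_coe_of_mem_slProd hx
    obtain ⟨g', v', -, rfl⟩ := exists_coe_of_mem_slProd hy
    exact twistInv_eq_iff hd h0 g g' v v'
  · obtain ⟨c, σ, hc, hs, -⟩ := exists_isLocalSection_twistInv hd h0 hF z hz
    exact ⟨c, σ, hc, hs⟩

end TwistInv

/-! ## Surjective matrices -/

section Surjective

variable {K : Type*} [Field K]

theorem exists_linearEquiv_ker_prod {V W : Type*} [AddCommGroup V] [Module K V] [AddCommGroup W]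
    [Module K W] {f : V →ₗ[K] W} (hf : Function.Surjective f) :
    ∃ e : V ≃ₗ[K] LinearMap.ker f × W, ∀ v, (e v).2 = f v := by
  obtain ⟨q, hq⟩ := (LinearMap.ker f).exists_isCompl
  refine ⟨LinearMap.equivProdOfSurjectiveOfIsCompl ((LinearMap.ker f).projectionOnto q hq) f
    (by simp) (LinearMap.range_eq_top.2 hf) (by simpa using hq.symm), fun v => rfl⟩

theorem exists_linearEquiv_comp_eq {V W : Type*} [AddCommGroup V] [Module K V]
    [FiniteDimensional K V] [AddCommGroup W] [Module K W] {f g : V →ₗ[K] W}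
    (hf : Function.Surjective f) (hg : Function.Surjective g) :
    ∃ e : V ≃ₗ[K] V, ∀ v, f (e v) = g v := by
  have hker : Module.finrank K (LinearMap.ker g) = Module.finrank K (LinearMap.ker f) := by
    have hrankf := f.finrank_range_add_finrank_ker
    have hrankg := g.finrank_range_add_finrank_ker
    rw [LinearMap.range_eq_top.2 hf] at hrankf
    rw [LinearMap.range_eq_top.2 hg] at hrankg
    omega
  obtain ⟨ef, hef⟩ := exists_linearEquiv_ker_prod hf
  obtain ⟨eg, heg⟩ := exists_linearEquiv_ker_prod hg
  refine ⟨eg ≪≫ₗ (LinearEquiv.ofFinrankEq _ _ hker).prodCongr (.refl K W) ≪≫ₗ ef.symm,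
    fun v => ?_⟩
  rw [← hef, ← heg]
  simp

variable {a b : ℕ}

theorem mulVec_surjective_iff_exists_det_ne_zero (M : Matrix (Fin a) (Fin b) K) :
    Function.Surjective M.mulVec ↔ ∃ t : Fin a → Fin b, (M.submatrix id t).det ≠ 0 := by
  constructor
  · rw [mulVec_surjective_iff_exists_right_inverse]
    rintro ⟨N, hN⟩
    by_contra! hminors
    have hzero : minorForm M = 0 := by
      refine Module.Basis.ext_alternating (Pi.basisFun K (Fin b)) fun t _ => ?_
      have ht := minorForm_mulVec_single M 1 t
      rw [Matrix.mul_one, hminors] at ht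
      simpa only [one_mulVec, Pi.basisFun_apply, AlternatingMap.zero_apply] using ht
    have hone : minorForm M N.col = 1 := by
      rw [minorForm_apply, ← det_transpose, ← det_one (R := K) (n := Fin a), ← hN]
      rfl
    rw [hzero, AlternatingMap.zero_apply] at hone
    exact zero_ne_one hone
  · rintro ⟨t, ht⟩ v
    have hsub : M.submatrix id t = M * (1 : Matrix (Fin b) (Fin b) K).submatrix id t := by
      ext i j
      simp only [mul_apply, submatrix_apply, id, one_apply, mul_ite, mul_one, mul_zero,
        Finset.sum_ite_eq', Finset.mem_univ, if_true]
    refine ⟨(1 : Matrix (Fin b) (Fin b) K).submatrix id t *ᵥ ((M.submatrix id t)⁻¹ *ᵥ v), ?_⟩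
    rw [mulVec_mulVec, ← hsub, mulVec_mulVec, mul_nonsing_inv _ (isUnit_iff_ne_zero.2 ht),
      one_mulVec]

theorem exists_isUnit_stdMat_mul_eq (hab : a ≤ b) {M : Matrix (Fin a) (Fin b) K}
    (hM : Function.Surjective M.mulVec) :
    ∃ P : Matrix (Fin b) (Fin b) K, IsUnit P.det ∧ stdMat K a b * P = M := by
  obtain ⟨e, he⟩ := exists_linearEquiv_comp_eq (f := (stdMat K a b).mulVecLin) (g := M.mulVecLin)
    (mulVec_surjective_iff_exists_right_inverse.2 ⟨_, stdMat_mul_transpose hab⟩) hM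
  have hP : stdMat K a b * LinearMap.toMatrix' e.toLinearMap = M := by
    refine mulVec_injective (funext fun v => ?_)
    rw [← mulVec_mulVec, LinearMap.toMatrix'_mulVec]
    exact he v
  exact ⟨_, by simpa only [LinearMap.det_toMatrix'] using e.isUnit_det', hP⟩

theorem exists_stdMat_mul_eq (hab : a < b) {M : Matrix (Fin a) (Fin b) K}
    (hM : Function.Surjective M.mulVec) :
    ∃ h : Matrix.SpecialLinearGroup (Fin b) K, stdMat K a b * h.1 = M := by
  obtain ⟨P, hP, rfl⟩ := exists_isUnit_stdMat_mul_eq hab.le hM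
  let D : Matrix (Fin b) (Fin b) K := diagonal (Function.update 1 ⟨0, by omega⟩ P.det⁻¹)
  have hD : stdMat K a b * D = stdMat K a b := by
    ext i j
    rw [mul_diagonal]
    rcases eq_or_ne j ⟨0, by omega⟩ with rfl | hj
    · rw [stdMat, of_apply, if_neg (by simp only; omega), zero_mul]
    · rw [Function.update_of_ne hj, Pi.one_apply, mul_one]
  refine ⟨⟨D * P, ?_⟩, ?_⟩
  · rw [det_mul, det_diagonal, Finset.prod_update_of_mem (Finset.mem_univ _)]
    simpa using inv_mul_cancel₀ hP.ne_zero
  · rw [← Matrix.mul_assoc, hD]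

end Surjective

/-! ## The quotient of the space of surjective quivers -/

section QuiverQuotient

variable {m : ℕ} {d : Fin (m + 1) → ℕ}

/-- The composition of the maps `β` from the last vertex to the vertex `j`. -/
def betaProd (x : QuiverRep d) : ∀ j : Fin (m + 1), Matrix (Fin (d j)) (Fin (d (Fin.last m))) ℂ :=
  Fin.reverseInduction 1 fun i P => x.2 i * P

theorem betaProd_last (x : QuiverRep d) : betaProd x (Fin.last m) = 1 := by
  simp [betaProd]

theorem betaProd_castSucc (x : QuiverRep d) (i : Fin m) :
    betaProd x i.castSucc = x.2 i * betaProd x i.succ := by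
  simp [betaProd]

theorem betaProd_act (g : ∀ j : Fin (m + 1), SLC (d j)) (x : QuiverRep d) (j : Fin (m + 1)) :
    betaProd (act g x) j = (g j).1 * (betaProd x j * ((g (Fin.last m))⁻¹).1) := by
  induction j using Fin.reverseInduction with
  | last => rw [betaProd_last, betaProd_last, Matrix.one_mul, coe_mul_coe_inv]
  | cast i ih =>
    rw [betaProd_castSucc, betaProd_castSucc, ih]
    simp only [act, Matrix.mul_assoc, coe_inv_mul_cancel_left]

theorem betaProd_of_isStandard (hd : Monotone d) {x : QuiverRep d} (hx : IsStandard x)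
    (j : Fin (m + 1)) : betaProd x j = stdMat ℂ (d j) (d (Fin.last m)) := by
  induction j using Fin.reverseInduction with
  | last => rw [betaProd_last, stdMat_self]
  | cast i ih =>
    rw [betaProd_castSucc, ih, isStandard_iff.1 hx,
      stdMat_mul_stdMat (hd i.castSucc_le_succ) (hd (Fin.le_last _))]

/-- The forms attached to a quiver: the maximal minors of the compositions of the maps `β`. -/
def quiverForms (x : QuiverRep d) (j : Fin (m + 1)) :
    (Fin (d (Fin.last m)) → ℂ) [⋀^Fin (d j)]→ₗ[ℂ] ℂ := minorForm (betaProd x j)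

/-- The `hGroup`-invariants of a quiver which separate the orbits in `surjSol`. -/
def quiverInv (x : QuiverRep d) : InvSpace d := (lastY x, quiverForms x)

theorem quiverForms_hAct (h : hGroup d) (x : QuiverRep d) :
    quiverForms (hAct h x) = quiverForms x := by
  have h1 : h.1 (Fin.last m) = 1 := h.2
  ext1 j
  rw [quiverForms, hAct, betaProd_act, minorForm_mul, (h.1 j).det_coe, one_smul, h1, inv_one,
    Matrix.SpecialLinearGroup.coe_one, Matrix.mul_one, quiverForms]

theorem lastY_hAct (h : hGroup d) (x : QuiverRep d) : lastY (hAct h x) = lastY x := by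
  have h1 : h.1 (Fin.last m) = 1 := h.2
  rw [hAct, lastY_act, h1, inv_one, Matrix.SpecialLinearGroup.coe_one, Matrix.mul_one,
    Matrix.one_mul]

theorem quiverForms_slAct (hd : Monotone d) {x : QuiverRep d} (hx : IsStandard x)
    (g : SLC (d (Fin.last m))) : quiverForms (slAct g x) = flagForms d (g⁻¹).1 := by
  ext1 j
  rw [quiverForms, slAct, betaProd_act, minorForm_mul, Matrix.SpecialLinearGroup.det_coe, one_smul,
    Pi.mulSingle_eq_same, betaProd_of_isStandard hd hx, flagForms]

theorem lastY_slAct (x : QuiverRep d) (g : SLC (d (Fin.last m))) : 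
    lastY (slAct g x) = g.1 * lastY x * (g⁻¹).1 := by
  rw [slAct, lastY_act, Pi.mulSingle_eq_same]

theorem exists_hAct_eq {g g' : ∀ j : Fin (m + 1), SLC (d j)}
    (h : g (Fin.last m) = g' (Fin.last m)) (x : QuiverRep d) :
    ∃ k : hGroup d, hAct k (act g x) = act g' x :=
  ⟨⟨g' * g⁻¹, by
    change g' (Fin.last m) * (g (Fin.last m))⁻¹ = 1
    rw [h, mul_inv_cancel]⟩, by rw [hAct, ← act_mul, inv_mul_cancel_right]⟩

theorem exists_isStandard_act (hd : StrictMono d) {x : QuiverRep d} (hx : AllSurj x) :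
    ∃ g : ∀ j : Fin (m + 1), SLC (d j), IsStandard (act g x) := by
  have exists_next : ∀ i : Fin m, ∀ h : SLC (d i.castSucc), ∃ h' : SLC (d i.succ),
      stdMat ℂ (d i.castSucc) (d i.succ) * h'.1 = h.1 * x.2 i := fun i h =>
    exists_stdMat_mul_eq (hd i.castSucc_lt_succ) fun v => by
      obtain ⟨w, hw⟩ := hx i ((h⁻¹).1 *ᵥ v)
      exact ⟨w, by rw [← mulVec_mulVec, hw, mulVec_mulVec, coe_mul_coe_inv, one_mulVec]⟩
  choose next hnext using exists_next
  let g : ∀ j : Fin (m + 1), SLC (d j) := fun j => Fin.induction 1 (fun i h => next i h) j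
  have hg : ∀ i : Fin m, g i.succ = next i (g i.castSucc) := fun i => by
    simp only [g, Fin.induction_succ]
  refine ⟨g, isStandard_iff.2 fun i => ?_⟩
  simp only [act]
  rw [← hnext i (g i.castSucc), ← hg, Matrix.mul_assoc, coe_mul_coe_inv, Matrix.mul_one]

theorem exists_hAct_slAct_eq (hd : StrictMono d) {x : QuiverRep d} (hx : AllSurj x) :
    ∃ (g : ∀ j : Fin (m + 1), SLC (d j)) (k : hGroup d), IsStandard (act g x) ∧
      hAct k (slAct (g (Fin.last m))⁻¹ (act g x)) = x := by
  obtain ⟨g, hg⟩ := exists_isStandard_act hd hx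
  obtain ⟨k, hk⟩ := exists_hAct_eq (g := Pi.mulSingle (Fin.last m) (g (Fin.last m))⁻¹) (g' := g⁻¹)
    (by rw [Pi.mulSingle_eq_same, Pi.inv_apply]) (act g x)
  refine ⟨g, k, hg, ?_⟩
  rw [slAct, hk, ← act_mul, inv_mul_cancel, act_one]

/-- The lower right corners of an element of `unimodularParabolic`, one for each vertex. Acting by
them on a quiver in standard form keeps the standard form. -/
def cornerSL (hd : Monotone d) (p : unimodularParabolic hd) (j : Fin (m + 1)) : SLC (d j) :=
  ⟨corner (d j) p.1.1, p.2.2 j⟩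

theorem cornerSL_last (hd : Monotone d) (p : unimodularParabolic hd) :
    cornerSL hd p (Fin.last m) = p.1 := Subtype.ext (corner_self _)

theorem isStandard_act_cornerSL (hd : Monotone d) (p : unimodularParabolic hd) {x : QuiverRep d}
    (hx : IsStandard x) : IsStandard (act (cornerSL hd p) x) := isStandard_iff.2 fun i => by
  simp only [act]
  have h : (cornerSL hd p i.castSucc).1 * stdMat ℂ (d i.castSucc) (d i.succ) =
      stdMat ℂ (d i.castSucc) (d i.succ) * (cornerSL hd p i.succ).1 :=
    (stdMat_mul_corner hd p.2.1 i).symm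
  rw [isStandard_iff.1 hx, h, Matrix.mul_assoc, coe_mul_coe_inv, Matrix.mul_one]

theorem exists_hAct_slAct_cornerSL (hd : Monotone d) (p : unimodularParabolic hd)
    (g : SLC (d (Fin.last m))) (x : QuiverRep d) :
    ∃ k : hGroup d, hAct k (slAct g x) = slAct (g * p.1⁻¹) (act (cornerSL hd p) x) := by
  rw [slAct, slAct, ← act_mul]
  refine exists_hAct_eq ?_ x
  rw [Pi.mul_apply, Pi.mulSingle_eq_same, Pi.mulSingle_eq_same, cornerSL_last,
    inv_mul_cancel_right]

theorem isConjStable_scalarBlock (hd : StrictMono d) (h0 : 0 < d 0) :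
    IsConjStable (unimodularParabolic hd.monotone) (scalarBlock d) := by
  intro p hp v hv
  have h := lastY_mem_scalarBlock hd h0
    (act_mem_surjSol (stdQuiver_mem_surjSol hd h0 hv) (cornerSL hd.monotone ⟨p, hp⟩))
    (isStandard_act_cornerSL hd.monotone ⟨p, hp⟩ (isStandard_stdQuiver hd h0 v))
  rwa [lastY_act, cornerSL_last, lastY_stdQuiver hd h0 hv] at h

theorem act_cornerSL_stdQuiver (hd : StrictMono d) (h0 : 0 < d 0)
    (p : unimodularParabolic hd.monotone) {v : Mat (d (Fin.last m))} (hv : v ∈ scalarBlock d) :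
    act (cornerSL hd.monotone p) (stdQuiver hd h0 v) =
      stdQuiver hd h0 (p.1.1 * v * (p.1⁻¹).1) := by
  have h := stdQuiver_lastY hd h0
    (act_mem_surjSol (stdQuiver_mem_surjSol hd h0 hv) (cornerSL hd.monotone p))
    (isStandard_act_cornerSL hd.monotone p (isStandard_stdQuiver hd h0 v))
  rw [lastY_act, cornerSL_last, lastY_stdQuiver hd h0 hv] at h
  exact h.symm

open Classical in
/-- A matrix of determinant one as an element of `SL`, with the junk value `1` at the other
matrices. -/
def toSL {n : ℕ} (A : Mat n) : SLC n := if h : A.det = 1 then ⟨A, h⟩ else 1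

theorem toSL_coe {n : ℕ} (g : SLC n) : toSL g.1 = g := dif_pos g.det_coe

/-- The quiver `g · x` attached to a pair `(g, Y)`, where `x` is the quiver in standard form with
matrix `Y`. -/
def pairQuiver (hd : StrictMono d) (h0 : 0 < d 0)
    (z : Mat (d (Fin.last m)) × Mat (d (Fin.last m))) : QuiverRep d :=
  slAct (toSL z.1) (stdQuiver hd h0 z.2)

section Regularity

variable {V : Type*} [AddCommGroup V] [Module ℂ V] {U : Set V}

theorem isRegularMap_act {g : V → ∀ j : Fin (m + 1), SLC (d j)} {x : V → QuiverRep d}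
    (hg : ∀ j, IsRegularMap (fun v => (g v j).1) U) (hx : IsRegularMap x U) :
    IsRegularMap (fun v => act (g v) (x v)) U := by
  have hi : ∀ j, IsRegularMap (fun v => ((g v j)⁻¹).1) U := fun j =>
    (hg j).adjugate.congr fun v _ => Matrix.SpecialLinearGroup.coe_inv _
  exact (IsRegularMap.pi fun i => ((hg i.succ).matMul (hx.fst.apply_pi i)).matMul
    (hi i.castSucc)).prodMk (IsRegularMap.pi fun i =>
      ((hg i.castSucc).matMul (hx.snd.apply_pi i)).matMul (hi i.succ))

theorem isRegularMap_stdQuiver (hd : StrictMono d) (h0 : 0 < d 0) {Y : V → Mat (d (Fin.last m))}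
    (hY : IsRegularMap Y U) (hne : ∀ v ∈ U, ∀ j, blockScalar hd h0 (Y v) j ≠ 0) :
    IsRegularMap (fun v => stdQuiver hd h0 (Y v)) U := by
  refine (IsRegularMap.pi fun i => ?_).prodMk (IsRegularMap.const _ U)
  exact ((IsRegularMap.smul ((hY.hasEntriesIn _ _).inv fun v hv => hne v hv i.succ)
    (((IsRegularMap.const _ U).matMul hY).matMul (IsRegularMap.const _ U))).sub
      (IsRegularMap.const 1 U)).matMul (IsRegularMap.const _ U)

theorem isRegularMap_pairQuiver (hd : StrictMono d) (h0 : 0 < d 0)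
    {F : Set (Mat (d (Fin.last m)))} (hF : ∀ v ∈ F, ∀ j, blockScalar hd h0 v j ≠ 0) :
    IsRegularMap (pairQuiver hd h0) (slProd F) := by
  refine isRegularMap_act (fun j => ?_) (isRegularMap_stdQuiver hd h0 (IsRegularMap.id _).snd
    fun _ hz => hF _ hz.2)
  by_cases hj : j = Fin.last m
  · subst hj
    refine (IsRegularMap.id (slProd F)).fst.congr fun z hz => ?_
    obtain ⟨g, v, -, rfl⟩ := exists_coe_of_mem_slProd hz
    rw [Pi.mulSingle_eq_same, toSL_coe]
  · refine (IsRegularMap.const 1 (slProd F)).congr fun _ _ => ?_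
    rw [Pi.mulSingle_eq_of_ne hj, Matrix.SpecialLinearGroup.coe_one]

theorem isRegularMap_incoming {x : V → QuiverRep d} (hx : IsRegularMap x U) (j : Fin (m + 1)) :
    IsRegularMap (fun v => incoming (x v) j) U := by
  cases j using Fin.cases with
  | zero => exact IsRegularMap.const 0 U
  | succ i => exact (hx.fst.apply_pi i).matMul (hx.snd.apply_pi i)

theorem isRegularMap_lastY {x : V → QuiverRep d} (hx : IsRegularMap x U) :
    IsRegularMap (fun v => lastY (x v)) U :=
  (IsRegularMap.const 1 U).add (isRegularMap_incoming hx _)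

theorem isRegularMap_quiverForms {x : V → QuiverRep d} (hx : IsRegularMap x U) :
    IsRegularMap (fun v => quiverForms (x v)) U := by
  have h : ∀ j, IsRegularMap (fun v => betaProd (x v) j) U := fun j => by
    induction j using Fin.reverseInduction with
    | last => exact (IsRegularMap.const 1 U).congr fun v _ => betaProd_last _
    | cast i ih =>
      exact ((hx.snd.apply_pi i).matMul ih).congr fun v _ => betaProd_castSucc _ _
  exact IsRegularMap.pi fun j => isRegularMap_minorForm (h j)

theorem isRegularMap_quiverInv (U : Set (QuiverRep d)) : IsRegularMap quiverInv U :=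
  (isRegularMap_lastY (IsRegularMap.id U)).prodMk (isRegularMap_quiverForms (IsRegularMap.id U))

end Regularity

section QuasiAffine

variable {V : Type*} [AddCommGroup V] [Module ℂ V]

theorem hasEntriesIn_alpha (L : V →ₗ[ℂ] QuiverRep d) (i : Fin m) :
    HasEntriesIn (polyFun V) fun v => (L v).1 i := fun a b =>
  polyFun_comp_linear (hasEntriesIn_polyFun_id a b) (LinearMap.proj i ∘ₗ LinearMap.fst ℂ _ _ ∘ₗ L)

theorem hasEntriesIn_beta (L : V →ₗ[ℂ] QuiverRep d) (i : Fin m) :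
    HasEntriesIn (polyFun V) fun v => (L v).2 i := fun a b =>
  polyFun_comp_linear (hasEntriesIn_polyFun_id a b) (LinearMap.proj i ∘ₗ LinearMap.snd ℂ _ _ ∘ₗ L)

theorem hasEntriesIn_one_add_incoming (L : V →ₗ[ℂ] QuiverRep d) (j : Fin (m + 1)) :
    HasEntriesIn (polyFun V) fun v => 1 + incoming (L v) j := by
  refine (HasEntriesIn.const 1).add ?_
  cases j using Fin.cases with
  | zero => exact HasEntriesIn.const 0
  | succ i => exact (hasEntriesIn_alpha L i).mul (hasEntriesIn_beta L i)

theorem hasEntriesIn_one_add_beta_mul_alpha (L : V →ₗ[ℂ] QuiverRep d) (i : Fin m) :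
    HasEntriesIn (polyFun V) fun v => 1 + (L v).2 i * (L v).1 i :=
  (HasEntriesIn.const 1).add ((hasEntriesIn_beta L i).mul (hasEntriesIn_alpha L i))

theorem isQuasiAffine_of_isMult_allSurj (L : V →ₗ[ℂ] QuiverRep d) {E : Set (V → ℂ)}
    (hE : E ⊆ polyFun V) {Z : Set V}
    (hZ : ∀ v, v ∈ Z ↔ (IsMult (L v) ∧ AllSurj (L v)) ∧ ∀ e ∈ E, e v = 0) :
    IsQuasiAffine Z := by
  refine isQuasiAffine_of_conditions (ι := Fin m ⊕ Fin m ⊕ Fin m)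
    (Sum.elim (fun i => {fun v => (1 + (L v).1 i * (L v).2 i).det})
      (Sum.elim (fun i => {fun v => (1 + (L v).2 i * (L v).1 i).det})
        fun i => Set.range fun t v => (((L v).2 i).submatrix id t).det)) E ?_ hE fun v => ?_
  · rintro (i | i | i)
    · rintro _ rfl
      exact (hasEntriesIn_one_add_incoming L i.succ).det
    · rintro _ rfl
      exact (hasEntriesIn_one_add_beta_mul_alpha L i).det
    · rintro _ ⟨t, rfl⟩
      exact HasEntriesIn.det fun a b => hasEntriesIn_beta L i a (t b)
  · rw [hZ v]
    simp only [Sum.forall, Sum.elim_inl, Sum.elim_inr, Set.mem_singleton_iff, exists_eq_left,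
      Set.exists_range_iff, IsMult, AllSurj, mulVec_surjective_iff_exists_det_ne_zero,
      isUnit_iff_isUnit_det, isUnit_iff_ne_zero, forall_and, and_assoc]

theorem exists_eq_smul_iff {K ι κ : Type*} [Field K] {A B : Matrix ι κ K} (hB : B ≠ 0) :
    (∃ q : K, A = q • B) ↔ ∀ a b a' b', A a b * B a' b' - A a' b' * B a b = 0 := by
  constructor
  · rintro ⟨q, rfl⟩ a b a' b'
    simp only [Matrix.smul_apply, smul_eq_mul]
    ring
  · intro h
    obtain ⟨a, b, hab⟩ : ∃ a b, B a b ≠ 0 := by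
      by_contra! hzero
      exact hB (Matrix.ext hzero)
    refine ⟨A a b / B a b, Matrix.ext fun a' b' => ?_⟩
    rw [Matrix.smul_apply, smul_eq_mul, div_mul_eq_mul_div, eq_div_iff hab]
    linear_combination h a' b' a b

theorem exists_multEq_iff (hd : Monotone d) (h0 : 0 < d 0) {x : QuiverRep d} (hx : IsMult x) :
    (∃ q, MultEq x q) ↔ ∀ i : Fin m, ∀ a b a' b',
      (1 + x.2 i * x.1 i : Mat _) a b * (1 + incoming x i.castSucc) a' b' -
        (1 + x.2 i * x.1 i : Mat _) a' b' * (1 + incoming x i.castSucc) a b = 0 := by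
  have hne : ∀ i : Fin m, 1 + incoming x i.castSucc ≠ 0 := fun i hzero => by
    have : Nonempty (Fin (d i.castSucc)) := ⟨⟨0, dim_pos hd h0 _⟩⟩
    exact (isUnit_one_add_incoming hx i.castSucc).ne_zero hzero
  simp only [MultEq, ← exists_eq_smul_iff (hne _)]
  exact ⟨fun ⟨q, hq⟩ i => ⟨q i, hq i⟩, fun h => ⟨_, fun i => (h i).choose_spec⟩⟩

theorem isQuasiAffine_surjSol (hd : Monotone d) (h0 : 0 < d 0) : IsQuasiAffine (surjSol d) := by
  refine isQuasiAffine_of_isMult_allSurj LinearMap.id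
    (E := {e | ∃ (i : Fin m) (a b a' b' : _), e = fun x : QuiverRep d =>
      (1 + x.2 i * x.1 i : Mat _) a b * (1 + incoming x i.castSucc) a' b' -
        (1 + x.2 i * x.1 i : Mat _) a' b' * (1 + incoming x i.castSucc) a b}) ?_ fun x => ?_
  · rintro _ ⟨i, a, b, a', b', rfl⟩
    have hβα := hasEntriesIn_one_add_beta_mul_alpha (d := d) LinearMap.id i
    have hαβ := hasEntriesIn_one_add_incoming (d := d) LinearMap.id i.castSucc
    exact sub_mem (mul_mem (hβα a b) (hαβ a' b')) (mul_mem (hβα a' b') (hαβ a b))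
  · constructor
    · rintro ⟨hmult, heq, hsurj⟩
      refine ⟨⟨hmult, hsurj⟩, ?_⟩
      rintro _ ⟨i, a, b, a', b', rfl⟩
      exact (exists_multEq_iff hd h0 hmult).1 heq i a b a' b'
    · rintro ⟨⟨hmult, hsurj⟩, h⟩
      exact ⟨hmult, (exists_multEq_iff hd h0 hmult).2 fun i a b a' b' =>
        h _ ⟨i, a, b, a', b', rfl⟩, hsurj⟩

theorem isQuasiAffine_modSurjSol : IsQuasiAffine (modSurjSol d) := by
  refine isQuasiAffine_of_isMult_allSurj (LinearMap.fst ℂ (QuiverRep d) (Fin (m + 1) → ℂ))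
    (E := insert (fun s => ∏ j, s.2 j - 1) {e | ∃ (i : Fin m) (a b : _),
      e = fun s : QuiverRep d × (Fin (m + 1) → ℂ) =>
        s.2 i.castSucc * (1 + s.1.2 i * s.1.1 i : Mat _) a b -
          s.2 i.succ * (1 + incoming s.1 i.castSucc) a b}) ?_ fun s => ?_
  · have ht : ∀ j, (fun s : QuiverRep d × (Fin (m + 1) → ℂ) => s.2 j) ∈ polyFun _ := fun j =>
      dual_mem_polyFun ((LinearMap.proj j : (Fin (m + 1) → ℂ) →ₗ[ℂ] ℂ) ∘ₗ
        LinearMap.snd ℂ (QuiverRep d) (Fin (m + 1) → ℂ))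
    rintro _ (rfl | ⟨i, a, b, rfl⟩)
    · refine sub_mem ?_ ((polyFun _).algebraMap_mem 1)
      simpa only [Finset.prod_fn] using prod_mem fun j _ => ht j
    · have hβα := hasEntriesIn_one_add_beta_mul_alpha
        (LinearMap.fst ℂ (QuiverRep d) (Fin (m + 1) → ℂ)) i
      have hαβ := hasEntriesIn_one_add_incoming
        (LinearMap.fst ℂ (QuiverRep d) (Fin (m + 1) → ℂ)) i.castSucc
      exact sub_mem (mul_mem (ht i.castSucc) (hβα a b)) (mul_mem (ht i.succ) (hαβ a b))
  · simp only [LinearMap.fst_apply, Set.forall_mem_insert, sub_eq_zero]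
    constructor
    · rintro ⟨hmult, ⟨hprod, heq⟩, hsurj⟩
      refine ⟨⟨hmult, hsurj⟩, hprod, ?_⟩
      rintro _ ⟨i, a, b, rfl⟩
      exact sub_eq_zero.2 (congrFun₂ (heq i) a b)
    · rintro ⟨⟨hmult, hsurj⟩, hprod, h⟩
      exact ⟨hmult, ⟨hprod, fun i => Matrix.ext fun a b =>
        sub_eq_zero.1 (h _ ⟨i, a, b, rfl⟩)⟩, hsurj⟩

theorem isQuasiAffine_scalarBlock (hd : StrictMono d) (h0 : 0 < d 0) :
    IsQuasiAffine (scalarBlock d) := by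
  refine isQuasiAffine_of_conditions (ι := Fin (m + 1)) (fun j => {fun Y => blockScalar hd h0 Y j})
    (insert (fun Y => blockScalar hd h0 Y (Fin.last m) - 1)
      {e | ∃ r s : Fin (d (Fin.last m)), level r ≤ level s ∧
        e = fun Y => Y r s - if r = s then blockScalar hd h0 Y (level s) else 0}) ?_ ?_ fun Y => ?_
  · rintro j _ rfl
    exact hasEntriesIn_polyFun_id _ _
  · rintro _ (rfl | ⟨r, s, -, rfl⟩)
    · exact sub_mem (hasEntriesIn_polyFun_id _ _) ((polyFun _).algebraMap_mem 1)
    · refine sub_mem (hasEntriesIn_polyFun_id _ _) ?_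
      split_ifs
      · exact hasEntriesIn_polyFun_id _ _
      · exact (polyFun _).algebraMap_mem 0
  · rw [mem_scalarBlock_iff hd h0]
    simp only [Set.mem_singleton_iff, exists_eq_left, Set.forall_mem_insert, sub_eq_zero]
    constructor
    · rintro ⟨hlast, hne, heq⟩
      refine ⟨hne, hlast, ?_⟩
      rintro _ ⟨r, s, hrs, rfl⟩
      exact sub_eq_zero.2 (heq hrs)
    · rintro ⟨hne, hlast, heq⟩
      exact ⟨hlast, hne, fun {r s} hrs => sub_eq_zero.1 (heq _ ⟨r, s, hrs, rfl⟩)⟩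

end QuasiAffine

end QuiverQuotient

section GeneralQuotient

variable {m : ℕ} {d : Fin (m + 1) → ℕ}

theorem quiverInv_slAct (hd : Monotone d) {x : QuiverRep d} (hx : IsStandard x)
    (g : SLC (d (Fin.last m))) : quiverInv (slAct g x) = twistInv d (g.1, lastY x) := by
  rw [quiverInv, lastY_slAct, quiverForms_slAct hd hx, twistInv_coe]

theorem quiverInv_hAct (h : hGroup d) (x : QuiverRep d) : quiverInv (hAct h x) = quiverInv x := by
  rw [quiverInv, lastY_hAct, quiverForms_hAct, quiverInv]

theorem pairQuiver_coe (hd : StrictMono d) (h0 : 0 < d 0) (g : SLC (d (Fin.last m)))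
    (v : Mat (d (Fin.last m))) : pairQuiver hd h0 (g.1, v) = slAct g (stdQuiver hd h0 v) := by
  rw [pairQuiver, toSL_coe]

theorem pairQuiver_mem_surjSol (hd : StrictMono d) (h0 : 0 < d 0) :
    Set.MapsTo (pairQuiver hd h0) (slProd (scalarBlock d)) (surjSol d) := fun _ hz =>
  act_mem_surjSol (stdQuiver_mem_surjSol hd h0 hz.2) _

theorem quiverInv_pairQuiver (hd : StrictMono d) (h0 : 0 < d 0)
    {z : Mat (d (Fin.last m)) × Mat (d (Fin.last m))} (hz : z ∈ slProd (scalarBlock d)) :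
    quiverInv (pairQuiver hd h0 z) = twistInv d z := by
  obtain ⟨g, v, hv, rfl⟩ := exists_coe_of_mem_slProd hz
  rw [pairQuiver_coe, quiverInv_slAct hd.monotone (isStandard_stdQuiver hd h0 v),
    lastY_stdQuiver hd h0 hv]

theorem exists_hAct_pairQuiver_eq (hd : StrictMono d) (h0 : 0 < d 0) {x : QuiverRep d}
    (hx : x ∈ surjSol d) :
    ∃ z ∈ slProd (scalarBlock d), ∃ k : hGroup d, hAct k (pairQuiver hd h0 z) = x := by
  obtain ⟨g, k, hst, hk⟩ := exists_hAct_slAct_eq hd hx.2.2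
  have hmem := act_mem_surjSol hx g
  refine ⟨_, coe_mem_slProd (g (Fin.last m))⁻¹ (lastY_mem_scalarBlock hd h0 hmem hst), k, ?_⟩
  rw [pairQuiver_coe, stdQuiver_lastY hd h0 hmem hst, hk]

theorem exists_hAct_pairQuiver_eq_pairQuiver (hd : StrictMono d) (h0 : 0 < d 0)
    {z z' : Mat (d (Fin.last m)) × Mat (d (Fin.last m))} (hz : z ∈ slProd (scalarBlock d))
    (hz' : z' ∈ slProd (scalarBlock d)) (h : twistInv d z = twistInv d z') :
    ∃ k : hGroup d, hAct k (pairQuiver hd h0 z) = pairQuiver hd h0 z' := by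
  obtain ⟨g, v, hv, rfl⟩ := exists_coe_of_mem_slProd hz
  obtain ⟨g', v', -, rfl⟩ := exists_coe_of_mem_slProd hz'
  obtain ⟨p, hp⟩ := (twistInv_eq_iff hd h0 g g' v v').1 h
  obtain ⟨k, hk⟩ := exists_hAct_slAct_cornerSL hd.monotone p g (stdQuiver hd h0 v)
  refine ⟨k, ?_⟩
  rw [← hp, twist, ← Matrix.SpecialLinearGroup.coe_mul, pairQuiver_coe, pairQuiver_coe, hk,
    act_cornerSL_stdQuiver hd h0 p hv]

theorem isGeometricQuotient_quiver (hd : StrictMono d) (h0 : 0 < d 0) :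
    IsGeometricQuotient hAct (surjSol d) (twistInv d '' slProd (scalarBlock d)) quiverInv := by
  have hF := isConjStable_scalarBlock hd h0
  refine isGeometricQuotient_transfer (φ := pairQuiver hd h0)
    (isQuasiAffine_image_twistInv hd h0 hF (isQuasiAffine_scalarBlock hd h0))
    (fun z hz => ?_) (isQuasiAffine_surjSol hd.monotone h0) (fun g h x => act_mul g.1 h.1 x)
    act_one (fun g x hx => act_mem_surjSol hx g.1) (isRegularMap_quiverInv _)
    (fun g x _ => quiverInv_hAct g x)
    (isRegularMap_pairQuiver hd h0 fun v hv =>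
      ((mem_scalarBlock_iff hd h0).1 hv).blockScalar_ne_zero)
    (pairQuiver_mem_surjSol hd h0) (fun _ => quiverInv_pairQuiver hd h0)
    (fun _ => exists_hAct_pairQuiver_eq hd h0)
    fun _ hz _ hz' => exists_hAct_pairQuiver_eq_pairQuiver hd h0 hz hz'
  obtain ⟨c, σ, hc, hs, -⟩ := exists_isLocalSection_twistInv hd h0 hF z hz
  exact ⟨c, σ, hc, hs⟩

theorem isGeometricQuotient_twist_commutator (hd : StrictMono d) (h0 : 0 < d 0) :
    IsGeometricQuotient (twist ⁅parabolic d, parabolic d⁆) (slProd (scalarBlock d))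
      (twistInv d '' slProd (scalarBlock d)) (twistInv d) := by
  rw [commutator_parabolic hd.monotone]
  exact isGeometricQuotient_twist hd h0 (isConjStable_scalarBlock hd h0)
    (isQuasiAffine_scalarBlock hd h0)

end GeneralQuotient

/-! ## The full flag -/

section FullFlag

variable {m : ℕ}

theorem fullFlag_zero_pos (m : ℕ) : 0 < fullFlag m 0 := Nat.succ_pos _

theorem blockScalar_fullFlag (Y : Mat (m + 1)) (j : Fin (m + 1)) :
    blockScalar (strictMono_fullFlag m) (fullFlag_zero_pos m) Y j = Y j.rev j.rev := by
  have hrow : topRow (strictMono_fullFlag m) (fullFlag_zero_pos m) j = (j.rev : Fin (m + 1)) := by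
    ext
    simp only [topRow, embLast, fullFlag, Fin.val_last, Fin.val_rev]
    omega
  rw [blockScalar, hrow]

theorem level_fullFlag (a : Fin (m + 1)) : level (d := fullFlag m) a = a.rev := by
  ext
  simp only [level, blockIdx_fullFlag, Fin.val_rev]
  omega

theorem isScalarBlock_fullFlag_iff {Y : Mat (m + 1)} :
    IsScalarBlock (strictMono_fullFlag m) (fullFlag_zero_pos m) Y ↔
      Y.BlockTriangular id ∧ Y 0 0 = 1 ∧ ∀ a, Y a a ≠ 0 := by
  constructor
  · rintro ⟨hlast, hne, hlevel⟩
    simp only [blockScalar_fullFlag, Fin.rev_last] at hlast hne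
    refine ⟨fun i j hij => ?_, hlast, fun a => by simpa only [Fin.rev_rev] using hne a.rev⟩
    have hij : j < i := hij
    rw [hlevel (by rw [level_fullFlag, level_fullFlag, Fin.rev_le_rev]; exact hij.le),
      if_neg hij.ne']
  · rintro ⟨htri, hlast, hne⟩
    refine ⟨by rwa [blockScalar_fullFlag, Fin.rev_last], fun j => ?_,
      fun {r s : Fin (m + 1)} hrs => ?_⟩
    · rw [blockScalar_fullFlag]
      exact hne _
    · rw [level_fullFlag, level_fullFlag, Fin.rev_le_rev] at hrs
      rw [blockScalar_fullFlag, level_fullFlag, Fin.rev_rev]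
      split_ifs with h
      · rw [h]
      · exact htri (hrs.lt_of_ne' h)

theorem mem_borelOneSet_iff {Y : Mat (m + 1)} : Y ∈ borelOneSet m ↔
    Y.BlockTriangular id ∧ Y 0 0 = 1 ∧ ∀ a, Y a a ≠ 0 := by
  have hdet (h : Y.BlockTriangular id) : Y.det ≠ 0 ↔ ∀ a, Y a a ≠ 0 := by
    rw [det_of_isUpperTriangular h, Finset.prod_ne_zero_iff]
    exact forall_congr' fun a => ⟨fun h => h (Finset.mem_univ a), fun h _ => h⟩
  constructor
  · rintro ⟨b, rfl⟩
    exact ⟨b.2.1, b.2.2, (hdet b.2.1).1 b.1.det_ne_zero⟩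
  · rintro ⟨h, h1, hne⟩
    exact ⟨⟨GeneralLinearGroup.mkOfDetNeZero Y ((hdet h).2 hne), h, h1⟩, rfl⟩

theorem borelOneSet_eq_scalarBlock (m : ℕ) : borelOneSet m = scalarBlock (fullFlag m) := by
  ext Y
  rw [mem_borelOneSet_iff, mem_scalarBlock_iff (strictMono_fullFlag m) (fullFlag_zero_pos m),
    isScalarBlock_fullFlag_iff]

end FullFlag

section Borel

variable {n : ℕ} {b : Mat n}

theorem mem_borelSet_iff : b ∈ borelSet n ↔ b.BlockTriangular id ∧ b.det = 1 := by
  constructor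
  · rintro ⟨b, rfl⟩
    exact ⟨b.2, b.1.det_coe⟩
  · rintro ⟨h, h1⟩
    exact ⟨⟨⟨b, h1⟩, h⟩, rfl⟩

theorem diag_ne_zero_of_mem_borelSet (hb : b ∈ borelSet n) (a : Fin n) : b a a ≠ 0 := by
  obtain ⟨b, rfl⟩ := hb
  exact borelSL_diag_ne_zero b a

theorem isQuasiAffine_borelSet (n : ℕ) : IsQuasiAffine (borelSet n) := by
  refine isQuasiAffine_of_conditions (ι := Empty) Empty.elim
    (insert (fun b => b.det - 1) {e | ∃ i j : Fin n, j < i ∧ e = fun b => b i j})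
    (fun i => i.elim) ?_ fun b => ?_
  · rintro _ (rfl | ⟨i, j, -, rfl⟩)
    · exact sub_mem hasEntriesIn_polyFun_id.det ((polyFun _).algebraMap_mem 1)
    · exact hasEntriesIn_polyFun_id i j
  · rw [mem_borelSet_iff]
    simp only [IsEmpty.forall_iff, true_and, Set.forall_mem_insert, sub_eq_zero]
    constructor
    · rintro ⟨h, h1⟩
      refine ⟨h1, ?_⟩
      rintro _ ⟨i, j, hij, rfl⟩
      exact h hij
    · rintro ⟨h1, h⟩
      exact ⟨fun i j hij => h _ ⟨i, j, hij, rfl⟩, h1⟩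

theorem isConjStable_unip_borelSet (n : ℕ) : IsConjStable (unip n) (borelSet n) := by
  rintro p hp _ ⟨b, rfl⟩
  exact ⟨⟨p * b.1 * p⁻¹, mul_mem (mul_mem hp.1 b.2) (inv_mem hp.1)⟩, by
    simp only [Matrix.SpecialLinearGroup.coe_mul]⟩

theorem conj_diag {p : SLC n} (hp : p ∈ unip n) {M : Mat n} (hM : M.BlockTriangular id)
    (a : Fin n) : (p.1 * M * (p⁻¹).1) a a = M a a := by
  rw [upper_mul_diag (BlockTriangular.mul hp.1 hM) (inv_mem hp).1, upper_mul_diag hp.1 hM, hp.2,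
    (inv_mem hp).2, one_mul, mul_one]

theorem inv_smul_conj {p : SLC n} (hp : p ∈ unip n) {M : Mat n} (hM : M.BlockTriangular id)
    (a : Fin n) : ((p.1 * M * (p⁻¹).1) a a)⁻¹ • (p.1 * M * (p⁻¹).1) =
      p.1 * ((M a a)⁻¹ • M) * (p⁻¹).1 := by
  rw [conj_diag hp hM, Matrix.mul_smul, Matrix.smul_mul]

theorem prod_rev_diag {M : Mat n} (hM : M.BlockTriangular id) :
    ∏ j : Fin n, M j.rev j.rev = M.det := by
  rw [det_of_isUpperTriangular hM]
  exact Equiv.prod_comp Fin.revPerm fun a => M a a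

end Borel

/-! ## The modified equations -/

section Modified

variable {m : ℕ} {d : Fin (m + 1) → ℕ} {s : QuiverRep d × (Fin (m + 1) → ℂ)}

theorem ModMultEq.ne_zero {x : QuiverRep d} {t : Fin (m + 1) → ℂ} (h : ModMultEq x t)
    (j : Fin (m + 1)) : t j ≠ 0 := fun h0 =>
  zero_ne_one ((Finset.prod_eq_zero (Finset.mem_univ j) h0).symm.trans h.1)

theorem ModMultEq.multEq {x : QuiverRep d} {t : Fin (m + 1) → ℂ} (h : ModMultEq x t) :
    MultEq x fun i => (t i.castSucc)⁻¹ / (t i.succ)⁻¹ := fun i => by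
  have := congrArg (fun M => (t i.castSucc)⁻¹ • M) (h.2 i)
  simp only [inv_smul_smul₀ (h.ne_zero i.castSucc), smul_smul] at this
  rwa [← div_inv_eq_mul] at this

theorem fst_mem_surjSol (hs : s ∈ modSurjSol d) : s.1 ∈ surjSol d :=
  ⟨hs.1, ⟨_, hs.2.1.multEq⟩, hs.2.2⟩

theorem blockScalar_lastY_of_modMultEq (hd : StrictMono d) (h0 : 0 < d 0) {x : QuiverRep d}
    (hx : IsStandard x) {t : Fin (m + 1) → ℂ} (ht : ModMultEq x t) (j : Fin (m + 1)) :
    blockScalar hd h0 (lastY x) j = t (Fin.last m) / t j := by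
  rw [blockScalar_lastY hd h0 hx ht.multEq,
    scalarProd_div (fun j => (t j)⁻¹) (fun j => inv_ne_zero (ht.ne_zero j)), inv_div_inv]

theorem stdQuiver_mem_modSurjSol (hd : StrictMono d) (h0 : 0 < d 0) {Y : Mat (d (Fin.last m))}
    (hY : Y ∈ scalarBlock d) {t : Fin (m + 1) → ℂ} (ht : ∏ j, t j = 1)
    (h : ∀ j, t j * blockScalar hd h0 Y j = t (Fin.last m)) :
    (stdQuiver hd h0 Y, t) ∈ modSurjSol d := by
  obtain ⟨hmul, -, hsurj⟩ := stdQuiver_mem_surjSol hd h0 hY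
  rw [mem_scalarBlock_iff hd h0] at hY
  refine ⟨hmul, ⟨ht, fun i => ?_⟩, hsurj⟩
  have key : t i.castSucc * (blockScalar hd h0 Y i.succ)⁻¹ =
      t i.succ * (blockScalar hd h0 Y i.castSucc)⁻¹ := by
    rw [← div_eq_mul_inv, ← div_eq_mul_inv,
      div_eq_div_iff (hY.blockScalar_ne_zero _) (hY.blockScalar_ne_zero _), h, h]
  rw [beta_mul_alpha_stdQuiver, hY.one_add_incoming_stdQuiver, smul_smul, smul_smul, key]

theorem stdQuiver_smul (hd : StrictMono d) (h0 : 0 < d 0) {c : ℂ} (hc : c ≠ 0)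
    (Y : Mat (d (Fin.last m))) : stdQuiver hd h0 (c • Y) = stdQuiver hd h0 Y := by
  have hcorner : ∀ j, corner (d j) (c • Y) = c • corner (d j) Y := fun j => by
    rw [corner, corner, Matrix.mul_smul, Matrix.smul_mul]
  have hscalar : ∀ j, blockScalar hd h0 (c • Y) j = c * blockScalar hd h0 Y j := fun _ => rfl
  simp only [stdQuiver, hcorner, hscalar, smul_smul, _root_.mul_inv_rev, mul_assoc,
    inv_mul_cancel₀ hc, mul_one]

/-- The matrix `q̃_{n-1}⁻¹ Y` of a solution of the modified equations. -/
def modY (s : QuiverRep d × (Fin (m + 1) → ℂ)) : Mat (d (Fin.last m)) :=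
  (s.2 (Fin.last m))⁻¹ • lastY s.1

/-- The invariants of a solution of the modified equations under `H_ℂ`: those of the quiver, with
`modY` in place of `lastY`. -/
def modInv (s : QuiverRep d × (Fin (m + 1) → ℂ)) : InvSpace d := (modY s, quiverForms s.1)

theorem modInv_slAct (hd : Monotone d) (hs : IsStandard s.1) (g : SLC (d (Fin.last m))) :
    modInv (slAct g s.1, s.2) = twistInv d (g.1, modY s) := by
  simp only [modInv, modY]
  rw [lastY_slAct, quiverForms_slAct hd hs, twistInv_coe, Matrix.mul_smul, Matrix.smul_mul]

theorem modInv_hActMod (h : hGroup d) (s : QuiverRep d × (Fin (m + 1) → ℂ)) :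
    modInv (hActMod h s) = modInv s :=
  Prod.ext (congrArg ((s.2 (Fin.last m))⁻¹ • ·) (lastY_hAct h s.1)) (quiverForms_hAct h s.1)

theorem isRegularMap_modInv : IsRegularMap (modInv (d := d)) (modSurjSol d) := by
  have hx := (IsRegularMap.id (modSurjSol d)).fst
  have ht := ((IsRegularMap.id (modSurjSol d)).snd.apply_pi (Fin.last m)).regularOn
  exact (IsRegularMap.smul (ht.inv fun s hs => hs.2.1.ne_zero _)
    (isRegularMap_lastY hx)).prodMk (isRegularMap_quiverForms hx)

end Modified

section ModifiedFullFlag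

variable {m : ℕ} {b : Mat (m + 1)} {s : QuiverRep (fullFlag m) × (Fin (m + 1) → ℂ)}

/-- The solution of the modified equations in standard form with matrix `b`; its scalars are the
inverses of the diagonal entries of `b`. -/
def modStd (b : Mat (m + 1)) : QuiverRep (fullFlag m) × (Fin (m + 1) → ℂ) :=
  (stdQuiver (strictMono_fullFlag m) (fullFlag_zero_pos m) b, fun j => (b j.rev j.rev)⁻¹)

theorem isStandard_modStd (b : Mat (m + 1)) : IsStandard (modStd b).1 :=
  isStandard_stdQuiver (d := fullFlag m) _ _ b

theorem inv_smul_mem_scalarBlock (hb : b ∈ borelSet (m + 1)) :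
    (b 0 0)⁻¹ • b ∈ scalarBlock (fullFlag m) := by
  obtain ⟨b, rfl⟩ := hb
  exact borelOneSet_eq_scalarBlock m ▸ ⟨rho m b, rfl⟩

theorem modStd_fst (hb : b ∈ borelSet (m + 1)) :
    (modStd b).1 = stdQuiver (strictMono_fullFlag m) (fullFlag_zero_pos m) ((b 0 0)⁻¹ • b) :=
  (stdQuiver_smul (d := fullFlag m) _ _ (inv_ne_zero (diag_ne_zero_of_mem_borelSet hb 0)) b).symm

theorem modStd_mem_modSurjSol (hb : b ∈ borelSet (m + 1)) :
    modStd b ∈ modSurjSol (fullFlag m) := by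
  obtain ⟨htri, hdet⟩ := mem_borelSet_iff.1 hb
  rw [← Prod.mk.eta (p := modStd b), modStd_fst hb]
  refine stdQuiver_mem_modSurjSol _ _ (inv_smul_mem_scalarBlock hb) ?_ fun j => ?_
  · simp only [modStd, Finset.prod_inv_distrib]
    rw [prod_rev_diag htri, hdet, inv_one]
  · have hne := diag_ne_zero_of_mem_borelSet hb j.rev
    rw [blockScalar_fullFlag]
    simp only [modStd, Fin.rev_last]
    exact mul_comm (b j.rev j.rev)⁻¹ _ |>.trans (mul_inv_cancel_right₀ hne _)

theorem lastY_modStd (hb : b ∈ borelSet (m + 1)) : lastY (modStd b).1 = (b 0 0)⁻¹ • b := by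
  rw [modStd_fst hb, lastY_stdQuiver _ _ (inv_smul_mem_scalarBlock hb)]

theorem modY_modStd (hb : b ∈ borelSet (m + 1)) : modY (modStd b) = b := by
  rw [modY, lastY_modStd hb]
  simp only [modStd, Fin.rev_last, inv_inv]
  exact smul_inv_smul₀ (diag_ne_zero_of_mem_borelSet hb 0) b

theorem modY_diag (hs : s ∈ modSurjSol (fullFlag m)) (hst : IsStandard s.1) (j : Fin (m + 1)) :
    modY s j.rev j.rev = (s.2 j)⁻¹ := by
  have h := blockScalar_lastY_of_modMultEq (strictMono_fullFlag m) (fullFlag_zero_pos m) hst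
    hs.2.1 j
  rw [blockScalar_fullFlag] at h
  change (s.2 (Fin.last m))⁻¹ * lastY s.1 j.rev j.rev = _
  rw [h, div_eq_mul_inv, inv_mul_cancel_left₀ (hs.2.1.ne_zero _)]

theorem modY_mem_borelSet (hs : s ∈ modSurjSol (fullFlag m)) (hst : IsStandard s.1) :
    modY s ∈ borelSet (m + 1) := by
  have hY : lastY s.1 ∈ borelOneSet m := by
    rw [borelOneSet_eq_scalarBlock]
    exact lastY_mem_scalarBlock (strictMono_fullFlag m) (fullFlag_zero_pos m)
      (fst_mem_surjSol hs) hst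
  have htri : (modY s : Mat (m + 1)).BlockTriangular id := fun i j hij => by
    change (s.2 (Fin.last m))⁻¹ * lastY s.1 i j = 0
    rw [(mem_borelOneSet_iff.1 hY).1 hij, mul_zero]
  refine mem_borelSet_iff.2 ⟨htri, ?_⟩
  rw [← prod_rev_diag htri]
  simp only [modY_diag hs hst, Finset.prod_inv_distrib]
  exact inv_eq_one.2 hs.2.1.1

theorem modStd_modY (hs : s ∈ modSurjSol (fullFlag m)) (hst : IsStandard s.1) :
    modStd (modY s) = s := by
  refine Prod.ext ?_ (funext fun j => ?_)
  · rw [modStd, modY, stdQuiver_smul _ _ (inv_ne_zero (hs.2.1.ne_zero _)),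
      stdQuiver_lastY _ _ (fst_mem_surjSol hs) hst]
  · change (modY s j.rev j.rev)⁻¹ = _
    rw [modY_diag hs hst, inv_inv]

theorem bijOn_modY (m : ℕ) : Set.BijOn modY
    {s | s ∈ modSurjSol (fullFlag m) ∧ IsStandard s.1} (borelSet (m + 1)) :=
  Set.InvOn.bijOn (f' := modStd) ⟨fun _ hs => modStd_modY hs.1 hs.2, fun _ hb => modY_modStd hb⟩
    (fun _ hs => modY_mem_borelSet hs.1 hs.2)
    fun b hb => ⟨modStd_mem_modSurjSol hb, isStandard_modStd b⟩

theorem mem_unip_of_mem_unimodularParabolic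
    (p : unimodularParabolic (strictMono_fullFlag m).monotone) : p.1 ∈ unip (m + 1) :=
  unimodularParabolic_fullFlag m ▸ p.2

theorem act_cornerSL_modStd (p : unimodularParabolic (strictMono_fullFlag m).monotone)
    {b : Mat (fullFlag m (Fin.last m))} (hb : b ∈ borelSet (m + 1)) :
    (act (cornerSL (strictMono_fullFlag m).monotone p) (modStd b).1, (modStd b).2) =
      modStd (p.1.1 * b * (p.1⁻¹).1) := by
  have hp := mem_unip_of_mem_unimodularParabolic p
  have htri := (mem_borelSet_iff.1 hb).1
  refine Prod.ext ?_ (funext fun j => (congrArg Inv.inv (conj_diag hp htri j.rev)).symm)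
  rw [modStd_fst (isConjStable_unip_borelSet (m + 1) _ hp _ hb), inv_smul_conj hp htri,
    ← act_cornerSL_stdQuiver _ _ p (inv_smul_mem_scalarBlock hb), modStd_fst hb]

/-- The solution `g · x` of the modified equations attached to a pair `(g, b)`, where `x` is the
solution in standard form with matrix `b`. -/
def pairMod (z : Mat (m + 1) × Mat (m + 1)) : QuiverRep (fullFlag m) × (Fin (m + 1) → ℂ) :=
  (pairQuiver (strictMono_fullFlag m) (fullFlag_zero_pos m) z, (modStd z.2).2)

theorem pairMod_coe (g : SLC (m + 1)) (b : Mat (m + 1)) :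
    pairMod (g.1, b) = (slAct (d := fullFlag m) g (modStd b).1, (modStd b).2) :=
  Prod.ext (pairQuiver_coe (d := fullFlag m) _ _ g b) rfl

theorem isRegularMap_pairMod : IsRegularMap (pairMod (m := m)) (slProd (borelSet (m + 1))) := by
  refine IsRegularMap.prodMk (isRegularMap_pairQuiver _ _ fun v hv j => ?_)
    (IsRegularMap.pi fun j => IsRegularMap.of_regularOn ?_)
  · rw [blockScalar_fullFlag]
    exact diag_ne_zero_of_mem_borelSet hv _
  · exact ((IsRegularMap.id _).snd.hasEntriesIn _ _).inv fun z hz =>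
      diag_ne_zero_of_mem_borelSet hz.2 _

theorem pairMod_mem_modSurjSol :
    Set.MapsTo pairMod (slProd (borelSet (m + 1))) (modSurjSol (fullFlag m)) := fun _ hz =>
  act_mem_modSurjSol (modStd_mem_modSurjSol hz.2) _

theorem modInv_pairMod {z : Mat (m + 1) × Mat (m + 1)} (hz : z ∈ slProd (borelSet (m + 1))) :
    modInv (pairMod z) = twistInv (fullFlag m) z := by
  obtain ⟨g, v, hv, rfl⟩ := exists_coe_of_mem_slProd hz
  rw [pairMod_coe, modInv_slAct (strictMono_fullFlag m).monotone (isStandard_modStd v),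
    modY_modStd hv]

theorem exists_hActMod_pairMod_eq (hs : s ∈ modSurjSol (fullFlag m)) :
    ∃ z ∈ slProd (borelSet (m + 1)), ∃ k : hGroup (fullFlag m), hActMod k (pairMod z) = s := by
  obtain ⟨g, k, hst, hk⟩ := exists_hAct_slAct_eq (strictMono_fullFlag m) hs.2.2
  have hmem := act_mem_modSurjSol hs g
  refine ⟨_, coe_mem_slProd (g (Fin.last m))⁻¹ (modY_mem_borelSet hmem hst), k, ?_⟩
  rw [pairMod_coe, modStd_modY hmem hst]
  exact Prod.ext hk rfl

theorem exists_hActMod_pairMod_eq_pairMod {z z' : Mat (m + 1) × Mat (m + 1)}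
    (hz : z ∈ slProd (borelSet (m + 1))) (hz' : z' ∈ slProd (borelSet (m + 1)))
    (h : twistInv (fullFlag m) z = twistInv (fullFlag m) z') :
    ∃ k : hGroup (fullFlag m), hActMod k (pairMod z) = pairMod z' := by
  have hd := strictMono_fullFlag m
  obtain ⟨g, v, hv, rfl⟩ := exists_coe_of_mem_slProd hz
  obtain ⟨g', v', -, rfl⟩ := exists_coe_of_mem_slProd hz'
  obtain ⟨p, hp⟩ := (twistInv_eq_iff hd (fullFlag_zero_pos m) g g' v v').1 h
  obtain ⟨k, hk⟩ := exists_hAct_slAct_cornerSL hd.monotone p g (modStd v).1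
  refine ⟨k, ?_⟩
  rw [← hp, twist, ← Matrix.SpecialLinearGroup.coe_mul, pairMod_coe, pairMod_coe,
    ← act_cornerSL_modStd p hv]
  exact Prod.ext hk rfl

theorem isConjStable_unimodularParabolic_borelSet (m : ℕ) :
    IsConjStable (unimodularParabolic (strictMono_fullFlag m).monotone) (borelSet (m + 1)) :=
  unimodularParabolic_fullFlag m ▸ isConjStable_unip_borelSet (m + 1)

theorem isGeometricQuotient_modQuiver (m : ℕ) :
    IsGeometricQuotient hActMod (modSurjSol (fullFlag m))
      (twistInv (fullFlag m) '' slProd (borelSet (m + 1))) modInv := by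
  have hd := strictMono_fullFlag m
  have h0 := fullFlag_zero_pos m
  have hF := isConjStable_unimodularParabolic_borelSet m
  refine isGeometricQuotient_transfer (φ := pairMod)
    (isQuasiAffine_image_twistInv hd h0 hF (isQuasiAffine_borelSet (m + 1)))
    (fun z hz => ?_) isQuasiAffine_modSurjSol
    (fun g h s => Prod.ext (act_mul g.1 h.1 s.1) rfl) (fun s => Prod.ext (act_one s.1) rfl)
    (fun g s hs => act_mem_modSurjSol hs g.1) isRegularMap_modInv
    (fun g s _ => modInv_hActMod g s) isRegularMap_pairMod pairMod_mem_modSurjSol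
    (fun _ => modInv_pairMod) (fun _ => exists_hActMod_pairMod_eq)
    fun _ hz _ hz' => exists_hActMod_pairMod_eq_pairMod hz hz'
  obtain ⟨c, σ, hc, hs, -⟩ := exists_isLocalSection_twistInv hd h0 hF z hz
  exact ⟨c, σ, hc, hs⟩

theorem isGeometricQuotient_twist_borelSet (m : ℕ) :
    IsGeometricQuotient (twist (unip (m + 1))) (slProd (borelSet (m + 1)))
      (twistInv (fullFlag m) '' slProd (borelSet (m + 1))) (twistInv (fullFlag m)) := by
  rw [← unimodularParabolic_fullFlag]
  exact isGeometricQuotient_twist (strictMono_fullFlag m) (fullFlag_zero_pos m)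
    (isConjStable_unimodularParabolic_borelSet m) (isQuasiAffine_borelSet _)

theorem isGeometricQuotient_twist_borelOneSet (m : ℕ) :
    IsGeometricQuotient (twist (unip (m + 1))) (slProd (borelOneSet m))
      (twistInv (fullFlag m) '' slProd (borelOneSet m)) (twistInv (fullFlag m)) := by
  have hd := strictMono_fullFlag m
  have h0 := fullFlag_zero_pos m
  rw [← unimodularParabolic_fullFlag, borelOneSet_eq_scalarBlock]
  exact isGeometricQuotient_twist hd h0 (isConjStable_scalarBlock hd h0)
    (isQuasiAffine_scalarBlock hd h0)

end ModifiedFullFlag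

/-! ## The covering `ρ` -/

section Rho

theorem ncard_setOf_pow_eq {n : ℕ} (hn : n ≠ 0) {a : ℂ} (ha : a ≠ 0) :
    {c : ℂ | c ^ n = a}.ncard = n := by
  have hζ := Complex.isPrimitiveRoot_exp n hn
  have h : {c : ℂ | c ^ n = a} = ((Polynomial.nthRoots n a).toFinset : Set ℂ) := by
    ext c
    simp [Polynomial.mem_nthRoots (Nat.pos_of_ne_zero hn)]
  rw [h, Set.ncard_coe_finset, Multiset.toFinset_card_of_nodup (hζ.nthRoots_nodup ha),
    hζ.card_nthRoots, if_pos (IsAlgClosed.exists_pow_nat_eq a (Nat.pos_of_ne_zero hn))]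

theorem exists_continuousAt_pow_mul_eq_one {X : Type*} [TopologicalSpace X] {f : X → ℂ}
    {n : ℕ} (hn : n ≠ 0) (hf : ∀ x, f x ≠ 0) {x₀ : X} (hcont : ContinuousAt f x₀) {c₀ : ℂ}
    (hc₀ : c₀ ^ n * f x₀ = 1) :
    ∃ c : X → ℂ, ContinuousAt c x₀ ∧ c x₀ = c₀ ∧ ∀ x, c x ^ n * f x = 1 := by
  refine ⟨fun x => c₀ * (f x₀ / f x) ^ ((n : ℂ)⁻¹), ?_, ?_, fun x => ?_⟩
  · refine continuousAt_const.mul (ContinuousAt.comp (g := fun w : ℂ => w ^ ((n : ℂ)⁻¹))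
      (continuousAt_cpow_const ?_) (continuousAt_const.div hcont (hf x₀)))
    rw [div_self (hf x₀)]
    exact Complex.one_mem_slitPlane
  · beta_reduce
    rw [div_self (hf x₀), Complex.one_cpow, mul_one]
  · rw [mul_pow, Complex.cpow_nat_inv_pow _ hn, mul_assoc, div_mul_cancel₀ _ (hf x), hc₀]

variable {m : ℕ}

theorem smul_coe_rho (b : borelSL (m + 1)) : b.1.1 0 0 • (rho m b).1.1 = b.1.1 :=
  smul_inv_smul₀ (borelSL_diag_ne_zero b 0) _

theorem leading_pow_mul_det_rho (b : borelSL (m + 1)) :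
    b.1.1 0 0 ^ (m + 1) * (rho m b).1.1.det = 1 := by
  have h := congrArg Matrix.det (smul_coe_rho b)
  rwa [det_smul, Fintype.card_fin, b.1.det_coe] at h

/-- The point `c • y` of the fibre of `ρ` over `y`. -/
def rhoLift (y : borelOne m) (c : ℂ) (hc : c ^ (m + 1) * y.1.1.det = 1) : borelSL (m + 1) :=
  ⟨⟨c • y.1.1, by rw [det_smul, Fintype.card_fin, hc]⟩, fun i j hij => by
    change c * y.1.1 i j = 0
    rw [y.2.1 hij, mul_zero]⟩

theorem leading_rhoLift (y : borelOne m) (c : ℂ) (hc : c ^ (m + 1) * y.1.1.det = 1) :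
    (rhoLift y c hc).1.1 0 0 = c := by
  change c * y.1.1 0 0 = c
  rw [y.2.2, mul_one]

theorem rho_rhoLift (y : borelOne m) (c : ℂ) (hc : c ^ (m + 1) * y.1.1.det = 1) :
    rho m (rhoLift y c hc) = y := by
  have hne : c ≠ 0 := ne_zero_pow m.succ_ne_zero (left_ne_zero_of_mul_eq_one hc)
  refine Subtype.ext (Units.ext ?_)
  change ((rhoLift y c hc).1.1 0 0)⁻¹ • (c • y.1.1) = y.1.1
  rw [leading_rhoLift, inv_smul_smul₀ hne]

theorem injOn_leading_rho_fibre (y : borelOne m) :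
    Set.InjOn (fun b : borelSL (m + 1) => b.1.1 0 0) (rho m ⁻¹' {y}) := by
  intro b hb b' hb' h
  refine Subtype.ext (Subtype.ext ?_)
  rw [← smul_coe_rho b, ← smul_coe_rho b', hb, hb']
  exact congrArg (· • y.1.1) h

theorem ncard_rho_fibre (y : borelOne m) : (rho m ⁻¹' {y}).ncard = m + 1 := by
  have hdet : y.1.1.det ≠ 0 := y.1.det_ne_zero
  rw [← (injOn_leading_rho_fibre y).ncard_image]
  refine Eq.trans (congrArg Set.ncard ?_) (ncard_setOf_pow_eq m.succ_ne_zero (inv_ne_zero hdet))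
  ext c
  constructor
  · rintro ⟨b, rfl, rfl⟩
    exact eq_inv_of_mul_eq_one_left (leading_pow_mul_det_rho b)
  · intro hc
    have hc' : c ^ (m + 1) * y.1.1.det = 1 := mul_eq_one_iff_eq_inv₀ hdet |>.2 hc
    exact ⟨rhoLift y c hc', rho_rhoLift y c hc', leading_rhoLift y c hc'⟩

/-- `ρ` as a homomorphism of groups. -/
def rhoHom (m : ℕ) : borelSL (m + 1) →* borelOne m :=
  MonoidHom.mk' (rho m) fun b b' => by
    refine Subtype.ext (Units.ext ?_)
    change ((b.1.1 * b'.1.1) 0 0)⁻¹ • (b.1.1 * b'.1.1) =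
      ((b.1.1 0 0)⁻¹ • b.1.1) * ((b'.1.1 0 0)⁻¹ • b'.1.1)
    rw [upper_mul_diag b.2 b'.2, Matrix.smul_mul, Matrix.mul_smul, smul_smul, mul_inv]

theorem continuous_rho : Continuous (rho m) := by
  have hval : Continuous fun b : borelSL (m + 1) => (rho m b).1.1 := by
    have hb : Continuous fun b : borelSL (m + 1) => b.1.1 :=
      continuous_subtype_val.comp continuous_subtype_val
    exact ((hb.matrix_elem 0 0).inv₀ fun b => borelSL_diag_ne_zero b 0).smul hb
  refine Continuous.subtype_mk (Units.continuous_iff.2 ⟨hval, ?_⟩) _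
  have h : (fun b : borelSL (m + 1) => ((rho m b).1⁻¹).1) = fun b => (rho m b⁻¹).1.1 :=
    funext fun b => congrArg (fun y : borelOne m => y.1.1) (map_inv (rhoHom m) b).symm
  exact h ▸ hval.comp continuous_inv

theorem isOpenMap_rho : IsOpenMap (rho m) := by
  refine IsOpenMap.of_sections fun b => ?_
  have hval : Continuous fun y : borelOne m => y.1.1 :=
    Units.continuous_val.comp continuous_subtype_val
  obtain ⟨c, hcont, hcb, hc⟩ := exists_continuousAt_pow_mul_eq_one m.succ_ne_zero
    (fun y : borelOne m => y.1.det_ne_zero) hval.matrix_det.continuousAt (leading_pow_mul_det_rho b)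
  refine ⟨fun y => rhoLift y (c y) (hc y), ?_, Subtype.ext (Subtype.ext ?_),
    fun y => rho_rhoLift y (c y) (hc y)⟩
  · exact Topology.IsInducing.subtypeVal.continuousAt_iff.2
      (Matrix.SpecialLinearGroup.isClosedEmbedding_val.isInducing.continuousAt_iff.2
        (hcont.smul hval.continuousAt))
  · change c (rho m b) • (rho m b).1.1 = _
    rw [hcb, smul_coe_rho]

theorem rho_surjective (m : ℕ) : Function.Surjective (rho m) := fun y => by
  have h : (rho m ⁻¹' {y}).Nonempty := Set.nonempty_of_ncard_ne_zero (by
    rw [ncard_rho_fibre]; exact m.succ_ne_zero)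
  exact h

theorem isCoveringMap_rho (m : ℕ) : IsCoveringMap (rho m) := by
  have hq : Topology.IsQuotientMap (rhoHom m) :=
    isOpenMap_rho.isQuotientMap continuous_rho (rho_surjective m)
  refine (hq.isQuotientCoveringMap_of_isDiscrete_ker_monoidHom
    (Set.Finite.isDiscrete ?_)).isCoveringMap
  refine Set.finite_of_ncard_ne_zero (s := rho m ⁻¹' {1}) ?_
  rw [ncard_rho_fibre]
  exact m.succ_ne_zero

end Rho

/-! ## The map of quotients induced by `ρ` -/

section QuotientRho

variable {m : ℕ}

theorem twistInv_injective_right {d : Fin (m + 1) → ℕ} (g : SLC (d (Fin.last m))) :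
    Function.Injective fun v => twistInv d (g.1, v) := fun v v' h => by
  simp only [twistInv_coe, Prod.mk.injEq, and_true] at h
  have := congrArg (fun M => (g⁻¹).1 * M * g.1) h
  simpa only [Matrix.mul_assoc, coe_inv_mul_cancel_left, coe_inv_mul_coe, Matrix.mul_one] using this

/-- The map `(g, b) ↦ (g, ρ(b))` followed by the quotient map. -/
def rhoTwistInv (z : Mat (m + 1) × Mat (m + 1)) : InvSpace (fullFlag m) :=
  twistInv (fullFlag m) (z.1, (z.2 0 0)⁻¹ • z.2)

theorem isMorphism_rhoTwistInv (m : ℕ) : IsMorphism rhoTwistInv (slProd (borelSet (m + 1)))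
    (twistInv (fullFlag m) '' slProd (borelOneSet m)) := by
  refine ⟨?_, ?_⟩
  · intro z hz
    obtain ⟨g, _, ⟨b, rfl⟩, rfl⟩ := exists_coe_of_mem_slProd hz
    exact ⟨_, coe_mem_slProd g ⟨rho m b, rfl⟩, rfl⟩
  · have h := IsRegularMap.id (slProd (borelSet (m + 1)))
    exact (isRegularMap_twistInv (d := fullFlag m) Set.univ).comp (h.fst.prodMk
      (IsRegularMap.smul ((h.snd.hasEntriesIn 0 0).inv fun z hz =>
        diag_ne_zero_of_mem_borelSet hz.2 0) h.snd)) fun _ _ => trivial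

theorem rhoTwistInv_twist (p : unimodularParabolic (strictMono_fullFlag m).monotone)
    {z : Mat (m + 1) × Mat (m + 1)} (hz : z ∈ slProd (borelSet (m + 1))) :
    rhoTwistInv (twist _ p z) = rhoTwistInv z := by
  obtain ⟨g, b, hb, rfl⟩ := exists_coe_of_mem_slProd hz
  refine Eq.trans ?_ (twistInv_twist (d := fullFlag m) _ p g ((b 0 0)⁻¹ • b))
  exact congrArg (fun v => twistInv (fullFlag m) ((twist _ p (g.1, b)).1, v))
    (inv_smul_conj (mem_unip_of_mem_unimodularParabolic p) (mem_borelSet_iff.1 hb).1 0)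

theorem exists_rho_quotient (m : ℕ) : ∃ κ : InvSpace (fullFlag m) → InvSpace (fullFlag m),
    IsMorphism κ (twistInv (fullFlag m) '' slProd (borelSet (m + 1)))
      (twistInv (fullFlag m) '' slProd (borelOneSet m)) ∧
    ∀ (g : SLC (m + 1)) (b : borelSL (m + 1)),
      κ (twistInv (fullFlag m) (g.1, b.1.1)) = twistInv (fullFlag m) (g.1, (rho m b).1.1) := by
  obtain ⟨κ, hκ, h⟩ := (isGeometricQuotient_twist (strictMono_fullFlag m) (fullFlag_zero_pos m)
    (isConjStable_unimodularParabolic_borelSet m) (isQuasiAffine_borelSet (m + 1))).exists_descent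
    (isMorphism_rhoTwistInv m) fun p _ => rhoTwistInv_twist p
  exact ⟨κ, hκ, fun g b => h _ (coe_mem_slProd g ⟨b, rfl⟩)⟩

theorem exists_rho_eq_of_twistInv_eq {g g' : SLC (m + 1)} {b : borelSL (m + 1)} {y : borelOne m}
    (h : twistInv (fullFlag m) (g'.1, (rho m b).1.1) = twistInv (fullFlag m) (g.1, y.1.1)) :
    ∃ b' : borelSL (m + 1), rho m b' = y ∧
      twistInv (fullFlag m) (g.1, b'.1.1) = twistInv (fullFlag m) (g'.1, b.1.1) := by
  have hd := strictMono_fullFlag m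
  obtain ⟨p, hp⟩ := (twistInv_eq_iff hd (fullFlag_zero_pos m) g' g _ _).1 h
  have hpu := mem_unip_of_mem_unimodularParabolic p
  obtain ⟨b', hb'⟩ := isConjStable_unimodularParabolic_borelSet m p.1 p.2 b.1.1 ⟨b, rfl⟩
  have hb' : b'.1.1 = (twist _ p (g'.1, b.1.1)).2 := hb'
  refine ⟨b', Subtype.ext (Units.ext ?_), ?_⟩
  · refine Eq.trans ?_ (congrArg Prod.snd hp)
    change (b'.1.1 0 0)⁻¹ • b'.1.1 = _
    rw [hb']
    exact inv_smul_conj hpu b.2 0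
  · rw [← twistInv_twist hd.monotone p g' b.1.1]
    exact congrArg (twistInv (fullFlag m)) (Prod.ext (congrArg Prod.fst hp).symm hb')

variable {κ : InvSpace (fullFlag m) → InvSpace (fullFlag m)}
  (hκ : ∀ (g : SLC (m + 1)) (b : borelSL (m + 1)),
    κ (twistInv (fullFlag m) (g.1, b.1.1)) = twistInv (fullFlag m) (g.1, (rho m b).1.1))

include hκ

theorem rho_quotient_modInv {s : QuiverRep (fullFlag m) × (Fin (m + 1) → ℂ)}
    (hs : s ∈ modSurjSol (fullFlag m)) : κ (modInv s) = quiverInv s.1 := by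
  obtain ⟨z, hz, k, rfl⟩ := exists_hActMod_pairMod_eq hs
  obtain ⟨g, b, ⟨b, rfl⟩, rfl⟩ := exists_coe_of_mem_slProd hz
  have hb : b.1.1 ∈ borelSet (m + 1) := ⟨b, rfl⟩
  rw [modInv_hActMod, modInv_pairMod hz, hκ, pairMod_coe]
  change _ = quiverInv (hAct k (slAct (d := fullFlag m) g (modStd b.1.1).1))
  rw [quiverInv_hAct, quiverInv_slAct (strictMono_fullFlag m).monotone (isStandard_modStd _),
    lastY_modStd hb]
  rfl

theorem ncard_rho_quotient_fibre {z : InvSpace (fullFlag m)}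
    (hz : z ∈ twistInv (fullFlag m) '' slProd (borelOneSet m)) :
    (twistInv (fullFlag m) '' slProd (borelSet (m + 1)) ∩ κ ⁻¹' {z}).ncard = m + 1 := by
  obtain ⟨_, hz, rfl⟩ := hz
  obtain ⟨g, _, ⟨y, rfl⟩, rfl⟩ := exists_coe_of_mem_slProd hz
  have hinj : Function.Injective fun b : borelSL (m + 1) =>
      twistInv (fullFlag m) (g.1, b.1.1) := fun b b' h =>
    Subtype.ext (Subtype.ext (twistInv_injective_right (d := fullFlag m) g h))
  refine Eq.trans (congrArg Set.ncard ?_)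
    ((Set.ncard_image_of_injective (rho m ⁻¹' {y}) hinj).trans (ncard_rho_fibre y))
  ext w
  constructor
  · rintro ⟨⟨z, hz, rfl⟩, h⟩
    obtain ⟨g', _, ⟨b, rfl⟩, rfl⟩ := exists_coe_of_mem_slProd hz
    exact exists_rho_eq_of_twistInv_eq ((hκ g' b).symm.trans h)
  · rintro ⟨b, rfl, rfl⟩
    exact ⟨⟨_, coe_mem_slProd g ⟨b, rfl⟩, rfl⟩, hκ g b⟩

end QuotientRho

end

end MultQuiver

theorem mainTheorem2 :
    -- the full flag case, `n = m + 1`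
    (∀ m : ℕ,
      -- quivers in standard form correspond to `B_1`, resp. `B` for the modified equations
      Set.BijOn lastY {x | x ∈ surjSol (fullFlag m) ∧ IsStandard x} (borelOneSet m) ∧
      Set.BijOn (fun s : QuiverRep (fullFlag m) × (Fin (m + 1) → ℂ) =>
          (s.2 (Fin.last m))⁻¹ • lastY s.1)
        {s | s ∈ modSurjSol (fullFlag m) ∧ IsStandard s.1} (borelSet (m + 1)) ∧
      -- `ρ : B → B_1` is an `n`-fold cover
      IsCoveringMap (rho m) ∧
      (∀ y : borelOne m, (rho m ⁻¹' {y}).ncard = m + 1) ∧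
      ∃ (k l : ℕ) (Z : Set (Fin k → ℂ)) (Z' : Set (Fin l → ℂ))
        (π₁ : Mat (m + 1) × Mat (m + 1) →
          Fin k → ℂ)
        (π₂ : QuiverRep (fullFlag m) → Fin k → ℂ)
        (π₁' : Mat (m + 1) × Mat (m + 1) →
          Fin l → ℂ)
        (π₂' : QuiverRep (fullFlag m) × (Fin (m + 1) → ℂ) → Fin l → ℂ)
        (κ : (Fin l → ℂ) → Fin k → ℂ),
        -- `Z` is both `SL(n, ℂ) ×_N B_1` and the space of surjective quivers modulo `H_ℂ`
        IsGeometricQuotient (twist (unip (m + 1))) (slProd (borelOneSet m)) Z π₁ ∧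
        IsGeometricQuotient hAct (surjSol (fullFlag m)) Z π₂ ∧
        (∀ (g : SLC (m + 1)), ∀ x ∈ surjSol (fullFlag m),
          IsStandard x → π₂ (slAct g x) = π₁ ((g : Mat (m + 1)), lastY x)) ∧
        -- `Z'` is both `SL(n, ℂ) ×_N B` and the space of surjective solutions of the modified
        -- equations modulo `H_ℂ`
        IsGeometricQuotient (twist (unip (m + 1))) (slProd (borelSet (m + 1))) Z' π₁' ∧
        IsGeometricQuotient hActMod (modSurjSol (fullFlag m)) Z' π₂' ∧
        (∀ (g : SLC (m + 1)), ∀ s ∈ modSurjSol (fullFlag m),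
          IsStandard s.1 →
            π₂' (slAct g s.1, s.2) = π₁' ((g : Mat (m + 1)), (s.2 (Fin.last m))⁻¹ • lastY s.1)) ∧
        -- forgetting the scalars corresponds to `ρ`, and is `n`-to-one
        IsMorphism κ Z' Z ∧
        (∀ s ∈ modSurjSol (fullFlag m), s.1 ∈ surjSol (fullFlag m) ∧ κ (π₂' s) = π₂ s.1) ∧
        (∀ (g : SLC (m + 1)) (b : borelSL (m + 1)),
          κ (π₁' ((g : Mat (m + 1)), (b.1 : Mat (m + 1)))) = π₁ ((g : Mat (m + 1)), ((rho m b).1 : Mat (m + 1)))) ∧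
        ∀ z ∈ Z, (Z' ∩ κ ⁻¹' {z}).ncard = m + 1) ∧
    -- the case of a general dimension vector `d 0 < d 1 < … < d m = n`
    (∀ (m : ℕ) (d : Fin (m + 1) → ℕ), StrictMono d → 0 < d 0 →
      Set.BijOn lastY {x | x ∈ surjSol d ∧ IsStandard x} (scalarBlock d) ∧
      ∃ (k : ℕ) (Z : Set (Fin k → ℂ))
        (π₁ : Mat (d (Fin.last m)) ×
          Mat (d (Fin.last m)) → Fin k → ℂ)
        (π₂ : QuiverRep d → Fin k → ℂ),
        -- `Z` is both `SL(n, ℂ) ×_{[P,P]} 𝒫` and the space of surjective quivers modulo `H_ℂ`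
        IsGeometricQuotient (twist ⁅parabolic d, parabolic d⁆) (slProd (scalarBlock d)) Z π₁ ∧
        IsGeometricQuotient hAct (surjSol d) Z π₂ ∧
        ∀ (g : SLC (d (Fin.last m))), ∀ x ∈ surjSol d,
          IsStandard x → π₂ (slAct g x) = π₁ ((g : Mat (d (Fin.last m))), lastY x)) := by
  refine ⟨fun m => ?_, fun m d hd h0 => ⟨bijOn_lastY hd h0, ?_⟩⟩
  · have hd := strictMono_fullFlag m
    have h0 := fullFlag_zero_pos m
    have hB := borelOneSet_eq_scalarBlock m
    let e := (Module.finBasis ℂ (InvSpace (fullFlag m))).equivFun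
    obtain ⟨κ, hκ, hκρ⟩ := exists_rho_quotient m
    exact ⟨hB ▸ bijOn_lastY hd h0, bijOn_modY m, isCoveringMap_rho m, ncard_rho_fibre, _, _, _, _,
      fun z => e (twistInv _ z), fun x => e (quiverInv x), fun z => e (twistInv _ z),
      fun s => e (modInv s), fun w => e (κ (e.symm w)),
      (isGeometricQuotient_twist_borelOneSet m).linearEquiv_comp e,
      hB ▸ (isGeometricQuotient_quiver hd h0).linearEquiv_comp e,
      fun g x _ hx => congrArg e (quiverInv_slAct hd.monotone hx g),
      (isGeometricQuotient_twist_borelSet m).linearEquiv_comp e,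
      (isGeometricQuotient_modQuiver m).linearEquiv_comp e,
      fun g s _ hs => congrArg e (modInv_slAct hd.monotone hs g), hκ.linearEquiv_conj e e,
      fun s hs => ⟨fst_mem_surjSol hs, congrArg e
        ((congrArg κ (e.symm_apply_apply _)).trans (rho_quotient_modInv hκρ hs))⟩,
      fun g b => congrArg e ((congrArg κ (e.symm_apply_apply _)).trans (hκρ g b)),
      Set.forall_mem_image.2 fun z hz => (ncard_fibre_equiv_conj e.toEquiv e.injective κ _ z).trans
        (ncard_rho_quotient_fibre hκρ hz)⟩
  · let e := (Module.finBasis ℂ (InvSpace d)).equivFun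
    exact ⟨_, _, fun z => e (twistInv d z), fun x => e (quiverInv x),
      (isGeometricQuotient_twist_commutator hd h0).linearEquiv_comp e,
      (isGeometricQuotient_quiver hd h0).linearEquiv_comp e,
      fun g x _ hx => congrArg e (quiverInv_slAct hd.monotone hx g)⟩
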